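/- Let $c\in\mathbb R$ and let $(N^4,\tilde g)$ be a smooth Riemannian manifold of dimension $4$ with constant sectional curvature $c$ (a space form $N^4(c)$). Let $(M^3,g)$ be a connected smooth Riemannian manifold of dimension $3$ and $\phi:M^3\to N^4(c)$ a smooth isometric immersion, with tension field $\tau=\operatorname{trace}\nabla d\phi$. Suppose that $\phi$ is biconservative, i.e. $\operatorname{div} S_2=0$ on $M$, where $$S_2(X,Y)=\tfrac12|\tau|^2\langle X,Y\rangle+\langle d\phi,\nabla\tau\rangle\langle X,Y\rangle-\langle d\phi(X),\nabla_Y\tau\rangle-\langle d\phi(Y),\nabla_X\tau\rangle$$ is the stress-energy tensor of the bienergy, and that the scalar curvature of $(M^3,g)$ is constant. Then $M^3$ has constant mean curvature: with $H=\tfrac13\operatorname{trace}A_\nu$ denoting the mean curvature with respect to a unit normal $\nu$ (so that $H$ is determined up to sign), $|H|$ is constant on $M$, and for every continuous unit normal field $\nu$ along $\phi$ the function $H$ is constant on $M$. -/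

import Mathlib

open scoped ContDiff Manifold

noncomputable section

namespace Biconservative

/-! ### Calculus of Riemannian metrics in local coordinates

A metric on a domain of `ℝⁿ` is given by its matrix of coefficients `g x i j = g(∂ᵢ, ∂ⱼ)`. -/

/-- The coordinate space `ℝⁿ`, on which `n`-dimensional manifolds are modelled. -/
abbrev E (n : ℕ) : Type := EuclideanSpace ℝ (Fin n)

/-- The partial derivative `∂f/∂xⁱ` at `x`. -/
def pd {n : ℕ} (i : Fin n) (f : E n → ℝ) (x : E n) : ℝ :=
  fderiv ℝ f x (EuclideanSpace.single i 1)

/-- The Christoffel symbol `Γᵏᵢⱼ` of the Levi-Civita connection of `g`: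
`∇_{∂ᵢ} ∂ⱼ = ∑ₖ Γᵏᵢⱼ ∂ₖ`. -/
def christoffel {n : ℕ} (g : E n → Matrix (Fin n) (Fin n) ℝ) (k i j : Fin n) (x : E n) : ℝ :=
  (1 / 2 : ℝ) * ∑ l, (g x)⁻¹ k l *
    (pd i (fun y => g y j l) x + pd j (fun y => g y i l) x - pd l (fun y => g y i j) x)

/-- The components of the curvature tensor
`R(X,Y)Z = ∇_X ∇_Y Z - ∇_Y ∇_X Z - ∇_{[X,Y]} Z`, namely
`R(∂ᵢ, ∂ⱼ) ∂ₖ = ∑ₗ (curvature g l i j k) ∂ₗ`. -/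
def curvature {n : ℕ} (g : E n → Matrix (Fin n) (Fin n) ℝ) (l i j k : Fin n) (x : E n) : ℝ :=
  pd i (christoffel g l j k) x - pd j (christoffel g l i k) x
    + ∑ m, (christoffel g l i m x * christoffel g m j k x
        - christoffel g l j m x * christoffel g m i k x)

/-- The scalar product `g(u, v)` at `x` of two vectors given by their components. -/
def dot {n : ℕ} (g : E n → Matrix (Fin n) (Fin n) ℝ) (x : E n) (u v : Fin n → ℝ) : ℝ :=
  ∑ a, ∑ b, g x a b * u a * v b

/-- The components of `R(u, v) w` at `x`. -/
def curvatureVec {n : ℕ} (g : E n → Matrix (Fin n) (Fin n) ℝ) (x : E n) (u v w : Fin n → ℝ) :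
    Fin n → ℝ :=
  fun l => ∑ i, ∑ j, ∑ k, curvature g l i j k x * u i * v j * w k

/-- The scalar curvature `∑ gʲᵏ Ricⱼₖ`, where `Ric(Y,Z) = trace (X ↦ R(X,Y)Z)`. -/
def scalarCurvature {n : ℕ} (g : E n → Matrix (Fin n) (Fin n) ℝ) (x : E n) : ℝ :=
  ∑ j, ∑ k, (g x)⁻¹ j k * ∑ i, curvature g i i j k x

/-! Maps `F` from a domain of `ℝᵐ` with metric `g` to a domain of `ℝⁿ` with metric `h`. Vector
fields along `F` are given by their components `V x a`. -/

/-- The components of `dF(∂ᵢ)`. -/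
def dmap {m n : ℕ} (F : E m → E n) (i : Fin m) (x : E m) : Fin n → ℝ :=
  fun a => pd i (fun y => F y a) x

/-- The components of the covariant derivative `∇_{∂ᵢ} V` of a vector field `V` along `F`, with
respect to the pull-back by `F` of the Levi-Civita connection of `h`. -/
def covAlong {m n : ℕ} (h : E n → Matrix (Fin n) (Fin n) ℝ) (F : E m → E n)
    (V : E m → Fin n → ℝ) (i : Fin m) (x : E m) : Fin n → ℝ :=
  fun a => pd i (fun y => V y a) x
    + ∑ b, ∑ d, christoffel h a b d (F x) * dmap F i x b * V x d

/-- The components of the second fundamental form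
`(∇dF)(∂ᵢ, ∂ⱼ) = ∇_{∂ᵢ}(dF(∂ⱼ)) - dF(∇_{∂ᵢ} ∂ⱼ)`. -/
def secondForm {m n : ℕ} (g : E m → Matrix (Fin m) (Fin m) ℝ)
    (h : E n → Matrix (Fin n) (Fin n) ℝ) (F : E m → E n) (i j : Fin m) (x : E m) : Fin n → ℝ :=
  fun a => covAlong h F (dmap F j) i x a - ∑ k, christoffel g k i j x * dmap F k x a

/-- The tension field `τ(F) = trace ∇dF`. -/
def tension {m n : ℕ} (g : E m → Matrix (Fin m) (Fin m) ℝ)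
    (h : E n → Matrix (Fin n) (Fin n) ℝ) (F : E m → E n) (x : E m) : Fin n → ℝ :=
  fun a => ∑ i, ∑ j, (g x)⁻¹ i j * secondForm g h F i j x a

/-- The components `S₂(∂ᵢ, ∂ⱼ)` of the stress-energy tensor of the bienergy:
`S₂(X,Y) = ½|τ|²⟨X,Y⟩ + ⟨dF,∇τ⟩⟨X,Y⟩ - ⟨dF(X),∇_Y τ⟩ - ⟨dF(Y),∇_X τ⟩`. -/
def stressBienergy {m n : ℕ} (g : E m → Matrix (Fin m) (Fin m) ℝ)
    (h : E n → Matrix (Fin n) (Fin n) ℝ) (F : E m → E n) (i j : Fin m) (x : E m) : ℝ :=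
  ((1 / 2 : ℝ) * dot h (F x) (tension g h F x) (tension g h F x)
      + ∑ k, ∑ l, (g x)⁻¹ k l *
          dot h (F x) (dmap F k x) (covAlong h F (tension g h F) l x)) * g x i j
    - dot h (F x) (dmap F i x) (covAlong h F (tension g h F) j x)
    - dot h (F x) (dmap F j x) (covAlong h F (tension g h F) i x)

/-- The components of the divergence of a symmetric 2-tensor `S`:
`(div S)(∂ⱼ) = ∑ gⁱᵏ (∇_{∂ₖ} S)(∂ᵢ, ∂ⱼ)`. -/
def divergence {m : ℕ} (g : E m → Matrix (Fin m) (Fin m) ℝ)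
    (S : Fin m → Fin m → E m → ℝ) (j : Fin m) (x : E m) : ℝ :=
  ∑ i, ∑ k, (g x)⁻¹ i k *
    (pd k (S i j) x
      - ∑ l, (christoffel g l k i x * S l j x + christoffel g l k j x * S i l x))

/-- The mean curvature `H = (1/m) trace A_ν` with respect to a normal vector with components `ν`,
where `⟨A_ν X, Y⟩ = ⟨(∇dF)(X,Y), ν⟩`. -/
def meanCurvature {m n : ℕ} (g : E m → Matrix (Fin m) (Fin m) ℝ)
    (h : E n → Matrix (Fin n) (Fin n) ℝ) (F : E m → E n) (x : E m) (ν : Fin n → ℝ) : ℝ :=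
  (1 / m : ℝ) * ∑ i, ∑ j, (g x)⁻¹ i j * dot h (F x) (secondForm g h F i j x) ν

/-! ### Riemannian manifolds and isometric immersions

All the conditions below are tensorial, hence independent of the charts in which they are
expressed; they are required in all charts of the smooth structure. -/

/-- Smooth Riemannian metrics on the smooth `n`-manifold `M`. -/
abbrev Metric (n : ℕ) (M : Type*) [TopologicalSpace M] [ChartedSpace (E n) M]
    [IsManifold (𝓡 n) ∞ M] : Type _ :=
  Bundle.ContMDiffRiemannianMetric (𝓡 n) ∞ (E n) (fun p : M => TangentSpace (𝓡 n) p)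

section Manifold

variable {m n : ℕ}
  {M : Type*} [TopologicalSpace M] [ChartedSpace (E m) M] [IsManifold (𝓡 m) ∞ M]
  {N : Type*} [TopologicalSpace N] [ChartedSpace (E n) N] [IsManifold (𝓡 n) ∞ N]

/-- The coefficients `g(∂ᵢ, ∂ⱼ)` of the metric `g` in the chart `e`, as functions of the
coordinates. They are meaningful on `e.target`. -/
def coeff (g : Metric n N) (e : OpenPartialHomeomorph N (E n)) (x : E n) :
    Matrix (Fin n) (Fin n) ℝ :=
  Matrix.of fun i j => g.inner (e.symm x)
    (mfderiv (𝓡 n) (𝓡 n) e.symm x (EuclideanSpace.single i (1 : ℝ) : E n))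
    (mfderiv (𝓡 n) (𝓡 n) e.symm x (EuclideanSpace.single j (1 : ℝ) : E n))

/-- The Riemannian manifold `(N, g)` has constant sectional curvature `c`: for all tangent vectors
`u`, `v` at a point, `⟨R(u,v)v, u⟩ = c (|u|²|v|² - ⟨u,v⟩²)`. -/
def HasConstantSectionalCurvature (g : Metric n N) (c : ℝ) : Prop :=
  ∀ e ∈ IsManifold.maximalAtlas (𝓡 n) ∞ N, ∀ x ∈ e.target, ∀ u v : Fin n → ℝ,
    dot (coeff g e) x (curvatureVec (coeff g e) x u v v) u
      = c * (dot (coeff g e) x u u * dot (coeff g e) x v v - dot (coeff g e) x u v ^ 2)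

/-- The scalar curvature of the Riemannian manifold `(M, g)` is constant. -/
def HasConstantScalarCurvature (g : Metric m M) : Prop :=
  ∃ R : ℝ, ∀ e ∈ IsManifold.maximalAtlas (𝓡 m) ∞ M, ∀ x ∈ e.target,
    scalarCurvature (coeff g e) x = R

/-- `φ : (M, g) → (N, h)` is a (smooth) isometric immersion. -/
structure IsIsometricImmersion (g : Metric m M) (h : Metric n N) (φ : M → N) : Prop where
  contMDiff : ContMDiff (𝓡 m) (𝓡 n) ∞ φ
  inner_eq : ∀ (p : M) (v w : TangentSpace (𝓡 m) p),
    h.inner (φ p) (mfderiv (𝓡 m) (𝓡 n) φ p v) (mfderiv (𝓡 m) (𝓡 n) φ p w) = g.inner p v w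

/-- The coordinate expression of `φ` in charts `e` of the source and `e'` of the target. -/
def localRep (φ : M → N) (e : OpenPartialHomeomorph M (E m)) (e' : OpenPartialHomeomorph N (E n)) :
    E m → E n :=
  fun x => e' (φ (e.symm x))

/-- `φ` is biconservative: `div S₂ = 0`. -/
def IsBiconservative (g : Metric m M) (h : Metric n N) (φ : M → N) : Prop :=
  ∀ e ∈ IsManifold.maximalAtlas (𝓡 m) ∞ M, ∀ e' ∈ IsManifold.maximalAtlas (𝓡 n) ∞ N,
    ∀ p ∈ e.source, φ p ∈ e'.source → ∀ j : Fin m,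
      divergence (coeff g e) (stressBienergy (coeff g e) (coeff h e') (localRep φ e e')) j (e p) = 0

/-- `ν` is a unit vector normal to `φ` at `p`. -/
def IsUnitNormal (h : Metric n N) (φ : M → N) (p : M) (ν : TangentSpace (𝓡 n) (φ p)) : Prop :=
  h.inner (φ p) ν ν = 1 ∧
    ∀ v : TangentSpace (𝓡 m) p, h.inner (φ p) ν (mfderiv (𝓡 m) (𝓡 n) φ p v) = 0

/-- The mean curvature of `φ` at `p` with respect to the vector `ν` normal to `φ` at `p`, computed
in charts `e` around `p` and `e'` around `φ p`. -/
def meanCurvatureAt (g : Metric m M) (h : Metric n N) (φ : M → N)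
    (e : OpenPartialHomeomorph M (E m)) (e' : OpenPartialHomeomorph N (E n))
    (p : M) (ν : TangentSpace (𝓡 n) (φ p)) : ℝ :=
  meanCurvature (coeff g e) (coeff h e') (localRep φ e e') (e p)
    (fun a => (show E n from mfderiv (𝓡 n) (𝓡 n) e' (φ p) ν) a)

/-- The hypersurface `φ : (M, g) → (N, h)` has constant mean curvature. The unit normal is
determined up to sign at each point and need not exist globally, so that the mean curvature `H` is
determined up to sign: `|H|` is constant and, for every continuous unit normal field along `φ`,
the function `H` is itself constant. -/
def HasConstantMeanCurvature (g : Metric m M) (h : Metric n N) (φ : M → N) : Prop :=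
  (∃ H₀ : ℝ, ∀ (p : M) (ν : TangentSpace (𝓡 n) (φ p)), IsUnitNormal (m := m) h φ p ν →
    ∀ e ∈ IsManifold.maximalAtlas (𝓡 m) ∞ M, ∀ e' ∈ IsManifold.maximalAtlas (𝓡 n) ∞ N,
      p ∈ e.source → φ p ∈ e'.source → |meanCurvatureAt g h φ e e' p ν| = H₀) ∧
  ∀ ξ : (p : M) → TangentSpace (𝓡 n) (φ p),
    Continuous (fun p => (⟨φ p, ξ p⟩ : TangentBundle (𝓡 n) N)) →
    (∀ p, IsUnitNormal (m := m) h φ p (ξ p)) →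
    ∃ H₀ : ℝ, ∀ p : M,
      ∀ e ∈ IsManifold.maximalAtlas (𝓡 m) ∞ M, ∀ e' ∈ IsManifold.maximalAtlas (𝓡 n) ∞ N,
        p ∈ e.source → φ p ∈ e'.source → meanCurvatureAt g h φ e e' p (ξ p) = H₀

end Manifold

end Biconservative

end

/-!
# Biconservative hypersurfaces of constant scalar curvature in `N⁴(c)`

Let `A` be the shape operator of the hypersurface and `f = trace A = 3H`. The tangent part of the
divergence of the stress-energy tensor, computed with the traced Codazzi equation, shows that a
biconservative hypersurface satisfies `A (grad f) = -(f / 2) grad f` (`IsNormal.sf_grad`). The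
contracted Gauss equation (`IsNormal.scal_eq`) shows that a constant scalar curvature `R` amounts
to `|A|² = f² + 2κ` with `2κ = 6c - R`. Suppose that `grad f ≠ 0` at some point. Then
`t = -f / 2` is a principal curvature in the direction `e₀` of `grad f`, and the two others are the
roots of `x² + 3 t x + 3 t² - κ`. Away from the values of `f²` for which two of the three
coincide, there is a smooth orthonormal frame of principal directions. The Codazzi equations
determine its connection coefficients up to `u = ⟨∇_{e₁} e₀, e₁⟩` and `v = ⟨∇_{e₂} e₀, e₂⟩`, and
the Gauss equations become ordinary differential equations in the direction `e₀`
(`PrincipalFrame.false`). Eliminating `u`, `v` and the derivatives of `t` leaves a polynomial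
equation in `t` with constant coefficients and leading term `-189 t¹⁰`
(`principal_ode_contradiction`), which contradicts `e₀ t ≠ 0`. Hence wherever `grad f ≠ 0` the
function `f²` takes one of two values, which is impossible on an open set; so `f²` is locally
constant (`pd_normSq_tension_eq_zero`), hence constant as `M` is connected.

This calculus is carried out with germs. The ring `SmoothGerm x` of germs of smooth functions at `x`
carries the commuting derivations `∂ᵢ`; a germ with nonzero value is invertible, and a germ with
positive value is a square, which is all that is needed to build orthonormal and principal frames.
The vector fields along an immersion form a module over this ring with a metric connection
(`ConnectionAlong`), and the equations of Gauss, Codazzi and Weingarten are derived for any such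
module. The coordinate formulas for the Christoffel symbols, the second fundamental form, the
tension field, etc. are identified with these abstract notions through `SmoothGerm.Rep`.

The mean curvature is expressed in charts. It does not depend on them because of the formula
for the second fundamental form of a composition (`IsIsometricAt.secondForm_comp`) and because
isometries between manifolds of the same dimension, such as changes of charts, are totally geodesic.
-/

noncomputable section

namespace Biconservative
open Filter Topology

/-! ### Germs of smooth functions -/

theorem contDiffAt_pd {n : ℕ} {f : E n → ℝ} {x : E n} (hf : ContDiffAt ℝ ∞ f x) (i : Fin n) :
    ContDiffAt ℝ ∞ (pd i f) x := by
  have h1 : ContDiffAt ℝ ∞ (fderiv ℝ f) x := hf.fderiv_right (by norm_num)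
  exact h1.clm_apply contDiffAt_const

theorem pd_eventuallyEq {n : ℕ} {f g : E n → ℝ} {x : E n} (h : f =ᶠ[𝓝 x] g) (i : Fin n) :
    pd i f =ᶠ[𝓝 x] pd i g := by
  filter_upwards [h.fderiv (𝕜 := ℝ)] with y hy
  simp only [pd, hy]

theorem eventually_differentiableAt {n k : ℕ} {f : E n → E k} {x : E n}
    (hf : ContDiffAt ℝ ∞ f x) : ∀ᶠ y in 𝓝 x, DifferentiableAt ℝ f y := by
  have h1 : ContDiffAt ℝ 1 f x := hf.of_le (by exact_mod_cast le_top)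
  filter_upwards [h1.eventually (by simp)] with y hy
  exact hy.differentiableAt one_ne_zero

theorem eventually_differentiableAt_real {n : ℕ} {f : E n → ℝ} {x : E n}
    (hf : ContDiffAt ℝ ∞ f x) : ∀ᶠ y in 𝓝 x, DifferentiableAt ℝ f y := by
  have h1 : ContDiffAt ℝ 1 f x := hf.of_le (by exact_mod_cast le_top)
  filter_upwards [h1.eventually (by simp)] with y hy
  exact hy.differentiableAt one_ne_zero

theorem pd_pd_comm {n : ℕ} {f : E n → ℝ} {x : E n} (hf : ContDiffAt ℝ ∞ f x) (i j : Fin n) :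
    pd i (pd j f) =ᶠ[𝓝 x] pd j (pd i f) := by
  have h2 : ContDiffAt ℝ 2 f x := hf.of_le ENat.LEInfty.out
  filter_upwards [h2.eventually (by simp)] with y hy
  have hs : IsSymmSndFDerivAt ℝ f y := hy.isSymmSndFDerivAt (by simp)
  have hd : DifferentiableAt ℝ (fderiv ℝ f) y :=
    (hy.fderiv_right (m := 1) (by norm_num)).differentiableAt one_ne_zero
  have key : ∀ k l : Fin n, pd k (pd l f) y
      = fderiv ℝ (fderiv ℝ f) y (EuclideanSpace.single k 1) (EuclideanSpace.single l 1) := by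
    intro k l
    change fderiv ℝ (fun z => fderiv ℝ f z (EuclideanSpace.single l 1)) y _ = _
    rw [fderiv_clm_apply hd (differentiableAt_const _)]
    simp
  rw [key, key]
  exact hs _ _

theorem pd_component {m n : ℕ} {F : E m → E n} {y : E m} (hF : DifferentiableAt ℝ F y)
    (i : Fin m) (a : Fin n) :
    pd i (fun z => F z a) y = fderiv ℝ F y (EuclideanSpace.single i 1) a := by
  have := ((EuclideanSpace.proj (𝕜 := ℝ) a).hasFDerivAt.comp y hF.hasFDerivAt).fderiv
  unfold pd
  change fderiv ℝ (⇑(EuclideanSpace.proj (𝕜 := ℝ) a) ∘ F) y _ = _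
  rw [this]; rfl

/-- The ring of germs at `x` of smooth functions on `ℝⁿ`, as a subring of all germs of functions. -/
def SmoothGerm {n : ℕ} (x : E n) : Subring (Germ (𝓝 x) ℝ) where
  carrier := {γ | ∃ f : E n → ℝ, ContDiffAt ℝ ∞ f x ∧ (f : Germ (𝓝 x) ℝ) = γ}
  mul_mem' := by
    rintro _ _ ⟨f, hf, rfl⟩ ⟨g, hg, rfl⟩
    exact ⟨f * g, hf.mul hg, rfl⟩
  add_mem' := by
    rintro _ _ ⟨f, hf, rfl⟩ ⟨g, hg, rfl⟩
    exact ⟨f + g, hf.add hg, rfl⟩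
  one_mem' := ⟨1, contDiffAt_const, rfl⟩
  zero_mem' := ⟨0, contDiffAt_const, rfl⟩
  neg_mem' := by
    rintro _ ⟨f, hf, rfl⟩
    exact ⟨-f, hf.neg, rfl⟩

namespace SmoothGerm

variable {n : ℕ} {x : E n}

/-- The germ at `x` of a function that is smooth at `x`. -/
def ofFun (f : E n → ℝ) (hf : ContDiffAt ℝ ∞ f x) : SmoothGerm x := ⟨(f : Germ (𝓝 x) ℝ), f, hf, rfl⟩

/-- Constant germs. -/
def const (x : E n) : ℝ →+* SmoothGerm x where
  toFun r := ofFun (fun _ => r) contDiffAt_const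
  map_one' := rfl
  map_zero' := rfl
  map_add' _ _ := rfl
  map_mul' _ _ := rfl

instance : Algebra ℝ (SmoothGerm x) := (const x).toAlgebra

/-- The function `f` has the smooth germ `a` at `x`. -/
def Rep (f : E n → ℝ) (a : SmoothGerm x) : Prop := (a : Germ (𝓝 x) ℝ) = (f : Germ (𝓝 x) ℝ)

theorem rep_ofFun (f : E n → ℝ) (hf : ContDiffAt ℝ ∞ f x) : Rep f (ofFun f hf) := rfl

theorem exists_rep (a : SmoothGerm x) : ∃ f : E n → ℝ, ContDiffAt ℝ ∞ f x ∧ Rep f a := by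
  obtain ⟨_, f, hf, rfl⟩ := a
  exact ⟨f, hf, rfl⟩

theorem Rep.unique {f : E n → ℝ} {a b : SmoothGerm x} (ha : Rep f a) (hb : Rep f b) : a = b :=
  Subtype.ext (ha.trans hb.symm)

theorem Rep.congr {f g : E n → ℝ} {a : SmoothGerm x} (ha : Rep f a) (h : g =ᶠ[𝓝 x] f) : Rep g a :=
  ha.trans (Germ.coe_eq.2 h.symm)

theorem Rep.eventuallyEq {f g : E n → ℝ} {a : SmoothGerm x} (ha : Rep f a) (hb : Rep g a) :
    f =ᶠ[𝓝 x] g :=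
  Germ.coe_eq.1 (ha.symm.trans hb)

theorem Rep.eq_of_eventuallyEq {f g : E n → ℝ} {a b : SmoothGerm x} (ha : Rep f a) (hb : Rep g b)
    (h : f =ᶠ[𝓝 x] g) : a = b :=
  ha.unique (hb.congr h)

theorem Rep.contDiffAt {f : E n → ℝ} {a : SmoothGerm x} (ha : Rep f a) : ContDiffAt ℝ ∞ f x := by
  obtain ⟨g, hg, hr⟩ := exists_rep a
  exact hg.congr_of_eventuallyEq (ha.eventuallyEq hr)

theorem Rep.add {f g : E n → ℝ} {a b : SmoothGerm x} (ha : Rep f a) (hb : Rep g b) :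
    Rep (fun y => f y + g y) (a + b) := by
  unfold Rep at *
  rw [Subring.coe_add, ha, hb]; rfl

theorem Rep.mul {f g : E n → ℝ} {a b : SmoothGerm x} (ha : Rep f a) (hb : Rep g b) :
    Rep (fun y => f y * g y) (a * b) := by
  unfold Rep at *
  rw [Subring.coe_mul, ha, hb]; rfl

theorem Rep.neg {f : E n → ℝ} {a : SmoothGerm x} (ha : Rep f a) :
    Rep (fun y => -f y) (-a) := by
  unfold Rep at *
  rw [Subring.coe_neg, ha]; rfl

theorem Rep.sub {f g : E n → ℝ} {a b : SmoothGerm x} (ha : Rep f a) (hb : Rep g b) :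
    Rep (fun y => f y - g y) (a - b) := by
  simpa only [sub_eq_add_neg] using ha.add hb.neg

theorem rep_const (r : ℝ) : Rep (x := x) (fun _ => r) (algebraMap ℝ (SmoothGerm x) r) := rfl

theorem rep_zero : Rep (x := x) (fun _ => (0 : ℝ)) (0 : SmoothGerm x) := rfl

theorem rep_one : Rep (x := x) (fun _ => (1 : ℝ)) (1 : SmoothGerm x) := rfl

theorem rep_ite (p : Prop) [Decidable p] :
    Rep (x := x) (fun _ => if p then (1 : ℝ) else 0) (if p then 1 else 0) := by
  split_ifs
  · exact rep_one
  · exact rep_zero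

theorem Rep.const_mul (r : ℝ) {f : E n → ℝ} {a : SmoothGerm x} (ha : Rep f a) :
    Rep (fun y => r * f y) (r • a) := by
  rw [Algebra.smul_def]
  exact (rep_const r).mul ha

theorem rep_sum {ι : Type*} (s : Finset ι) {f : ι → E n → ℝ} {a : ι → SmoothGerm x}
    (h : ∀ i ∈ s, Rep (f i) (a i)) : Rep (fun y => ∑ i ∈ s, f i y) (∑ i ∈ s, a i) := by
  classical
  induction s using Finset.induction_on with
  | empty => simpa using rep_zero
  | insert i s hi ih =>
    simp only [Finset.sum_insert hi]
    exact (h i (by simp)).add (ih fun j hj => h j (by simp [hj]))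

/-- The value of a germ at the base point. -/
def ev (x : E n) : SmoothGerm x →ₐ[ℝ] ℝ where
  toRingHom := (Germ.valueRingHom (x := x) (E := ℝ)).comp (SmoothGerm x).subtype
  commutes' _ := rfl

theorem Rep.ev_eq {f : E n → ℝ} {a : SmoothGerm x} (ha : Rep f a) : ev x a = f x := by
  change Germ.value (a : Germ (𝓝 x) ℝ) = _
  rw [ha, Germ.value_ofFun]

theorem isUnit_of_ev_ne_zero {a : SmoothGerm x} (h : ev x a ≠ 0) : IsUnit a := by
  obtain ⟨f, hf, ha⟩ := exists_rep a
  rw [ha.ev_eq] at h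
  have hinv : ContDiffAt ℝ ∞ (fun y => (f y)⁻¹) x := hf.inv h
  refine IsUnit.of_mul_eq_one (ofFun _ hinv) ((ha.mul (rep_ofFun _ hinv)).eq_of_eventuallyEq rep_one ?_)
  filter_upwards [hf.continuousAt.eventually_ne h] with y hy
  exact mul_inv_cancel₀ hy

theorem exists_sqrt {a : SmoothGerm x} (h : 0 < ev x a) : ∃ b, b * b = a := by
  obtain ⟨f, hf, ha⟩ := exists_rep a
  rw [ha.ev_eq] at h
  have hs : ContDiffAt ℝ ∞ (fun y => √(f y)) x := hf.sqrt h.ne'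
  refine ⟨ofFun _ hs, ((rep_ofFun _ hs).mul (rep_ofFun _ hs)).eq_of_eventuallyEq ha ?_⟩
  filter_upwards [hf.continuousAt.eventually_const_lt h] with y hy
  exact Real.mul_self_sqrt hy.le

/-- The partial derivative of a germ. -/
def pdFun (i : Fin n) (a : SmoothGerm x) : SmoothGerm x :=
  ⟨Germ.liftOn (a : Germ (𝓝 x) ℝ) (fun f => (Biconservative.pd i f : Germ (𝓝 x) ℝ))
    fun _ _ h => Germ.coe_eq.2 (pd_eventuallyEq h i), by
      obtain ⟨_, f, hf, rfl⟩ := a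
      exact ⟨_, contDiffAt_pd hf i, rfl⟩⟩

theorem Rep.pdFun {f : E n → ℝ} {a : SmoothGerm x} (ha : Rep f a) (i : Fin n) :
    Rep (Biconservative.pd i f) (pdFun i a) := by
  unfold Rep at *
  change Germ.liftOn (a : Germ (𝓝 x) ℝ) _ _ = _
  rw [ha]; rfl

/-- The partial derivative `∂/∂xⁱ` as a derivation of the ring of smooth germs. -/
def gpd (i : Fin n) : Derivation ℝ (SmoothGerm x) (SmoothGerm x) :=
  Derivation.mk'
    { toFun := pdFun i
      map_add' := by
        intro a b
        obtain ⟨f, hf, ha⟩ := exists_rep a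
        obtain ⟨g, hg, hb⟩ := exists_rep b
        refine ((ha.add hb).pdFun i).eq_of_eventuallyEq ((ha.pdFun i).add (hb.pdFun i)) ?_
        filter_upwards [eventually_differentiableAt_real hf,
          eventually_differentiableAt_real hg] with y h1 h2
        simp [Biconservative.pd, fderiv_fun_add h1 h2]
      map_smul' := by
        intro r a
        obtain ⟨f, hf, ha⟩ := exists_rep a
        refine ((ha.const_mul r).pdFun i).eq_of_eventuallyEq ((ha.pdFun i).const_mul r) ?_
        filter_upwards [eventually_differentiableAt_real hf] with y h1
        simp [Biconservative.pd, fderiv_const_mul h1] }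
    (by
      intro a b
      obtain ⟨f, hf, ha⟩ := exists_rep a
      obtain ⟨g, hg, hb⟩ := exists_rep b
      refine ((ha.mul hb).pdFun i).eq_of_eventuallyEq
        ((ha.mul (hb.pdFun i)).add (hb.mul (ha.pdFun i))) ?_
      filter_upwards [eventually_differentiableAt_real hf,
        eventually_differentiableAt_real hg] with y h1 h2
      simp [Biconservative.pd, fderiv_fun_mul h1 h2])

theorem Rep.pd {f : E n → ℝ} {a : SmoothGerm x} (ha : Rep f a) (i : Fin n) :
    Rep (Biconservative.pd i f) (gpd i a) := ha.pdFun i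

theorem gpd_comm (i j : Fin n) (a : SmoothGerm x) : gpd i (gpd j a) = gpd j (gpd i a) := by
  obtain ⟨f, hf, ha⟩ := exists_rep a
  exact ((ha.pd j).pd i).eq_of_eventuallyEq ((ha.pd i).pd j) (pd_pd_comm hf i j)

/-- The pull-back of germs by a smooth map. -/
def comap {m : ℕ} {p : E m} (F : E m → E n) (hF : ContDiffAt ℝ ∞ F p) :
    SmoothGerm (F p) →ₐ[ℝ] SmoothGerm p where
  toFun a := ⟨Germ.compTendsto (a : Germ (𝓝 (F p)) ℝ) F hF.continuousAt, by
    obtain ⟨_, f, hf, rfl⟩ := a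
    exact ⟨f ∘ F, hf.comp p hF, rfl⟩⟩
  map_one' := rfl
  map_zero' := rfl
  map_add' := by
    rintro ⟨_, f, hf, rfl⟩ ⟨_, g, hg, rfl⟩
    rfl
  map_mul' := by
    rintro ⟨_, f, hf, rfl⟩ ⟨_, g, hg, rfl⟩
    rfl
  commutes' _ := rfl

theorem Rep.comap {m : ℕ} {p : E m} {F : E m → E n} (hF : ContDiffAt ℝ ∞ F p) {f : E n → ℝ}
    {a : SmoothGerm (F p)} (ha : Rep f a) : Rep (fun y => f (F y)) (comap F hF a) := by
  unfold Rep at *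
  change Germ.compTendsto (a : Germ (𝓝 (F p)) ℝ) F hF.continuousAt = _
  rw [ha]; rfl

/-- The germ of the `a`-th component of a smooth map. -/
def component {m : ℕ} {p : E m} (F : E m → E n) (hF : ContDiffAt ℝ ∞ F p) (a : Fin n) :
    SmoothGerm p :=
  ofFun (fun y => F y a) ((contDiffAt_piLp 2).1 hF a)

/-- The chain rule. -/
theorem gpd_comap {m : ℕ} {p : E m} {F : E m → E n} (hF : ContDiffAt ℝ ∞ F p)
    (a : SmoothGerm (F p)) (i : Fin m) :
    gpd i (comap F hF a) = ∑ d, comap F hF (gpd d a) * gpd i (component F hF d) := by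
  obtain ⟨f, hf, ha⟩ := exists_rep a
  refine ((ha.comap hF).pd i).eq_of_eventuallyEq
    (rep_sum _ fun d _ => ((ha.pd d).comap hF).mul ((rep_ofFun _ _).pd i)) ?_
  filter_upwards [eventually_differentiableAt hF,
    hF.continuousAt.eventually (eventually_differentiableAt_real hf)] with y h1 h2
  have h3 : ∀ d, Biconservative.pd i (fun z => F z d) y
      = fderiv ℝ F y (EuclideanSpace.single i 1) d := by
    exact fun d => pd_component h1 i d
  have h4 : fderiv ℝ F y (EuclideanSpace.single i 1)
      = ∑ d, (fderiv ℝ F y (EuclideanSpace.single i 1) d) • EuclideanSpace.single d (1 : ℝ) := by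
    ext d
    simp [Finset.sum_apply, Pi.single_apply]
  simp only [h3]
  unfold Biconservative.pd
  rw [show (fun y => f (F y)) = f ∘ F from rfl, fderiv_comp y h2 h1]
  simp only [ContinuousLinearMap.comp_apply]
  conv_lhs => rw [h4]
  simp [mul_comm]

end SmoothGerm
end Biconservative

namespace Biconservative

/-! ### Metric connections along a map -/

/-- The vector fields along an isometric immersion `F`, as an algebraic structure over a ring `A` of
functions on the source with derivations `∂ᵢ`: the module `V` of the vector fields, their scalar
product, the covariant derivatives `D i = ∇_{∂ᵢ}` of the pulled back Levi-Civita connection, and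
the fields `vel i = dF(∂ᵢ)`.

The inverse of the first fundamental form need not exist over a general ring; where it is needed,
it is a parameter `inv`, subject to the equation `hinv`. -/
structure ConnectionAlong {m : ℕ} {A : Type*} [CommRing A] [Algebra ℝ A]
    (der : Fin m → Derivation ℝ A A) (V : Type*) [AddCommGroup V] [Module A V] where
  ip : V →ₗ[A] V →ₗ[A] A
  D : Fin m → V →+ V
  vel : Fin m → V
  ip_comm : ∀ u v, ip u v = ip v u
  D_smul : ∀ i (a : A) v, D i (a • v) = der i a • v + a • D i v
  der_ip : ∀ i u v, der i (ip u v) = ip (D i u) v + ip u (D i v)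
  torsion : ∀ i j, D i (vel j) = D j (vel i)

namespace ConnectionAlong

variable {m : ℕ} {A : Type*} [CommRing A] [Algebra ℝ A] {der : Fin m → Derivation ℝ A A}
  {V : Type*} [AddCommGroup V] [Module A V] (C : ConnectionAlong der V)

/-- The coefficients of the first fundamental form. -/
def met (i j : Fin m) : A := C.ip (C.vel i) (C.vel j)

theorem met_comm (i j : Fin m) : C.met i j = C.met j i := C.ip_comm _ _

/-- The Christoffel symbols of the first fundamental form, `inv` being its inverse. -/
def chr (inv : Fin m → Fin m → A) (k i j : Fin m) : A :=
  algebraMap ℝ A (1 / 2) * ∑ l, inv k l *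
    (der i (C.met j l) + der j (C.met i l) - der l (C.met i j))

/-- The second fundamental form, with values in `V`. -/
def sff (inv : Fin m → Fin m → A) (i j : Fin m) : V :=
  C.D i (C.vel j) - ∑ k, C.chr inv k i j • C.vel k

theorem algebraMap_half_add : algebraMap ℝ A (1 / 2) + algebraMap ℝ A (1 / 2) = 1 := by
  rw [← map_add]; norm_num

/-- Koszul's formula. -/
theorem koszul (i j l : Fin m) :
    algebraMap ℝ A (1 / 2) * (der i (C.met j l) + der j (C.met i l) - der l (C.met i j))
      = C.ip (C.D i (C.vel j)) (C.vel l) := by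
  simp only [met, C.der_ip]
  rw [C.torsion j i, C.torsion l i, C.torsion l j, C.ip_comm (C.vel j) (C.D i (C.vel l)),
    C.ip_comm (C.vel i) (C.D j (C.vel l))]
  linear_combination (C.ip (C.D i (C.vel j)) (C.vel l)) * algebraMap_half_add (A := A)

theorem chr_comm (inv : Fin m → Fin m → A) (k i j : Fin m) : C.chr inv k i j = C.chr inv k j i := by
  simp only [chr, C.met_comm i j]
  congr 1
  exact Finset.sum_congr rfl fun l _ => by ring

theorem ip_D_sum (i : Fin m) (c : Fin m → A) (w : Fin m → V) :
    C.D i (∑ k, c k • w k) = ∑ k, (der i (c k) • w k + c k • C.D i (w k)) := by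
  rw [map_sum]
  exact Finset.sum_congr rfl fun k _ => C.D_smul _ _ _

variable {inv : Fin m → Fin m → A}

theorem sum_chr_mul_met (hinv : ∀ i j, ∑ l, C.met i l * inv l j = if i = j then 1 else 0)
    (i j p : Fin m) :
    ∑ k, C.chr inv k i j * C.met p k = C.ip (C.D i (C.vel j)) (C.vel p) := by
  rw [← C.koszul]
  simp only [chr]
  set T := fun l => der i (C.met j l) + der j (C.met i l) - der l (C.met i j) with hT
  change ∑ k, algebraMap ℝ A (1 / 2) * (∑ l, inv k l * T l) * C.met p k
    = algebraMap ℝ A (1 / 2) * T p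
  simp only [mul_assoc, ← Finset.mul_sum]
  congr 1
  simp only [Finset.sum_mul]
  rw [Finset.sum_comm]
  calc ∑ l, ∑ k, inv k l * T l * C.met p k = ∑ l, (∑ k, C.met p k * inv k l) * T l := by
        refine Finset.sum_congr rfl fun l _ => ?_
        rw [Finset.sum_mul]
        exact Finset.sum_congr rfl fun k _ => by ring
    _ = T p := by simp [hinv]

/-- The second fundamental form is normal, by Koszul's formula. -/
theorem ip_sff_vel (hinv : ∀ i j, ∑ l, C.met i l * inv l j = if i = j then 1 else 0)
    (i j p : Fin m) : C.ip (C.sff inv i j) (C.vel p) = 0 := by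
  simp only [sff, map_sub, map_sum, map_smul, LinearMap.sub_apply, LinearMap.sum_apply,
    LinearMap.smul_apply, smul_eq_mul]
  rw [← C.sum_chr_mul_met hinv i j p, sub_eq_zero]
  exact Finset.sum_congr rfl fun k _ => by rw [C.met_comm p k]; rfl

/-- The metric is parallel. -/
theorem der_met (hinv : ∀ i j, ∑ l, C.met i l * inv l j = if i = j then 1 else 0)
    (k i j : Fin m) :
    der k (C.met i j) = ∑ l, (C.chr inv l k i * C.met l j + C.chr inv l k j * C.met i l) := by
  rw [Finset.sum_add_distrib, C.sum_chr_mul_met hinv k j i]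
  simp only [C.met_comm _ j]
  rw [C.sum_chr_mul_met hinv k i j]
  unfold met
  rw [C.ip_comm (C.vel j), C.der_ip, C.ip_comm (C.vel i) (C.D k (C.vel j))]

theorem der_inv (hinv : ∀ i j, ∑ l, C.met i l * inv l j = if i = j then 1 else 0)
    (hsymm : ∀ i j, inv i j = inv j i) (k p q : Fin m) :
    der k (inv p q) = -∑ l, (C.chr inv p k l * inv l q + C.chr inv q k l * inv p l) := by
  have hinv' : ∀ i j, ∑ l, inv i l * C.met l j = if i = j then 1 else 0 := by
    intro i j
    rw [show (if i = j then (1 : A) else 0) = if j = i then 1 else 0 by simp [eq_comm], ← hinv j i]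
    exact Finset.sum_congr rfl fun l _ => by rw [hsymm i l, C.met_comm l j, mul_comm]
  -- Differentiate `g g⁻¹ = 1` and multiply by `g⁻¹`.
  have h1 : ∀ i, ∑ l, (C.met i l * der k (inv l q) + inv l q * der k (C.met i l)) = 0 := by
    intro i
    have := congrArg (der k) (hinv i q)
    rw [map_sum] at this
    simp only [Derivation.leibniz, smul_eq_mul] at this
    rw [this]
    split_ifs <;> simp
  have h2 : ∑ i, inv p i * ∑ l, (C.met i l * der k (inv l q) + inv l q * der k (C.met i l)) = 0 := by
    simp [h1]
  have h3 : ∑ i, inv p i * ∑ l, C.met i l * der k (inv l q) = der k (inv p q) := by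
    simp only [Finset.mul_sum]
    rw [Finset.sum_comm]
    calc ∑ l, ∑ i, inv p i * (C.met i l * der k (inv l q))
        = ∑ l, (∑ i, inv p i * C.met i l) * der k (inv l q) := by
          refine Finset.sum_congr rfl fun l _ => ?_
          rw [Finset.sum_mul]
          exact Finset.sum_congr rfl fun i _ => by ring
      _ = _ := by simp [hinv']
  have h4 : ∑ i, inv p i * ∑ l, inv l q * der k (C.met i l)
      = ∑ l, (C.chr inv p k l * inv l q + C.chr inv q k l * inv p l) := by
    simp only [C.der_met hinv, Finset.sum_add_distrib, mul_add]
    rw [add_comm]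
    congr 1
    · calc ∑ i, inv p i * ∑ l, inv l q * ∑ r, C.chr inv r k l * C.met i r
          = ∑ l, ∑ r, ∑ i, inv p i * (inv l q * (C.chr inv r k l * C.met i r)) := by
            simp only [Finset.mul_sum]
            rw [Finset.sum_comm]
            exact Finset.sum_congr rfl fun l _ => Finset.sum_comm
        _ = ∑ l, ∑ r, (∑ i, inv p i * C.met i r) * (C.chr inv r k l * inv l q) := by
            simp only [Finset.sum_mul]
            exact Finset.sum_congr rfl fun l _ => Finset.sum_congr rfl fun r _ =>
              Finset.sum_congr rfl fun i _ => by ring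
        _ = _ := by simp [hinv']
    · calc ∑ i, inv p i * ∑ l, inv l q * ∑ r, C.chr inv r k i * C.met r l
          = ∑ i, ∑ r, ∑ l, inv p i * (inv l q * (C.chr inv r k i * C.met r l)) := by
            simp only [Finset.mul_sum]
            exact Finset.sum_congr rfl fun l _ => Finset.sum_comm
        _ = ∑ i, ∑ r, (∑ l, C.met r l * inv l q) * (C.chr inv r k i * inv p i) := by
            simp only [Finset.sum_mul]
            exact Finset.sum_congr rfl fun l _ => Finset.sum_congr rfl fun r _ =>
              Finset.sum_congr rfl fun i _ => by ring
        _ = _ := by simp [hinv]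
  simp only [Finset.sum_add_distrib, mul_add] at h2 h3 h4 ⊢
  rw [h3] at h2
  linear_combination h2 - h4

/-! ### Hypersurfaces of space forms -/

/-- The components of the curvature tensor of the first fundamental form. -/
def curv (inv : Fin m → Fin m → A) (l i j k : Fin m) : A :=
  der i (C.chr inv l j k) - der j (C.chr inv l i k)
    + ∑ p, (C.chr inv l i p * C.chr inv p j k - C.chr inv l j p * C.chr inv p i k)

/-- The scalar second fundamental form with respect to the normal `ν`. -/
def sf (ν : V) (i j : Fin m) : A := C.ip (C.D i (C.vel j)) ν

theorem sf_comm (ν : V) (i j : Fin m) : C.sf ν i j = C.sf ν j i := by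
  simp only [sf, C.torsion i j]

/-- `ν` is a unit normal, and `V` is spanned by `ν` and the tangent vectors. -/
structure IsNormal (ν : V) : Prop where
  ip_vel : ∀ l, C.ip ν (C.vel l) = 0
  ip_self : C.ip ν ν = 1
  eq_zero : ∀ w, (∀ l, C.ip w (C.vel l) = 0) → C.ip w ν = 0 → w = 0

variable {C} {ν : V}

theorem IsNormal.D_normal_self (hν : C.IsNormal ν) (i : Fin m) : C.ip (C.D i ν) ν = 0 := by
  have h := C.der_ip i ν ν
  rw [hν.ip_self, C.ip_comm ν (C.D i ν), Derivation.map_one_eq_zero] at h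
  linear_combination -algebraMap ℝ A (1 / 2) * h
    - (C.ip (C.D i ν) ν) * algebraMap_half_add (A := A)

theorem IsNormal.D_normal_vel (hν : C.IsNormal ν) (i j : Fin m) :
    C.ip (C.D i ν) (C.vel j) = -C.sf ν i j := by
  have h := C.der_ip i ν (C.vel j)
  rw [hν.ip_vel, map_zero, C.ip_comm ν (C.D i (C.vel j))] at h
  unfold sf
  linear_combination -h

theorem IsNormal.sff_eq (hν : C.IsNormal ν)
    (hinv : ∀ i j, ∑ l, C.met i l * inv l j = if i = j then 1 else 0) (i j : Fin m) :
    C.sff inv i j = C.sf ν i j • ν := by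
  rw [← sub_eq_zero]
  refine hν.eq_zero _ (fun l => ?_) ?_
  · simp [C.ip_sff_vel hinv, hν.ip_vel]
  · simp [sff, sf, hν.ip_self, C.ip_comm _ ν, hν.ip_vel]

/-- The Gauss formula. -/
theorem IsNormal.D_vel (hν : C.IsNormal ν)
    (hinv : ∀ i j, ∑ l, C.met i l * inv l j = if i = j then 1 else 0) (i j : Fin m) :
    C.D i (C.vel j) = ∑ k, C.chr inv k i j • C.vel k + C.sf ν i j • ν := by
  rw [← hν.sff_eq hinv, sff]; abel

variable (C) in
/-- The ambient curvature along the immersion is that of a space form of curvature `c`. -/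
def HasCurvature (c : A) : Prop :=
  ∀ i j w, C.D i (C.D j w) - C.D j (C.D i w)
    = c • (C.ip (C.vel j) w • C.vel i - C.ip (C.vel i) w • C.vel j)

theorem IsNormal.D_D_vel (hν : C.IsNormal ν)
    (hinv : ∀ i j, ∑ l, C.met i l * inv l j = if i = j then 1 else 0) (i j k : Fin m) :
    C.D i (C.D j (C.vel k)) = ∑ l, (der i (C.chr inv l j k)
        + ∑ p, C.chr inv l i p * C.chr inv p j k) • C.vel l
      + (∑ l, C.chr inv l j k * C.sf ν i l + der i (C.sf ν j k)) • ν + C.sf ν j k • C.D i ν := by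
  rw [hν.D_vel hinv j k, map_add, C.ip_D_sum, C.D_smul]
  simp only [hν.D_vel hinv, add_smul, Finset.sum_smul, Finset.sum_add_distrib, smul_add,
    Finset.smul_sum, smul_smul]
  rw [Finset.sum_comm (f := fun l p => (C.chr inv l i p * C.chr inv p j k) • C.vel l)]
  simp only [mul_comm (C.chr inv _ j k) (C.chr inv _ i _)]
  abel

/-- The Codazzi equation. -/
theorem IsNormal.codazzi (hν : C.IsNormal ν)
    (hinv : ∀ i j, ∑ l, C.met i l * inv l j = if i = j then 1 else 0) {c : A}
    (hc : C.HasCurvature c) (i j k : Fin m) :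
    der i (C.sf ν j k) - ∑ l, C.chr inv l i k * C.sf ν j l
      = der j (C.sf ν i k) - ∑ l, C.chr inv l j k * C.sf ν i l := by
  have h := congrArg (fun w => C.ip w ν) (hc i j (C.vel k))
  simp only [hν.D_D_vel hinv, map_sub, map_add, map_sum, map_smul, LinearMap.sub_apply,
    LinearMap.add_apply, LinearMap.sum_apply, LinearMap.smul_apply, smul_eq_mul,
    hν.D_normal_self, C.ip_comm (C.vel _) ν, hν.ip_vel, hν.ip_self, mul_zero, Finset.sum_const_zero,
    sub_zero, add_zero, zero_add, mul_one] at h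
  linear_combination h

/-- The Gauss equation. -/
theorem IsNormal.gauss (hν : C.IsNormal ν)
    (hinv : ∀ i j, ∑ l, C.met i l * inv l j = if i = j then 1 else 0) {c : A}
    (hc : C.HasCurvature c) (i j k p : Fin m) :
    ∑ l, C.curv inv l i j k * C.met l p
      = c * (C.met j k * C.met i p - C.met i k * C.met j p)
        + (C.sf ν j k * C.sf ν i p - C.sf ν i k * C.sf ν j p) := by
  have h := congrArg (fun w => C.ip w (C.vel p)) (hc i j (C.vel k))
  simp only [hν.D_D_vel hinv, map_sub, map_add, map_sum, map_smul, LinearMap.sub_apply,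
    LinearMap.add_apply, LinearMap.sum_apply, LinearMap.smul_apply, smul_eq_mul,
    hν.D_normal_vel, hν.ip_vel, mul_zero] at h
  have e : ∀ a b : Fin m, C.ip (C.vel a) (C.vel b) = C.met a b := fun _ _ => rfl
  simp only [e] at h
  have h2 : ∑ l, C.curv inv l i j k * C.met l p
      = ∑ l, (der i (C.chr inv l j k) + ∑ p, C.chr inv l i p * C.chr inv p j k) * C.met l p
        - ∑ l, (der j (C.chr inv l i k) + ∑ p, C.chr inv l j p * C.chr inv p i k) * C.met l p := by
    rw [← Finset.sum_sub_distrib]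
    refine Finset.sum_congr rfl fun l _ => ?_
    rw [curv, Finset.sum_sub_distrib]
    ring
  rw [h2]
  linear_combination h

/-- The scalar curvature of the first fundamental form. -/
def scal (C : ConnectionAlong der V) (inv : Fin m → Fin m → A) : A :=
  ∑ j, ∑ k, inv j k * ∑ i, C.curv inv i i j k

/-- The trace of the second fundamental form. -/
def trace (C : ConnectionAlong der V) (inv : Fin m → Fin m → A) (ν : V) : A :=
  ∑ i, ∑ j, inv i j * C.sf ν i j

theorem IsNormal.curv_eq (hν : C.IsNormal ν)
    (hinv : ∀ i j, ∑ l, C.met i l * inv l j = if i = j then 1 else 0) {c : A}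
    (hc : C.HasCurvature c) (q i j k : Fin m) :
    C.curv inv q i j k = ∑ p, (c * (C.met j k * C.met i p - C.met i k * C.met j p)
        + (C.sf ν j k * C.sf ν i p - C.sf ν i k * C.sf ν j p)) * inv p q := by
  simp only [← hν.gauss hinv hc, Finset.sum_mul]
  rw [Finset.sum_comm]
  simp only [mul_assoc, ← Finset.mul_sum, hinv]
  simp

/-- The contracted Gauss equation `R = m(m-1)c + (tr A)² - |A|²`. -/
theorem IsNormal.scal_eq (hν : C.IsNormal ν)
    (hinv : ∀ i j, ∑ l, C.met i l * inv l j = if i = j then 1 else 0)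
    (hsymm : ∀ i j, inv i j = inv j i) {c : A} (hc : C.HasCurvature c) :
    C.scal inv = (m * m - m) * c + C.trace inv ν ^ 2
      - ∑ j, ∑ k, ∑ i, ∑ p, inv j k * inv p i * (C.sf ν i k * C.sf ν j p) := by
  have t1 : ∀ i, ∑ p, C.met i p * inv p i = 1 := fun i => by simp [hinv]
  have t2 : ∑ j, ∑ k, inv j k * C.met j k = (m : A) := by
    calc ∑ j, ∑ k, inv j k * C.met j k = ∑ j : Fin m, (1 : A) := by
          refine Finset.sum_congr rfl fun j _ => ?_
          rw [← t1 j]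
          exact Finset.sum_congr rfl fun k _ => by rw [hsymm j k, mul_comm]
      _ = m := by simp
  have h : ∀ j k, ∑ i, C.curv inv i i j k
      = c * (m * C.met j k - C.met j k) + C.sf ν j k * C.trace inv ν
        - ∑ i, ∑ p, inv p i * (C.sf ν i k * C.sf ν j p) := by
    intro j k
    simp only [hν.curv_eq hinv hc, add_mul, sub_mul, mul_sub, Finset.sum_add_distrib,
      Finset.sum_sub_distrib]
    have e1 : ∑ i, ∑ p, c * (C.met j k * C.met i p) * inv p i = c * (m * C.met j k) := by
      simp only [mul_assoc, ← Finset.mul_sum, t1]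
      simp [mul_comm]
    have e2 : ∑ i, ∑ p, c * (C.met i k * C.met j p) * inv p i = c * C.met j k := by
      simp only [mul_assoc, ← Finset.mul_sum, hinv]
      simp
    have e3 : ∑ i, ∑ p, C.sf ν j k * C.sf ν i p * inv p i = C.sf ν j k * C.trace inv ν := by
      simp only [trace, mul_assoc, ← Finset.mul_sum]
      congr 1
      exact Finset.sum_congr rfl fun i _ => Finset.sum_congr rfl fun p _ => by
        rw [hsymm i p, mul_comm]
    have e4 : ∑ i, ∑ p, C.sf ν i k * C.sf ν j p * inv p i
        = ∑ i, ∑ p, inv p i * (C.sf ν i k * C.sf ν j p) :=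
      Finset.sum_congr rfl fun i _ => Finset.sum_congr rfl fun p _ => mul_comm _ _
    rw [e1, e2, e3, e4]
    ring
  simp only [scal, h]
  have e5 : ∀ j k, inv j k * (c * (m * C.met j k - C.met j k) + C.sf ν j k * C.trace inv ν
        - ∑ i, ∑ p, inv p i * (C.sf ν i k * C.sf ν j p))
      = (m - 1) * c * (inv j k * C.met j k) + inv j k * C.sf ν j k * C.trace inv ν
        - ∑ i, ∑ p, inv j k * inv p i * (C.sf ν i k * C.sf ν j p) := by
    intro j k
    simp only [mul_assoc (inv j k) (inv _ _), ← Finset.mul_sum]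
    ring
  simp only [e5, Finset.sum_sub_distrib, Finset.sum_add_distrib, ← Finset.mul_sum,
    ← Finset.sum_mul, t2]
  rw [show ∑ j, ∑ k, inv j k * C.sf ν j k = C.trace inv ν from rfl]
  ring

end ConnectionAlong
end Biconservative

namespace Biconservative
namespace ConnectionAlong

variable {m : ℕ} {A : Type*} [CommRing A] [Algebra ℝ A] {der : Fin m → Derivation ℝ A A}
  {V : Type*} [AddCommGroup V] [Module A V] {C : ConnectionAlong der V}
  {inv : Fin m → Fin m → A} {ν : V}

/-! ### The stress-energy tensor of the bienergy -/

/-- The tension field. -/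
def tens (C : ConnectionAlong der V) (inv : Fin m → Fin m → A) : V :=
  ∑ i, ∑ j, inv i j • C.sff inv i j

/-- The stress-energy tensor of the bienergy. -/
def stress (C : ConnectionAlong der V) (inv : Fin m → Fin m → A) (i j : Fin m) : A :=
  (algebraMap ℝ A (1 / 2) * C.ip (C.tens inv) (C.tens inv)
      + ∑ k, ∑ l, inv k l * C.ip (C.vel k) (C.D l (C.tens inv))) * C.met i j
    - C.ip (C.vel i) (C.D j (C.tens inv)) - C.ip (C.vel j) (C.D i (C.tens inv))

/-- The divergence of a 2-tensor. -/
def dvg (C : ConnectionAlong der V) (inv : Fin m → Fin m → A) (S : Fin m → Fin m → A)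
    (j : Fin m) : A :=
  ∑ i, ∑ k, inv i k * (der k (S i j)
    - ∑ l, (C.chr inv l k i * S l j + C.chr inv l k j * S i l))

theorem IsNormal.tens_eq (hν : C.IsNormal ν)
    (hinv : ∀ i j, ∑ l, C.met i l * inv l j = if i = j then 1 else 0) :
    C.tens inv = C.trace inv ν • ν := by
  simp only [tens, trace, hν.sff_eq hinv, smul_smul, Finset.sum_smul]

/-- The stress-energy tensor of a hypersurface is `-(f² / 2) g + 2 f b`, where `b` is the second
fundamental form and `f` its trace. -/
theorem IsNormal.stress_eq (hν : C.IsNormal ν)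
    (hinv : ∀ i j, ∑ l, C.met i l * inv l j = if i = j then 1 else 0)
    (i j : Fin m) :
    C.stress inv i j = -(algebraMap ℝ A (1 / 2) * C.trace inv ν ^ 2) * C.met i j
      + (C.trace inv ν * C.sf ν i j + C.trace inv ν * C.sf ν i j) := by
  have h1 : ∀ k l, C.ip (C.vel k) (C.D l (C.tens inv)) = -(C.trace inv ν * C.sf ν k l) := by
    intro k l
    rw [hν.tens_eq hinv, C.D_smul, C.ip_comm]
    simp only [map_add, map_smul, LinearMap.add_apply, LinearMap.smul_apply, smul_eq_mul,
      hν.ip_vel, hν.D_normal_vel, C.sf_comm ν l k]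
    ring
  have h2 : ∑ k, ∑ l, inv k l * -(C.trace inv ν * C.sf ν k l) = -(C.trace inv ν) ^ 2 := by
    have : ∀ k l, inv k l * -(C.trace inv ν * C.sf ν k l)
        = -C.trace inv ν * (inv k l * C.sf ν k l) := fun k l => by ring
    simp only [this, ← Finset.mul_sum]
    rw [show ∑ k, ∑ l, inv k l * C.sf ν k l = C.trace inv ν from rfl]
    ring
  simp only [stress, h1, h2, C.sf_comm ν j i]
  rw [hν.tens_eq hinv]
  simp only [map_smul, LinearMap.smul_apply, hν.ip_self, smul_eq_mul, mul_one]
  linear_combination C.trace inv ν ^ 2 * C.met i j * algebraMap_half_add (A := A)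

/-- The traced Codazzi equation: the divergence of the second fundamental form is the differential
of its trace. -/
theorem IsNormal.dvg_sf (hν : C.IsNormal ν)
    (hinv : ∀ i j, ∑ l, C.met i l * inv l j = if i = j then 1 else 0)
    (hsymm : ∀ i j, inv i j = inv j i) {c : A} (hc : C.HasCurvature c) (j : Fin m) :
    C.dvg inv (C.sf ν) j = der j (C.trace inv ν) := by
  -- The covariant derivative of the second fundamental form is symmetric in `k` and `j`.
  have h1 : ∀ i k, der k (C.sf ν i j)
        - ∑ l, (C.chr inv l k i * C.sf ν l j + C.chr inv l k j * C.sf ν i l)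
      = der j (C.sf ν i k)
        - ∑ l, (C.chr inv l j i * C.sf ν l k + C.chr inv l j k * C.sf ν i l) := by
    intro i k
    have h := hν.codazzi hinv hc k j i
    simp only [Finset.sum_add_distrib, C.sf_comm ν i, C.sf_comm ν _ j, C.sf_comm ν _ k,
      C.chr_comm inv _ k j] at h ⊢
    linear_combination h
  have h2 : der j (C.trace inv ν) = ∑ i, ∑ k, inv i k * der j (C.sf ν i k)
      + ∑ i, ∑ k, C.sf ν i k * der j (inv i k) := by
    simp only [trace, map_sum, Derivation.leibniz, smul_eq_mul, Finset.sum_add_distrib]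
  have h3 : ∑ i, ∑ k, inv i k * ∑ l, (C.chr inv l j i * C.sf ν l k + C.chr inv l j k * C.sf ν i l)
      = ∑ i, ∑ k, C.sf ν i k * ∑ l, (C.chr inv i j l * inv l k + C.chr inv k j l * inv i l) := by
    simp only [mul_add, Finset.sum_add_distrib, Finset.mul_sum]
    congr 1
    · calc ∑ i, ∑ k, ∑ l, inv i k * (C.chr inv l j i * C.sf ν l k)
          = ∑ i, ∑ l, ∑ k, inv i k * (C.chr inv l j i * C.sf ν l k) :=
            Finset.sum_congr rfl fun _ _ => Finset.sum_comm
        _ = ∑ l, ∑ i, ∑ k, inv i k * (C.chr inv l j i * C.sf ν l k) := Finset.sum_comm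
        _ = ∑ l, ∑ k, ∑ i, inv i k * (C.chr inv l j i * C.sf ν l k) :=
            Finset.sum_congr rfl fun _ _ => Finset.sum_comm
        _ = _ := Finset.sum_congr rfl fun _ _ => Finset.sum_congr rfl fun _ _ =>
            Finset.sum_congr rfl fun _ _ => by ring
    · calc ∑ i, ∑ k, ∑ l, inv i k * (C.chr inv l j k * C.sf ν i l)
          = ∑ i, ∑ l, ∑ k, inv i k * (C.chr inv l j k * C.sf ν i l) :=
            Finset.sum_congr rfl fun _ _ => Finset.sum_comm
        _ = _ := Finset.sum_congr rfl fun _ _ => Finset.sum_congr rfl fun _ _ =>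
            Finset.sum_congr rfl fun _ _ => by ring
  simp only [dvg, h1, mul_sub, Finset.sum_sub_distrib, h3]
  simp only [h2, C.der_inv hinv hsymm, mul_neg, Finset.sum_neg_distrib]
  ring

/-- As the metric is parallel, its divergence vanishes. -/
theorem dvg_met (hinv : ∀ i j, ∑ l, C.met i l * inv l j = if i = j then 1 else 0)
    (a : A) (j : Fin m) : C.dvg inv (fun i k => a * C.met i k) j = der j a := by
  have h : ∀ i k, der k (a * C.met i j) - ∑ l, (C.chr inv l k i * (a * C.met l j)
      + C.chr inv l k j * (a * C.met i l)) = C.met j i * der k a := by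
    intro i k
    rw [Derivation.leibniz, C.der_met hinv k i j]
    simp only [smul_eq_mul, Finset.mul_sum]
    rw [C.met_comm j i, add_sub_assoc, add_comm, sub_add_eq_add_sub]
    have : ∀ l, C.chr inv l k i * (a * C.met l j) + C.chr inv l k j * (a * C.met i l)
      = a * (C.chr inv l k i * C.met l j + C.chr inv l k j * C.met i l) := fun l => by ring
    simp only [this]
    ring
  simp only [dvg, h]
  rw [Finset.sum_comm]
  calc ∑ k, ∑ i, inv i k * (C.met j i * der k a)
      = ∑ k, (∑ i, C.met j i * inv i k) * der k a := by
        simp only [Finset.sum_mul]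
        exact Finset.sum_congr rfl fun _ _ => Finset.sum_congr rfl fun _ _ => by ring
    _ = der j a := by simp [hinv]

theorem dvg_add (S T : Fin m → Fin m → A) (j : Fin m) :
    C.dvg inv (fun i k => S i k + T i k) j = C.dvg inv S j + C.dvg inv T j := by
  simp only [dvg, map_add, mul_add, mul_sub, Finset.sum_add_distrib, Finset.sum_sub_distrib]
  ring

theorem dvg_mul (a : A) (S : Fin m → Fin m → A) (j : Fin m) :
    C.dvg inv (fun i k => a * S i k) j
      = a * C.dvg inv S j + ∑ i, ∑ k, inv i k * der k a * S i j := by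
  have h : ∀ i k, inv i k * (der k (a * S i j) - ∑ l, (C.chr inv l k i * (a * S l j)
      + C.chr inv l k j * (a * S i l)))
      = a * (inv i k * (der k (S i j) - ∑ l, (C.chr inv l k i * S l j
      + C.chr inv l k j * S i l))) + inv i k * der k a * S i j := by
    intro i k
    have : ∀ l, C.chr inv l k i * (a * S l j) + C.chr inv l k j * (a * S i l)
      = a * (C.chr inv l k i * S l j + C.chr inv l k j * S i l) := fun l => by ring
    simp only [this, Derivation.leibniz, smul_eq_mul, ← Finset.mul_sum]
    ring
  simp only [dvg, h]
  simp only [Finset.sum_add_distrib (f := fun k => a * _), ← Finset.mul_sum]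

/-- A biconservative hypersurface satisfies `A (grad f) = -(f / 2) grad f`, where `f` is the trace
of `A`. -/
theorem IsNormal.sf_grad (hν : C.IsNormal ν)
    (hinv : ∀ i j, ∑ l, C.met i l * inv l j = if i = j then 1 else 0)
    (hsymm : ∀ i j, inv i j = inv j i) {c : A} (hc : C.HasCurvature c) (j : Fin m)
    (hbi : C.dvg inv (C.stress inv) j = 0) :
    ∑ i, (∑ k, inv i k * der k (C.trace inv ν)) * C.sf ν i j
      = -(algebraMap ℝ A (1 / 2) * C.trace inv ν) * der j (C.trace inv ν) := by
  have h0 : C.stress inv = fun i j => -(algebraMap ℝ A (1 / 2) * C.trace inv ν ^ 2) * C.met i j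
      + (C.trace inv ν * C.sf ν i j + C.trace inv ν * C.sf ν i j) := by
    funext i j
    exact hν.stress_eq hinv i j
  have h1 : der j (-(algebraMap ℝ A (1 / 2) * C.trace inv ν ^ 2))
      = -(C.trace inv ν * der j (C.trace inv ν)) := by
    simp only [map_neg, Derivation.leibniz, Derivation.leibniz_pow, smul_eq_mul, nsmul_eq_mul,
      Derivation.map_algebraMap]
    push_cast
    linear_combination (-C.trace inv ν * der j (C.trace inv ν)) * algebraMap_half_add (A := A)
  rw [h0, dvg_add, dvg_add, dvg_met hinv, dvg_mul, h1,
    show C.dvg inv (fun i k => C.sf ν i k) j = _ from hν.dvg_sf hinv hsymm hc j] at hbi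
  simp only [Finset.sum_mul]
  linear_combination algebraMap ℝ A (1 / 2) * hbi
    - (∑ i, ∑ k, inv i k * der k (C.trace inv ν) * C.sf ν i j) * algebraMap_half_add (A := A)

end ConnectionAlong
end Biconservative

namespace Biconservative

/-! ### The structure equations of a principal frame -/

section
variable {A : Type*} [CommRing A] [Algebra ℝ A]

open Polynomial in
/-- An element with invertible derivative is transcendental over the constants. -/
theorem eq_zero_of_aeval_eq_zero [Nontrivial A] (δ : Derivation ℝ A A) {t : A} (ht : IsUnit (δ t))
    (P : ℝ[X]) (hP : aeval t P = 0) : P = 0 := by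
  induction h : P.natDegree using Nat.strong_induction_on generalizing P with
  | _ n ih =>
    have h1 : aeval t (derivative P) = 0 := by
      have h2 := δ.map_aeval P t
      rw [hP, map_zero, smul_eq_mul] at h2
      exact (ht.mul_left_eq_zero).1 h2.symm
    have h3 : P.natDegree = 0 := by
      by_contra h0
      have h4 := ih _ (h ▸ natDegree_derivative_lt h0) (derivative P) h1 rfl
      exact h0 (derivative_eq_zero.1 h4)
    rw [eq_C_of_natDegree_eq_zero h3, aeval_C] at hP
    rw [eq_C_of_natDegree_eq_zero h3]
    have h5 := (algebraMap ℝ A).injective (hP.trans (map_zero _).symm)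
    rw [h5, C_0]

open Polynomial in
/-- The coefficient equations that remain of the structure equations of a biconservative
hypersurface are incompatible: eliminating the derivatives of `t` up to second order
leaves a nontrivial polynomial equation for `t`. Here `t`, `x`, `y` are the principal curvatures,
and `u`, `v` are the two connection coefficients that do not vanish. -/
theorem principal_ode_contradiction [Nontrivial A] (δ : Derivation ℝ A A) (c κ : ℝ)
    {t x y u v : A} (ht : IsUnit (δ t))
    (hsum : x + y = -3 * t) (hprod : x * y = 3 * t ^ 2 - algebraMap ℝ A κ)
    (hx : δ x = (t - x) * u) (hy : δ y = (t - y) * v)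
    (huv : u * v = -(algebraMap ℝ A c + x * y))
    (hu : δ u + u ^ 2 = -(algebraMap ℝ A c + t * x))
    (hv : δ v + v ^ 2 = -(algebraMap ℝ A c + t * y)) : False := by
  have hT2 : ∃ T2, T2 = δ (δ t) := ⟨_, rfl⟩
  obtain ⟨T2, hT2⟩ := hT2
  obtain ⟨T, hT⟩ : ∃ T, T = δ t := ⟨_, rfl⟩
  rw [← hT] at ht hT2
  obtain ⟨k, hk⟩ : ∃ k, k = algebraMap ℝ A κ := ⟨_, rfl⟩
  obtain ⟨q, hq⟩ : ∃ q, q = algebraMap ℝ A c := ⟨_, rfl⟩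
  have dk : δ k = 0 := by rw [hk, Derivation.map_algebraMap]
  have dq : δ q = 0 := by rw [hq, Derivation.map_algebraMap]
  have d2 : ∀ a : A, δ (a ^ 2) = 2 * a * δ a := by
    intro a; rw [pow_two, Derivation.leibniz, smul_eq_mul]; ring
  have dn : ∀ (n : ℕ) [n.AtLeastTwo], δ (ofNat(n) : A) = 0 := by
    intro n _
    rw [← map_ofNat (algebraMap ℝ A) n, Derivation.map_algebraMap]
  rw [← hk] at hprod
  rw [← hq] at huv hu hv
  have h1 : δ x + δ y = -3 * T := by
    have := congrArg δ hsum
    simp only [Derivation.leibniz, smul_eq_mul, map_add, map_neg, ← hT, dn] at this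
    linear_combination this
  have h2 : x * δ y + y * δ x = 6 * t * T := by
    have := congrArg δ hprod
    simp only [Derivation.leibniz, smul_eq_mul, map_sub, d2, dk, ← hT, dn] at this
    linear_combination this
  have hD : (t - x) * (t - y) = 7 * t ^ 2 - k := by linear_combination hprod - t * hsum
  -- The equations for `δ x` and `δ y` give `u + v`, and `u v` is known, which gives `T²` in terms of
  -- `t`; the sum of the Riccati equations for `u` and `v` brings in `T2`.
  have hw : (7 * t ^ 2 - k) * (u + v) = -9 * t * T := by
    linear_combination -(u + v) * hD - (t - y) * hx - (t - x) * hy + t * h1 - h2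
  have hE1 : (4 * k - 3 * t ^ 2) * (7 * t ^ 2 - k) * (q + 3 * t ^ 2 - k)
      = 9 * (t ^ 2 - k) * T ^ 2 := by
    have a1 : (x - y) * δ x = -3 * T * (x + 2 * t) := by linear_combination x * h1 - h2
    have a2 : (x - y) * δ y = 3 * T * (2 * t + y) := by linear_combination h2 - y * h1
    have a3 : (x - y) ^ 2 * (δ x * δ y) = -9 * T ^ 2 * (t ^ 2 - k) := by
      linear_combination (x - y) * δ y * a1 + (-3 * T * (x + 2 * t)) * a2
        - 9 * T ^ 2 * (hprod + 2 * t * hsum)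
    have a4 : (x - y) ^ 2 = 4 * k - 3 * t ^ 2 := by
      linear_combination (x + y - 3 * t) * hsum - 4 * hprod
    have a5 : δ x * δ y = -(7 * t ^ 2 - k) * (q + 3 * t ^ 2 - k) := by
      rw [hx, hy]
      linear_combination u * v * hD + (7 * t ^ 2 - k) * huv - (7 * t ^ 2 - k) * hprod
    rw [a4, a5] at a3
    linear_combination -a3
  have hdw : δ u + δ v = -4 * q - 3 * t ^ 2 + 2 * k - (u + v) ^ 2 := by
    linear_combination hu + hv + 2 * huv - 2 * hprod - t * hsum
  have hE3 : -207 * t ^ 2 * T ^ 2 + (7 * t ^ 2 - k) ^ 2 * (-4 * q - 3 * t ^ 2 + 2 * k)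
      + 9 * (7 * t ^ 2 - k) * T ^ 2 + 9 * (7 * t ^ 2 - k) * t * T2 = 0 := by
    have := congrArg δ hw
    simp only [Derivation.leibniz, smul_eq_mul, map_sub, map_add, map_neg, d2, dk, ← hT, ← hT2,
      dn] at this
    linear_combination (7 * t ^ 2 - k) * this - (7 * t ^ 2 - k) ^ 2 * hdw
      + ((7 * t ^ 2 - k) * (u + v) - 9 * t * T - 14 * t * T) * hw
  have hE4 : -3 * t * (7 * t ^ 2 - k) * (q + 3 * t ^ 2 - k)
      + 7 * t * (4 * k - 3 * t ^ 2) * (q + 3 * t ^ 2 - k)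
      + 3 * t * (4 * k - 3 * t ^ 2) * (7 * t ^ 2 - k) - 9 * t * T ^ 2 - 9 * (t ^ 2 - k) * T2 = 0 := by
    have := congrArg δ hE1
    simp only [Derivation.leibniz, smul_eq_mul, map_sub, map_add, d2, dk, dq, ← hT, ← hT2,
      dn] at this
    have h2u : IsUnit (2 * T : A) := by
      refine IsUnit.mul ?_ ht
      rw [← map_ofNat (algebraMap ℝ A) 2]
      exact (IsUnit.mk0 (2 : ℝ) two_ne_zero).map _
    refine (h2u.mul_right_eq_zero).1 ?_
    linear_combination this
  -- `hE1`, its derivative `hE4` and `hE3` are linear in `T²` and `t * T2`; eliminate these two.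
  have hfin : -189 * t ^ 10 + (-792 * k - 63 * q) * t ^ 8 + (-432 * k * q - 198 * k ^ 2) * t ^ 6
      + (-315 * k ^ 2 * q + 990 * k ^ 3) * t ^ 4 + (558 * k ^ 3 * q - 513 * k ^ 4) * t ^ 2
      + (-72 * k ^ 4 * q + 54 * k ^ 5) = 0 := by
    linear_combination ((-207 * t ^ 2 + 9 * (7 * t ^ 2 - k)) * (t ^ 2 - k)
        - 9 * (7 * t ^ 2 - k) * t ^ 2) * hE1 + 9 * (t ^ 2 - k) ^ 2 * hE3
      + 9 * (t ^ 2 - k) * (7 * t ^ 2 - k) * t * hE4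
  have hP := eq_zero_of_aeval_eq_zero δ (hT ▸ ht : IsUnit (δ t))
    (C (-189) * X ^ 10 + C (-792 * κ - 63 * c) * X ^ 8 + C (-432 * κ * c - 198 * κ ^ 2) * X ^ 6
      + C (-315 * κ ^ 2 * c + 990 * κ ^ 3) * X ^ 4 + C (558 * κ ^ 3 * c - 513 * κ ^ 4) * X ^ 2
      + C (-72 * κ ^ 4 * c + 54 * κ ^ 5)) (by
        simp only [map_add, map_mul, map_sub, map_pow, map_neg, aeval_X, aeval_C, ← hk, ← hq,
          map_ofNat]
        linear_combination hfin)
  have h10 := congrArg (fun p => Polynomial.coeff p 10) hP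
  simp only [coeff_add, coeff_C_mul, coeff_X_pow, coeff_C, coeff_zero] at h10
  norm_num at h10

/-- The structure equations of a hypersurface of a space form in an orthonormal frame of principal
directions, with connection coefficients `Γ a b d = ⟨∇_{e_a} e_b, e_d⟩` and principal curvatures
`lam a`, the frame vectors acting on functions by the derivations `δ a`. -/
structure PrincipalFrame (δ : Fin 3 → Derivation ℝ A A) (Γ : Fin 3 → Fin 3 → Fin 3 → A)
    (lam : Fin 3 → A) (c : A) : Prop where
  skew : ∀ a b d, Γ a b d = -Γ a d b
  bracket : ∀ a b φ, δ a (δ b φ) - δ b (δ a φ) = ∑ e, (Γ a b e - Γ b a e) * δ e φ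
  codazzi : ∀ a b d, -(if b = d then δ a (lam b) else 0) - lam b * Γ a b d
    + (if a = d then δ b (lam a) else 0) + lam a * Γ b a d + (Γ a b d - Γ b a d) * lam d = 0
  gauss : ∀ a b k d, δ a (Γ b k d) - δ b (Γ a k d)
    + ∑ e, (Γ b k e * Γ a e d - Γ a k e * Γ b e d)
    - (if b = k then lam b else 0) * (if a = d then lam a else 0)
    + (if a = k then lam a else 0) * (if b = d then lam b else 0)
    - ∑ e, (Γ a b e - Γ b a e) * Γ e k d
    = c * ((if b = k then 1 else 0) * (if a = d then 1 else 0)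
      - (if a = k then 1 else 0) * (if b = d then 1 else 0))

/-- There is no frame of principal directions with distinct principal curvatures `t`, `lam 1`,
`lam 2`, where `t` is half the opposite of the trace and varies along the first direction only,
while the norm of the second fundamental form is related to `t` as by the Gauss equation of a
metric of constant scalar curvature. -/
theorem PrincipalFrame.false [Nontrivial A] {δ : Fin 3 → Derivation ℝ A A}
    {Γ : Fin 3 → Fin 3 → Fin 3 → A} {lam : Fin 3 → A} {c : ℝ}
    (h : PrincipalFrame δ Γ lam (algebraMap ℝ A c)) (κ : ℝ)
    (hsum : lam 1 + lam 2 = -3 * lam 0)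
    (hprod : lam 1 * lam 2 = 3 * lam 0 ^ 2 - algebraMap ℝ A κ)
    (h01 : IsUnit (lam 0 - lam 1)) (h02 : IsUnit (lam 0 - lam 2)) (h12 : IsUnit (lam 1 - lam 2))
    (ht0 : IsUnit (δ 0 (lam 0))) (ht1 : δ 1 (lam 0) = 0) (ht2 : δ 2 (lam 0) = 0) : False := by
  have two : IsUnit (2 : A) := by
    rw [← map_ofNat (algebraMap ℝ A) 2]
    exact (IsUnit.mk0 (2 : ℝ) two_ne_zero).map _
  have dn : ∀ (d : Derivation ℝ A A) (n : ℕ) [n.AtLeastTwo], d (ofNat(n) : A) = 0 := by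
    intro d n _
    rw [← map_ofNat (algebraMap ℝ A) n, Derivation.map_algebraMap]
  have diag : ∀ a b, Γ a b b = 0 := by
    intro a b
    refine (two.mul_right_eq_zero).1 ?_
    linear_combination h.skew a b b
  -- All the principal curvatures are constant in the directions 1 and 2.
  have dlam : ∀ d : Derivation ℝ A A, d (lam 0) = 0 → d (lam 1) = 0 ∧ d (lam 2) = 0 := by
    intro d hd
    have e1 := congrArg d hsum
    have e2 := congrArg d hprod
    simp only [Derivation.leibniz, Derivation.leibniz_pow, smul_eq_mul, map_add, map_sub, map_neg,
      dn, hd, Derivation.map_algebraMap, mul_zero, smul_zero, sub_zero, neg_zero, add_zero] at e1 e2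
    have e3 : d (lam 1) = 0 := by
      refine (h12.mul_right_eq_zero).1 ?_
      linear_combination lam 1 * e1 - e2
    exact ⟨e3, by linear_combination e1 - e3⟩
  -- The Codazzi equations, with distinct principal curvatures, kill most connection coefficients.
  obtain ⟨-, d12⟩ := dlam _ ht1
  obtain ⟨d21, -⟩ := dlam _ ht2
  have c10 := h.codazzi 1 0 0
  have c20 := h.codazzi 2 0 0
  have c12 := h.codazzi 1 2 2
  have c21 := h.codazzi 2 1 1
  have c01 := h.codazzi 0 1 1
  have c02 := h.codazzi 0 2 2
  have k120 := h.codazzi 1 2 0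
  have k012 := h.codazzi 0 1 2
  simp only [diag, ht1, ht2, d12, d21, if_true, Fin.reduceEq, if_false] at c10 c20 c12 c21 c01 c02
  simp only [Fin.reduceEq, if_false] at k120 k012
  have g010 : Γ 0 1 0 = 0 := (h01.mul_right_eq_zero).1 (by linear_combination -c10)
  have g020 : Γ 0 2 0 = 0 := (h02.mul_right_eq_zero).1 (by linear_combination -c20)
  have g212 : Γ 2 1 2 = 0 := (h12.mul_right_eq_zero).1 (by linear_combination c12)
  have g121 : Γ 1 2 1 = 0 := (h12.mul_right_eq_zero).1 (by linear_combination -c21)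
  -- The level sets of `t` are integral surfaces of the directions 1 and 2.
  have b12 := h.bracket 1 2 (lam 0)
  simp only [Fin.sum_univ_three, ht1, ht2, map_zero, mul_zero, add_zero, sub_zero] at b12
  have e120 : Γ 1 2 0 - Γ 2 1 0 = 0 := (ht0.mul_left_eq_zero).1 b12.symm
  have g120 : Γ 1 2 0 = 0 := (h12.mul_right_eq_zero).1 (by
    linear_combination k120 + (lam 1 - lam 0) * e120)
  have g210 : Γ 2 1 0 = 0 := by linear_combination g120 - e120
  have g102 : Γ 1 0 2 = 0 := by rw [h.skew, g120, neg_zero]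
  have g201 : Γ 2 0 1 = 0 := by rw [h.skew, g210, neg_zero]
  have g012 : Γ 0 1 2 = 0 := (h12.mul_right_eq_zero).1 (by
    linear_combination (lam 0 - lam 2) * g102 - k012)
  have g021 : Γ 0 2 1 = 0 := by rw [h.skew, g012, neg_zero]
  have g001 : Γ 0 0 1 = 0 := by rw [h.skew, g010, neg_zero]
  have g002 : Γ 0 0 2 = 0 := by rw [h.skew, g020, neg_zero]
  have g221 : Γ 2 2 1 = 0 := by rw [h.skew, g212, neg_zero]
  have g220 : Γ 2 2 0 = -Γ 2 0 2 := h.skew 2 2 0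
  -- Only `Γ 1 0 1` and `Γ 2 0 2` are left; the Gauss equations are differential equations for them.
  have G12 := h.gauss 1 2 2 1
  have G01 := h.gauss 0 1 0 1
  have G02 := h.gauss 0 2 0 2
  simp only [Fin.sum_univ_three, diag, g010, g020, g212, g121, g120, g210, g102, g201, g012, g021,
    g001, g002, g221, g220, if_true, Fin.reduceEq, if_false, map_zero, mul_zero,
    zero_mul, add_zero, zero_add, sub_zero, zero_sub, mul_one] at G12 G01 G02
  exact principal_ode_contradiction (δ 0) c κ (u := Γ 1 0 1) (v := Γ 2 0 2) ht0 hsum hprod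
    (by linear_combination -c01) (by linear_combination -c02)
    (by linear_combination -G12) (by linear_combination G01) (by linear_combination G02)

end
end Biconservative

namespace Biconservative
namespace ConnectionAlong

variable {m : ℕ} {A : Type*} [CommRing A] [Algebra ℝ A] {der : Fin m → Derivation ℝ A A}
  {V : Type*} [AddCommGroup V] [Module A V]

/-! ### Moving frames -/

/-- The derivative of functions in the direction of the vector field with components `X`. -/
def dirDer (der : Fin m → Derivation ℝ A A) (X : Fin m → A) : Derivation ℝ A A :=
  ∑ i, X i • der i

theorem dirDer_apply (X : Fin m → A) (φ : A) : dirDer der X φ = ∑ i, X i * der i φ := by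
  have : ∀ s : Finset (Fin m), (∑ i ∈ s, X i • der i) φ = ∑ i ∈ s, X i * der i φ := by
    intro s
    induction s using Finset.induction_on with
    | empty => simp
    | insert i s hi ih => simp [Finset.sum_insert hi, ih]
  exact this _

variable (C : ConnectionAlong der V)

/-- The covariant derivative in the direction of the vector field with components `X`. -/
def nab (X : Fin m → A) (w : V) : V := ∑ i, X i • C.D i w

/-- The image `dF(X)` of the vector field with components `X`. -/
def push (X : Fin m → A) : V := ∑ i, X i • C.vel i

/-- The components of the Lie bracket `[X, Y]`. -/
def lie (der : Fin m → Derivation ℝ A A) (X Y : Fin m → A) (i : Fin m) : A :=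
  dirDer der X (Y i) - dirDer der Y (X i)

theorem nab_add (X : Fin m → A) (v w : V) : C.nab X (v + w) = C.nab X v + C.nab X w := by
  simp [nab, Finset.sum_add_distrib]

theorem nab_neg (X : Fin m → A) (v : V) : C.nab X (-v) = -C.nab X v := by
  simp [nab]

theorem nab_sum {ι : Type*} (s : Finset ι) (X : Fin m → A) (v : ι → V) :
    C.nab X (∑ k ∈ s, v k) = ∑ k ∈ s, C.nab X (v k) := by
  simp only [nab, map_sum, Finset.smul_sum]
  exact Finset.sum_comm

theorem nab_smul (X : Fin m → A) (φ : A) (w : V) :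
    C.nab X (φ • w) = dirDer der X φ • w + φ • C.nab X w := by
  simp only [nab, dirDer_apply, C.D_smul, smul_add, Finset.sum_add_distrib, Finset.sum_smul,
    Finset.smul_sum, smul_smul, mul_comm]

theorem dirDer_ip (X : Fin m → A) (u v : V) :
    dirDer der X (C.ip u v) = C.ip (C.nab X u) v + C.ip u (C.nab X v) := by
  simp only [nab, dirDer_apply, C.der_ip, mul_add, Finset.sum_add_distrib, map_sum, map_smul,
    LinearMap.sum_apply, LinearMap.smul_apply, smul_eq_mul]

theorem ip_push_push (X Y : Fin m → A) :
    C.ip (C.push X) (C.push Y) = ∑ i, ∑ j, X i * Y j * C.met i j := by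
  simp only [push, map_sum, map_smul, LinearMap.sum_apply, LinearMap.smul_apply, smul_eq_mul, met,
    Finset.mul_sum]
  rw [Finset.sum_comm]
  exact Finset.sum_congr rfl fun i _ => Finset.sum_congr rfl fun j _ => by ring

theorem ip_nab_push (X Y : Fin m → A) {ν : V} (hν : C.IsNormal ν) :
    C.ip (C.nab X (C.push Y)) ν = ∑ i, ∑ j, X i * Y j * C.sf ν i j := by
  simp only [nab, push, C.ip_D_sum, map_sum, map_smul, map_add, LinearMap.sum_apply,
    LinearMap.smul_apply, LinearMap.add_apply, smul_eq_mul, C.ip_comm (C.vel _) ν, hν.ip_vel, sf,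
    Finset.mul_sum, mul_zero, zero_add]
  exact Finset.sum_congr rfl fun i _ => Finset.sum_congr rfl fun j _ => by ring

/-- The connection is torsion free. -/
theorem nab_push_sub (X Y : Fin m → A) :
    C.nab X (C.push Y) - C.nab Y (C.push X) = C.push (lie der X Y) := by
  have h : ∑ i, ∑ j, (X i * Y j) • C.D i (C.vel j) = ∑ i, ∑ j, (Y i * X j) • C.D i (C.vel j) := by
    rw [Finset.sum_comm]
    exact Finset.sum_congr rfl fun i _ => Finset.sum_congr rfl fun j _ => by
      rw [C.torsion, mul_comm]
  have h2 : ∀ X Y : Fin m → A, C.nab X (C.push Y)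
      = C.push (fun i => dirDer der X (Y i)) + ∑ i, ∑ j, (X i * Y j) • C.D i (C.vel j) := by
    intro X Y
    simp only [nab, push, C.ip_D_sum, dirDer_apply, Finset.smul_sum, smul_add,
      Finset.sum_add_distrib, smul_smul, Finset.sum_smul]
    rw [Finset.sum_comm]
  rw [h2, h2, h]
  simp only [push, lie, sub_smul, Finset.sum_sub_distrib]
  abel

theorem dirDer_comm (hcomm : ∀ i j a, der i (der j a) = der j (der i a)) (X Y : Fin m → A) (φ : A) :
    dirDer der X (dirDer der Y φ) - dirDer der Y (dirDer der X φ)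
      = ∑ i, lie der X Y i * der i φ := by
  have h2 : ∀ X Y : Fin m → A, dirDer der X (dirDer der Y φ)
      = ∑ i, dirDer der X (Y i) * der i φ + ∑ i, ∑ j, X i * Y j * der i (der j φ) := by
    intro X Y
    simp only [dirDer_apply, map_sum, Derivation.leibniz, smul_eq_mul, Finset.mul_sum,
      Finset.sum_mul, Finset.sum_add_distrib]
    rw [add_comm]
    congr 1
    · exact Finset.sum_congr rfl fun i _ => Finset.sum_congr rfl fun j _ => by ring
    · rw [Finset.sum_comm]
      exact Finset.sum_congr rfl fun i _ => Finset.sum_congr rfl fun j _ => by ring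
  have h : ∑ i, ∑ j, X i * Y j * der i (der j φ) = ∑ i, ∑ j, Y i * X j * der i (der j φ) := by
    rw [Finset.sum_comm]
    exact Finset.sum_congr rfl fun i _ => Finset.sum_congr rfl fun j _ => by
      rw [hcomm, mul_comm (X j)]
  rw [h2, h2, h]
  simp only [lie, sub_mul, Finset.sum_sub_distrib]
  ring

/-- The definition of the curvature, for arbitrary vector fields. -/
theorem nab_comm {c : A} (hc : C.HasCurvature c) (X Y : Fin m → A) (w : V) :
    C.nab X (C.nab Y w) - C.nab Y (C.nab X w) = C.nab (lie der X Y) w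
      + c • (C.ip (C.push Y) w • C.push X - C.ip (C.push X) w • C.push Y) := by
  have h2 : ∀ X Y : Fin m → A, C.nab X (C.nab Y w)
      = C.nab (fun i => dirDer der X (Y i)) w + ∑ i, ∑ j, (X i * Y j) • C.D i (C.D j w) := by
    intro X Y
    simp only [nab, C.ip_D_sum, dirDer_apply, Finset.smul_sum, smul_add,
      Finset.sum_add_distrib, smul_smul, Finset.sum_smul]
    rw [Finset.sum_comm]
  have h : ∑ i, ∑ j, (X i * Y j) • C.D i (C.D j w) - ∑ i, ∑ j, (Y i * X j) • C.D i (C.D j w)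
      = c • (C.ip (C.push Y) w • C.push X - C.ip (C.push X) w • C.push Y) := by
    have h3 : ∑ i, ∑ j, (Y i * X j) • C.D i (C.D j w) = ∑ i, ∑ j, (X i * Y j) • C.D j (C.D i w) := by
      rw [Finset.sum_comm]
      exact Finset.sum_congr rfl fun i _ => Finset.sum_congr rfl fun j _ => by rw [mul_comm]
    rw [h3]
    simp only [← Finset.sum_sub_distrib, ← smul_sub, hc _ _ w]
    simp only [push, map_sum, map_smul, LinearMap.sum_apply, LinearMap.smul_apply, smul_sub,
      Finset.smul_sum, smul_smul, Finset.sum_sub_distrib, Finset.sum_smul, Finset.sum_mul,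
      smul_eq_mul]
    congr 1
    · exact Finset.sum_congr rfl fun i _ => Finset.sum_congr rfl fun j _ => by
        congr 1; ring
    · rw [Finset.sum_comm]
      exact Finset.sum_congr rfl fun i _ => Finset.sum_congr rfl fun j _ => by
        congr 1; ring
  rw [h2, h2, ← h]
  simp only [nab, lie, sub_smul, Finset.sum_sub_distrib]
  abel

variable {C} {ν : V} {inv : Fin m → Fin m → A} {X : Fin m → Fin m → A}

/-- The matrix `X` of an orthonormal frame satisfies `Xᵀ X g = 1`. -/
theorem sum_frame_mul (horth : ∀ a b, C.ip (C.push (X a)) (C.push (X b)) = if a = b then 1 else 0)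
    (i l : Fin m) : ∑ a, X a i * ∑ j, X a j * C.met j l = if i = l then 1 else 0 := by
  have h1 : (Matrix.of X) * (Matrix.of fun l a => ∑ j, X a j * C.met j l) = 1 := by
    ext a b
    rw [Matrix.one_apply, ← horth, C.ip_push_push, Matrix.mul_apply]
    simp only [Matrix.of_apply, Finset.mul_sum]
    exact Finset.sum_congr rfl fun i _ => Finset.sum_congr rfl fun j _ => by
      rw [C.met_comm j i]; ring
  have h2 := mul_eq_one_comm.1 h1
  have h3 := congrFun (congrFun h2 l) i
  rw [Matrix.mul_apply, Matrix.one_apply] at h3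
  simp only [Matrix.of_apply] at h3
  rw [show (if i = l then (1 : A) else 0) = if l = i then 1 else 0 by simp [eq_comm], ← h3]
  exact Finset.sum_congr rfl fun a _ => mul_comm _ _

/-- The inverse of the first fundamental form is `Xᵀ X` for any orthonormal frame `X`. -/
theorem inv_eq_frame (hinv : ∀ i j, ∑ l, C.met i l * inv l j = if i = j then 1 else 0)
    (horth : ∀ a b, C.ip (C.push (X a)) (C.push (X b)) = if a = b then 1 else 0)
    (i l : Fin m) : inv i l = ∑ a, X a i * X a l := by
  calc inv i l = ∑ k, (∑ a, X a i * ∑ j, X a j * C.met j k) * inv k l := by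
        simp [sum_frame_mul horth]
    _ = ∑ a, X a i * ∑ j, X a j * ∑ k, C.met j k * inv k l := by
        simp only [Finset.sum_mul, Finset.mul_sum]
        rw [Finset.sum_comm]
        refine Finset.sum_congr rfl fun a _ => ?_
        rw [Finset.sum_comm]
        exact Finset.sum_congr rfl fun j _ => Finset.sum_congr rfl fun k _ => by ring
    _ = _ := by simp [hinv]

theorem vel_eq_frame
    (horth : ∀ a b, C.ip (C.push (X a)) (C.push (X b)) = if a = b then 1 else 0) (l : Fin m) :
    C.vel l = ∑ a, (∑ j, X a j * C.met j l) • C.push (X a) := by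
  calc C.vel l = ∑ i, (∑ a, X a i * ∑ j, X a j * C.met j l) • C.vel i := by
        simp [sum_frame_mul horth]
    _ = _ := by
      simp only [push, Finset.sum_smul, Finset.smul_sum, smul_smul]
      rw [Finset.sum_comm]
      exact Finset.sum_congr rfl fun j _ => Finset.sum_congr rfl fun k _ => by
        rw [mul_comm]

theorem IsNormal.ip_push (hν : C.IsNormal ν) (Y : Fin m → A) : C.ip ν (C.push Y) = 0 := by
  simp [push, hν.ip_vel]

theorem IsNormal.eq_sum_frame (hν : C.IsNormal ν)
    (horth : ∀ a b, C.ip (C.push (X a)) (C.push (X b)) = if a = b then 1 else 0) (w : V) :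
    w = ∑ a, C.ip w (C.push (X a)) • C.push (X a) + C.ip w ν • ν := by
  rw [← sub_eq_zero]
  have h1 : ∀ b, C.ip (w - (∑ a, C.ip w (C.push (X a)) • C.push (X a) + C.ip w ν • ν))
      (C.push (X b)) = 0 := by
    intro b
    simp only [map_sub, map_add, map_sum, map_smul, LinearMap.sub_apply, LinearMap.add_apply,
      LinearMap.sum_apply, LinearMap.smul_apply, smul_eq_mul, horth, hν.ip_push]
    simp
  refine hν.eq_zero _ (fun l => ?_) ?_
  · rw [C.vel_eq_frame horth l]
    simp only [map_sum (C.ip _), map_smul (C.ip _), h1, smul_zero, Finset.sum_const_zero]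
  · simp only [map_sub, map_add, map_sum, map_smul, LinearMap.sub_apply, LinearMap.add_apply,
      LinearMap.sum_apply, LinearMap.smul_apply, smul_eq_mul, C.ip_comm (C.push _) ν, hν.ip_push,
      hν.ip_self]
    simp

theorem push_injective (hinv : ∀ i j, ∑ l, C.met i l * inv l j = if i = j then 1 else 0)
    {Y Z : Fin m → A} (h : C.push Y = C.push Z) : Y = Z := by
  have h1 : ∀ W : Fin m → A, ∀ q, ∑ l, C.ip (C.push W) (C.vel l) * inv l q = W q := by
    intro W q
    simp only [push, map_sum, map_smul, LinearMap.sum_apply, LinearMap.smul_apply, smul_eq_mul,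
      Finset.sum_mul]
    rw [Finset.sum_comm]
    calc ∑ i, ∑ l, W i * C.ip (C.vel i) (C.vel l) * inv l q
        = ∑ i, W i * ∑ l, C.met i l * inv l q := by
          simp only [Finset.mul_sum, mul_assoc]; rfl
      _ = W q := by simp [hinv]
  funext q
  rw [← h1 Y, ← h1 Z, h]

/-- The connection coefficients `⟨∇_{e_a} e_b, e_d⟩` of a frame. -/
def frameCoeff (C : ConnectionAlong der V) (X : Fin m → Fin m → A) (a b d : Fin m) : A :=
  C.ip (C.nab (X a) (C.push (X b))) (C.push (X d))

theorem frameCoeff_skew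
    (horth : ∀ a b, C.ip (C.push (X a)) (C.push (X b)) = if a = b then 1 else 0) (a b d : Fin m) :
    C.frameCoeff X a b d = -C.frameCoeff X a d b := by
  have h := C.dirDer_ip (X a) (C.push (X b)) (C.push (X d))
  have h0 : dirDer der (X a) (C.ip (C.push (X b)) (C.push (X d))) = 0 := by
    rw [horth]; split_ifs <;> simp
  rw [h0, C.ip_comm (C.push (X b))] at h
  unfold frameCoeff
  linear_combination -h

theorem lie_frame (hinv : ∀ i j, ∑ l, C.met i l * inv l j = if i = j then 1 else 0)
    (hν : C.IsNormal ν)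
    (horth : ∀ a b, C.ip (C.push (X a)) (C.push (X b)) = if a = b then 1 else 0) (a b : Fin m) :
    lie der (X a) (X b)
      = fun i => ∑ e, (C.frameCoeff X a b e - C.frameCoeff X b a e) * X e i := by
  apply push_injective hinv
  rw [hν.eq_sum_frame horth (C.push (lie der (X a) (X b))), C.ip_comm _ ν, hν.ip_push, zero_smul,
    add_zero, ← C.nab_push_sub]
  simp only [map_sub, LinearMap.sub_apply]
  simp only [push, Finset.smul_sum, Finset.sum_smul, smul_smul]
  rw [Finset.sum_comm]
  rfl

section Principal

variable {lam : Fin m → A}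

theorem nab_lie_frame (hinv : ∀ i j, ∑ l, C.met i l * inv l j = if i = j then 1 else 0)
    (hν : C.IsNormal ν)
    (horth : ∀ a b, C.ip (C.push (X a)) (C.push (X b)) = if a = b then 1 else 0) (a b : Fin m)
    (w : V) : C.nab (lie der (X a) (X b)) w
      = ∑ e, (C.frameCoeff X a b e - C.frameCoeff X b a e) • C.nab (X e) w := by
  rw [lie_frame hinv hν horth]
  simp only [nab, Finset.sum_smul, Finset.smul_sum, smul_smul]
  exact Finset.sum_comm

theorem IsNormal.nab_frame (hν : C.IsNormal ν)
    (horth : ∀ a b, C.ip (C.push (X a)) (C.push (X b)) = if a = b then 1 else 0)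
    (hdiag : ∀ a b, C.ip (C.nab (X a) (C.push (X b))) ν = if a = b then lam a else 0)
    (a b : Fin m) : C.nab (X a) (C.push (X b))
      = ∑ e, C.frameCoeff X a b e • C.push (X e) + (if a = b then lam a else 0) • ν := by
  rw [← hdiag]
  exact hν.eq_sum_frame horth _

theorem IsNormal.ip_nab_normal (hν : C.IsNormal ν) (Y : Fin m → A) : C.ip (C.nab Y ν) ν = 0 := by
  simp [nab, hν.D_normal_self]

theorem IsNormal.ip_nab_normal_push (hν : C.IsNormal ν)
    (hdiag : ∀ a b, C.ip (C.nab (X a) (C.push (X b))) ν = if a = b then lam a else 0)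
    (a b : Fin m) : C.ip (C.nab (X a) ν) (C.push (X b)) = -(if a = b then lam a else 0) := by
  have h := C.dirDer_ip (X a) ν (C.push (X b))
  rw [hν.ip_push, map_zero, C.ip_comm ν, hdiag] at h
  linear_combination -h

/-- Weingarten's equation in a principal frame. -/
theorem IsNormal.nab_normal (hν : C.IsNormal ν)
    (horth : ∀ a b, C.ip (C.push (X a)) (C.push (X b)) = if a = b then 1 else 0)
    (hdiag : ∀ a b, C.ip (C.nab (X a) (C.push (X b))) ν = if a = b then lam a else 0)
    (a : Fin m) : C.nab (X a) ν = -(lam a • C.push (X a)) := by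
  rw [hν.eq_sum_frame horth (C.nab (X a) ν)]
  simp [hν.ip_nab_normal, hν.ip_nab_normal_push hdiag]

end Principal

/-- The structure equations of a hypersurface of a space form in a frame of principal directions. -/
theorem IsNormal.principalFrame {der : Fin 3 → Derivation ℝ A A} {C : ConnectionAlong der V} {ν : V}
    {inv : Fin 3 → Fin 3 → A} {X : Fin 3 → Fin 3 → A} {lam : Fin 3 → A} {c : A}
    (hcomm : ∀ i j a, der i (der j a) = der j (der i a))
    (hinv : ∀ i j, ∑ l, C.met i l * inv l j = if i = j then 1 else 0)
    (hν : C.IsNormal ν) (hc : C.HasCurvature c)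
    (horth : ∀ a b, C.ip (C.push (X a)) (C.push (X b)) = if a = b then 1 else 0)
    (hdiag : ∀ a b, C.ip (C.nab (X a) (C.push (X b))) ν = if a = b then lam a else 0) :
    PrincipalFrame (fun a => dirDer der (X a)) (C.frameCoeff X) lam c where
  skew := frameCoeff_skew horth
  bracket a b φ := by
    rw [dirDer_comm hcomm, lie_frame hinv hν horth]
    simp only [dirDer_apply, Finset.sum_mul, Finset.mul_sum]
    rw [Finset.sum_comm]
    exact Finset.sum_congr rfl fun i _ => Finset.sum_congr rfl fun j _ => by ring
  codazzi a b d := by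
    have h := congrArg (fun w => C.ip w (C.push (X d))) (C.nab_comm hc (X a) (X b) ν)
    simp only [nab_lie_frame hinv hν horth, hν.nab_normal horth hdiag, C.nab_neg, C.nab_smul,
      C.ip_comm (C.push _) ν, hν.ip_push, zero_smul, sub_zero, smul_zero, add_zero] at h
    simp only [map_sub, map_add, map_neg, map_sum, map_smul, LinearMap.sub_apply, smul_neg,
      LinearMap.add_apply, LinearMap.neg_apply, LinearMap.sum_apply, LinearMap.smul_apply,
      smul_eq_mul, horth, ← frameCoeff.eq_1, mul_ite, mul_one, mul_zero, Finset.sum_neg_distrib,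
      Finset.sum_ite_eq', Finset.mem_univ, if_true] at h
    linear_combination h
  gauss a b k d := by
    have h := congrArg (fun w => C.ip w (C.push (X d))) (C.nab_comm hc (X a) (X b) (C.push (X k)))
    have h1 : ∀ a b, C.ip (C.nab (X a) (C.nab (X b) (C.push (X k)))) (C.push (X d))
        = dirDer der (X a) (C.frameCoeff X b k d) + ∑ e, C.frameCoeff X b k e * C.frameCoeff X a e d
          - (if b = k then lam b else 0) * (if a = d then lam a else 0) := by
      intro a b
      rw [hν.nab_frame horth hdiag b k, C.nab_add, C.nab_sum, C.nab_smul]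
      simp only [C.nab_smul, map_add, map_sum, map_smul, LinearMap.add_apply,
        LinearMap.sum_apply, LinearMap.smul_apply, smul_eq_mul, horth, hν.ip_push,
        hν.ip_nab_normal_push hdiag, ← frameCoeff.eq_1, Finset.sum_add_distrib, mul_ite, mul_one,
        mul_zero, Finset.sum_ite_eq', Finset.mem_univ, if_true]
      split_ifs <;> ring
    simp only [map_sub, map_add, LinearMap.sub_apply, LinearMap.add_apply, h1,
      nab_lie_frame hinv hν horth] at h
    simp only [map_sum, map_smul, map_sub, LinearMap.sum_apply, LinearMap.smul_apply,
      LinearMap.sub_apply, smul_eq_mul, horth, ← frameCoeff.eq_1] at h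
    simp only [Finset.sum_sub_distrib] at h ⊢
    linear_combination h

end ConnectionAlong
end Biconservative

namespace Biconservative

/-! ### Existence of frames -/

/-- The properties of the evaluation of smooth germs at the base point from which orthonormal
frames are built: germs with nonzero value are invertible, germs with positive value have square
roots. -/
structure IsLocalEval {A : Type*} [CommRing A] [Algebra ℝ A] (ev : A →ₐ[ℝ] ℝ) : Prop where
  isUnit : ∀ a, ev a ≠ 0 → IsUnit a
  sqrt : ∀ a, 0 < ev a → ∃ b, b * b = a

variable {A : Type*} [CommRing A] [Algebra ℝ A] {ev : A →ₐ[ℝ] ℝ}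

theorem IsLocalEval.exists_mul_mul_eq_one (hev : IsLocalEval ev) {a : A} (ha : 0 < ev a) :
    ∃ r, IsUnit r ∧ r * r * a = 1 := by
  obtain ⟨b, hb⟩ := hev.sqrt a ha
  have hb0 : ev b ≠ 0 := by
    intro h
    rw [← hb, map_mul, h, mul_zero] at ha
    exact ha.false
  obtain ⟨r, hr⟩ := (hev.isUnit b hb0).exists_left_inv
  exact ⟨r, IsUnit.of_mul_eq_one b hr, by rw [← hb]; linear_combination (r * b + 1) * hr⟩

section Extend

variable {n : ℕ} (B : (Fin n → A) →ₗ[A] (Fin n → A) →ₗ[A] A)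

/-- An orthonormal system of fewer than `n` vectors can be extended. -/
theorem IsLocalEval.exists_orthonormal_extension (hev : IsLocalEval ev)
    (hpos : ∀ w : Fin n → A, (∃ i, ev (w i) ≠ 0) → 0 < ev (B w w))
    {k : ℕ} (hk : k < n) (v : Fin k → Fin n → A)
    (hv : ∀ a b, B (v a) (v b) = if a = b then 1 else 0) :
    ∃ w, B w w = 1 ∧ ∀ a, B w (v a) = 0 := by
  -- Apply the Gram-Schmidt process to a constant vector outside the span of the values of `v` at the
  -- base point, so that the result does not vanish there.
  let ve : Fin k → Fin n → ℝ := fun a i => ev (v a i)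
  obtain ⟨w0, hw0⟩ : ∃ w0 : Fin n → ℝ, w0 ∉ Submodule.span ℝ (Set.range ve) := by
    by_contra! hall
    have h1 : Submodule.span ℝ (Set.range ve) = ⊤ := Submodule.eq_top_iff'.2 hall
    have h2 := finrank_range_le_card (R := ℝ) ve
    rw [Set.finrank, h1, finrank_top] at h2
    simp at h2
    omega
  let w1 : Fin n → A := (fun i => algebraMap ℝ A (w0 i))
    - ∑ a, B (fun i => algebraMap ℝ A (w0 i)) (v a) • v a
  have h1 : ∀ b, B w1 (v b) = 0 := by
    intro b
    simp only [w1, map_sub, map_sum, map_smul, LinearMap.sub_apply, LinearMap.sum_apply,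
      LinearMap.smul_apply, smul_eq_mul, hv]
    simp
  have h2 : ∃ i, ev (w1 i) ≠ 0 := by
    by_contra! hall
    apply hw0
    have : w0 = ∑ a, ev (B (fun i => algebraMap ℝ A (w0 i)) (v a)) • ve a := by
      funext i
      have h3 := hall i
      simp only [w1, Pi.sub_apply, Finset.sum_apply, Pi.smul_apply, smul_eq_mul, map_sub, map_sum,
        map_mul, AlgHom.commutes, Algebra.algebraMap_self, RingHom.id_apply] at h3
      simp only [Finset.sum_apply, Pi.smul_apply, smul_eq_mul, ve]
      linarith
    rw [this]
    exact Submodule.sum_mem _ fun a _ => Submodule.smul_mem _ _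
      (Submodule.subset_span (Set.mem_range_self a))
  obtain ⟨r, -, hr⟩ := hev.exists_mul_mul_eq_one (hpos w1 h2)
  refine ⟨r • w1, ?_, fun a => ?_⟩
  · simp only [map_smul, LinearMap.smul_apply, smul_eq_mul]
    linear_combination hr
  · simp [h1]

end Extend

/-- A vector orthogonal to an orthonormal system of `n` vectors vanishes. -/
theorem eq_zero_of_orthogonal {R : Type*} [CommRing R] {n : ℕ}
    (B : (Fin n → R) →ₗ[R] (Fin n → R) →ₗ[R] R) (v : Fin n → Fin n → R)
    (hv : ∀ a b, B (v a) (v b) = if a = b then 1 else 0) (w : Fin n → R)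
    (hw : ∀ a, B w (v a) = 0) : w = 0 := by
  have hexp : ∀ (u : Fin n → R) z, B u z = ∑ i, u i * B (Pi.single i 1) z := by
    intro u z
    conv_lhs => rw [pi_eq_sum_univ' u]
    simp only [map_sum, map_smul, LinearMap.sum_apply, LinearMap.smul_apply, smul_eq_mul]
  have h1 : (Matrix.of v) * (Matrix.of fun i b => B (Pi.single i 1) (v b)) = 1 := by
    ext a b
    rw [Matrix.mul_apply, Matrix.one_apply, ← hv, hexp]
    rfl
  have h2 := mul_eq_one_comm.1 h1
  have h3 : Matrix.vecMul w (Matrix.of fun i b => B (Pi.single i 1) (v b)) = 0 := by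
    funext b
    rw [Pi.zero_apply, ← hw b, hexp]
    rfl
  rw [← Matrix.vecMul_one w, ← h2, ← Matrix.vecMul_vecMul, h3, Matrix.zero_vecMul]


namespace ConnectionAlong

section
variable {m : ℕ} {der : Fin m → Derivation ℝ A A}
  {V : Type*} [AddCommGroup V] [Module A V] (C : ConnectionAlong der V)

theorem push_add (X Y : Fin m → A) : C.push (X + Y) = C.push X + C.push Y := by
  simp [push, add_smul, Finset.sum_add_distrib]

theorem push_smul (a : A) (X : Fin m → A) : C.push (a • X) = a • C.push X := by
  simp [push, Finset.smul_sum, smul_smul]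

/-- The first fundamental form. -/
def firstForm : (Fin m → A) →ₗ[A] (Fin m → A) →ₗ[A] A :=
  LinearMap.mk₂ A (fun X Y => C.ip (C.push X) (C.push Y))
    (by intros; simp [push_add]) (by intros; simp [push_smul])
    (by intros; simp [push_add]) (by intros; simp [push_smul])

theorem firstForm_apply (X Y : Fin m → A) : C.firstForm X Y = C.ip (C.push X) (C.push Y) := rfl

/-- The scalar second fundamental form, as a bilinear form. -/
def secondBilin (ν : V) : (Fin m → A) →ₗ[A] (Fin m → A) →ₗ[A] A :=
  LinearMap.mk₂ A (fun X Y => ∑ i, ∑ j, X i * Y j * C.sf ν i j)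
    (by intros; simp [add_mul, Finset.sum_add_distrib])
    (by intros; simp [Finset.mul_sum, mul_assoc])
    (by intros; simp [mul_add, add_mul, Finset.sum_add_distrib])
    (by intros; simp only [Pi.smul_apply, smul_eq_mul, Finset.mul_sum]
        exact Finset.sum_congr rfl fun _ _ => Finset.sum_congr rfl fun _ _ => by ring)

theorem secondBilin_apply (ν : V) (X Y : Fin m → A) :
    C.secondBilin ν X Y = ∑ i, ∑ j, X i * Y j * C.sf ν i j := rfl

theorem secondBilin_comm (ν : V) (X Y : Fin m → A) :
    C.secondBilin ν X Y = C.secondBilin ν Y X := by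
  rw [secondBilin_apply, secondBilin_apply, Finset.sum_comm]
  exact Finset.sum_congr rfl fun _ _ => Finset.sum_congr rfl fun _ _ => by
    rw [C.sf_comm ν]; ring

variable {C} {ν : V} {inv : Fin m → Fin m → A} {X : Fin m → Fin m → A}

theorem trace_eq_frame (hinv : ∀ i j, ∑ l, C.met i l * inv l j = if i = j then 1 else 0)
    (horth : ∀ a b, C.ip (C.push (X a)) (C.push (X b)) = if a = b then 1 else 0) :
    C.trace inv ν = ∑ a, C.secondBilin ν (X a) (X a) := by
  simp only [trace, inv_eq_frame hinv horth, secondBilin_apply, Finset.sum_mul]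
  calc ∑ i, ∑ j, ∑ a, X a i * X a j * C.sf ν i j
      = ∑ i, ∑ a, ∑ j, X a i * X a j * C.sf ν i j :=
        Finset.sum_congr rfl fun _ _ => Finset.sum_comm
    _ = _ := Finset.sum_comm

theorem norm_sq_eq_frame (hinv : ∀ i j, ∑ l, C.met i l * inv l j = if i = j then 1 else 0)
    (horth : ∀ a b, C.ip (C.push (X a)) (C.push (X b)) = if a = b then 1 else 0) :
    ∑ j, ∑ k, ∑ i, ∑ p, inv j k * inv p i * (C.sf ν i k * C.sf ν j p)
      = ∑ a, ∑ b, C.secondBilin ν (X a) (X b) ^ 2 := by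
  -- Both sides are the trace of the square of the matrix `g⁻¹ b`, where `g⁻¹ = Xᵀ X`.
  let S : Matrix (Fin m) (Fin m) A := Matrix.of fun i j => C.sf ν i j
  let Xm : Matrix (Fin m) (Fin m) A := Matrix.of X
  let G : Matrix (Fin m) (Fin m) A := Matrix.of inv
  have hG : G = Xm.transpose * Xm := by
    ext i j
    simp [G, Xm, Matrix.mul_apply, inv_eq_frame hinv horth]
  have hS : ∀ a b, C.secondBilin ν (X a) (X b) = (Xm * S * Xm.transpose) a b := by
    intro a b
    simp only [secondBilin_apply, Matrix.mul_apply, S, Xm, Matrix.of_apply, Matrix.transpose_apply,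
      Finset.sum_mul]
    rw [Finset.sum_comm]
    exact Finset.sum_congr rfl fun _ _ => Finset.sum_congr rfl fun _ _ => by ring
  have h1 : ∑ a, ∑ b, C.secondBilin ν (X a) (X b) ^ 2
      = Matrix.trace ((Xm * S * Xm.transpose) * (Xm * S * Xm.transpose)) := by
    simp only [Matrix.trace, Matrix.diag, Matrix.mul_apply (M := Xm * S * Xm.transpose)]
    refine Finset.sum_congr rfl fun a _ => Finset.sum_congr rfl fun b _ => ?_
    rw [← hS, ← hS, C.secondBilin_comm ν (X b)]
    ring
  have h2 : Matrix.trace ((Xm * S * Xm.transpose) * (Xm * S * Xm.transpose))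
      = Matrix.trace ((G * S) * (G * S)) := by
    rw [hG]
    calc Matrix.trace ((Xm * S * Xm.transpose) * (Xm * S * Xm.transpose))
        = Matrix.trace (Xm * (S * Xm.transpose * Xm * S * Xm.transpose)) := by
          simp only [Matrix.mul_assoc]
      _ = _ := by
          rw [Matrix.trace_mul_comm]
          have : S * Xm.transpose * Xm * S * Xm.transpose * Xm
            = S * (Xm.transpose * Xm * S * (Xm.transpose * Xm)) := by simp only [Matrix.mul_assoc]
          rw [this, Matrix.trace_mul_comm]
          simp only [Matrix.mul_assoc]
  rw [h1, h2]
  simp only [Matrix.trace, Matrix.diag, Matrix.mul_apply, Finset.sum_mul, Finset.mul_sum, G, S,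
    Matrix.of_apply]
  calc ∑ j, ∑ k, ∑ i, ∑ p, inv j k * inv p i * (C.sf ν i k * C.sf ν j p)
      = ∑ k, ∑ j, ∑ i, ∑ p, inv j k * inv p i * (C.sf ν i k * C.sf ν j p) := Finset.sum_comm
    _ = ∑ k, ∑ p, ∑ i, ∑ j, inv j k * inv p i * (C.sf ν i k * C.sf ν j p) := by
        refine Finset.sum_congr rfl fun k _ => ?_
        calc ∑ j, ∑ i, ∑ p, inv j k * inv p i * (C.sf ν i k * C.sf ν j p)
            = ∑ j, ∑ p, ∑ i, inv j k * inv p i * (C.sf ν i k * C.sf ν j p) :=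
              Finset.sum_congr rfl fun _ _ => Finset.sum_comm
          _ = ∑ p, ∑ j, ∑ i, inv j k * inv p i * (C.sf ν i k * C.sf ν j p) := Finset.sum_comm
          _ = _ := Finset.sum_congr rfl fun _ _ => Finset.sum_comm
    _ = _ := by
        refine Finset.sum_congr rfl fun k _ => Finset.sum_congr rfl fun p _ =>
          Finset.sum_congr rfl fun i _ => Finset.sum_congr rfl fun j _ => ?_
        rw [show inv j k = inv k j by
          rw [inv_eq_frame hinv horth, inv_eq_frame hinv horth]
          exact Finset.sum_congr rfl fun _ _ => mul_comm _ _]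
        ring

end

end ConnectionAlong
end Biconservative

namespace Biconservative

/-! ### The trace of the second fundamental form has no regular point -/

variable {A : Type*} [CommRing A] [Algebra ℝ A] {ev : A →ₐ[ℝ] ℝ}

/-- A symmetric `2 × 2` matrix over `A` with distinct eigenvalues at the base point is diagonalized
by a rotation. -/
theorem IsLocalEval.exists_rotation (hev : IsLocalEval ev) {p q r l : A}
    (hchar : (l - p) * (l - r) = q * q) (hl : ev (l - p) ≠ 0 ∨ ev (l - r) ≠ 0) :
    ∃ α β : A, α * α + β * β = 1 ∧ p * α + q * β = l * α ∧ q * α + r * β = l * β := by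
  have key : ∀ a b : A, (ev a ≠ 0 ∨ ev b ≠ 0) → p * a + q * b = l * a → q * a + r * b = l * b →
      ∃ α β : A, α * α + β * β = 1 ∧ p * α + q * β = l * α ∧ q * α + r * β = l * β := by
    intro a b hab h1 h2
    have hpos : 0 < ev (a * a + b * b) := by
      rw [map_add, map_mul, map_mul]
      rcases hab with h | h
      · exact add_pos_of_pos_of_nonneg (mul_self_pos.2 h) (mul_self_nonneg _)
      · exact add_pos_of_nonneg_of_pos (mul_self_nonneg _) (mul_self_pos.2 h)
    obtain ⟨s, -, hs⟩ := hev.exists_mul_mul_eq_one hpos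
    exact ⟨s * a, s * b, by linear_combination hs, by linear_combination s * h1,
      by linear_combination s * h2⟩
  rcases hl with h | h
  · exact key q (l - p) (Or.inr h) (by ring) (by linear_combination -hchar)
  · exact key (l - r) q (Or.inl h) (by linear_combination -hchar) (by ring)

namespace ConnectionAlong

variable {der : Fin 3 → Derivation ℝ A A} {V : Type*} [AddCommGroup V] [Module A V]
  {C : ConnectionAlong der V} {ν : V} {inv : Fin 3 → Fin 3 → A}

theorem ip_push_grad (hinv : ∀ i j, ∑ l, C.met i l * inv l j = if i = j then 1 else 0)
    (f : A) (Y : Fin 3 → A) :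
    C.ip (C.push fun i => ∑ k, inv i k * der k f) (C.push Y) = dirDer der Y f := by
  rw [C.ip_comm, C.ip_push_push, dirDer_apply]
  refine Finset.sum_congr rfl fun i _ => ?_
  calc ∑ j, Y i * (∑ k, inv j k * der k f) * C.met i j
      = Y i * ∑ k, (∑ j, C.met i j * inv j k) * der k f := by
        simp only [Finset.mul_sum, Finset.sum_mul]
        rw [Finset.sum_comm]
        exact Finset.sum_congr rfl fun _ _ => Finset.sum_congr rfl fun _ _ => by ring
    _ = _ := by simp [hinv]

/-- On a biconservative hypersurface of constant scalar curvature, the trace `f` of the second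
fundamental form cannot have a nonzero differential at a point where the principal curvatures are
distinct; in terms of `t = -f / 2` and `κ`, these are `t` and the roots of `x² + 3 t x + 3 t² - κ`,
and they are distinct when `4 κ - 3 t²` and `7 t² - κ` do not vanish. -/
theorem IsNormal.not_regular (hν : C.IsNormal ν) (hev : IsLocalEval ev)
    (hcomm : ∀ i j a, der i (der j a) = der j (der i a))
    (hinv : ∀ i j, ∑ l, C.met i l * inv l j = if i = j then 1 else 0)
    (hsymm : ∀ i j, inv i j = inv j i)
    (hpos : ∀ Y : Fin 3 → A, (∃ i, ev (Y i) ≠ 0) → 0 < ev (C.ip (C.push Y) (C.push Y)))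
    {c R κ : ℝ} (hc : C.HasCurvature (algebraMap ℝ A c)) (hR : C.scal inv = algebraMap ℝ A R)
    (hκ : 2 * κ = 6 * c - R)
    (hbi : ∀ j, C.dvg inv (C.stress inv) j = 0)
    (h1 : 3 * ev (C.trace inv ν) ^ 2 ≠ 16 * κ) (h2 : 7 * ev (C.trace inv ν) ^ 2 ≠ 4 * κ)
    (i₀ : Fin 3) (hreg : ev (der i₀ (C.trace inv ν)) ≠ 0) : False := by
  have : Nontrivial A := ev.toRingHom.domain_nontrivial
  obtain ⟨f, hf⟩ : ∃ f, f = C.trace inv ν := ⟨_, rfl⟩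
  obtain ⟨hlf, hhlf⟩ : ∃ a : A, a = algebraMap ℝ A (1 / 2) := ⟨_, rfl⟩
  have hhalf : 2 * hlf = 1 := by
    rw [hhlf, two_mul]; exact algebraMap_half_add
  have evhalf : ev hlf = 1 / 2 := by rw [hhlf, AlgHom.commutes]; rfl
  have dhalf : ∀ d : Derivation ℝ A A, d hlf = 0 := fun d => by
    rw [hhlf, Derivation.map_algebraMap]
  set t : A := -(hlf * f) with ht
  obtain ⟨k, hk⟩ : ∃ k : A, k = algebraMap ℝ A κ := ⟨_, rfl⟩
  have evk : ev k = κ := by rw [hk, AlgHom.commutes]; rfl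
  have evt : ev t = -(ev f / 2) := by rw [ht, map_neg, map_mul, evhalf]; ring
  rw [← hf] at h1 h2 hreg
  -- `grad f` is a principal direction with principal curvature `t`.
  have hsg : ∀ Y : Fin 3 → A, C.secondBilin ν (fun i => ∑ k, inv i k * der k f) Y
      = t * dirDer der Y f := by
    intro Y
    have e : ∀ j, ∑ i, (∑ k, inv i k * der k f) * C.sf ν i j = t * der j f := by
      intro j
      have := hν.sf_grad hinv hsymm hc j (hbi j)
      rw [← hf] at this
      rw [this, ht, hhlf]
    rw [secondBilin_apply, Finset.sum_comm, dirDer_apply, Finset.mul_sum]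
    refine Finset.sum_congr rfl fun j _ => ?_
    calc ∑ i, (∑ k, inv i k * der k f) * Y j * C.sf ν i j
        = Y j * ∑ i, (∑ k, inv i k * der k f) * C.sf ν i j := by
          rw [Finset.mul_sum]
          exact Finset.sum_congr rfl fun _ _ => by ring
      _ = _ := by rw [e]; ring
  set G : Fin 3 → A := fun i => ∑ k, inv i k * der k f with hG
  have hGne : ∃ i, ev (G i) ≠ 0 := by
    by_contra! hall
    apply hreg
    have h3 : C.ip (C.push G) (C.vel i₀) = der i₀ f := by
      have h4 := C.ip_push_grad hinv f (Pi.single i₀ 1)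
      rw [dirDer_apply] at h4
      simpa [push, Pi.single_apply] using h4
    rw [← h3]
    simp [push, hall]
  obtain ⟨s, hsu, hs⟩ := hev.exists_mul_mul_eq_one (hpos G hGne)
  have hsne : ev s ≠ 0 := (hsu.map ev).ne_zero
  obtain ⟨X0, hX0d⟩ : ∃ X0, X0 = s • G := ⟨_, rfl⟩
  have hX0 : C.firstForm X0 X0 = 1 := by
    rw [hX0d]
    simp only [map_smul, LinearMap.smul_apply, smul_eq_mul, firstForm_apply]
    linear_combination hs
  have hgrad : ∀ Y, C.firstForm X0 Y = s * dirDer der Y f := by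
    intro Y
    rw [hX0d, map_smul, LinearMap.smul_apply, firstForm_apply, C.ip_push_grad hinv, smul_eq_mul]
  have hsec : ∀ Y, C.secondBilin ν X0 Y = t * C.firstForm X0 Y := by
    intro Y
    rw [hgrad, hX0d, map_smul, LinearMap.smul_apply, hsg, smul_eq_mul]
    ring
  have hff : ∀ X Y, C.firstForm X Y = C.firstForm Y X := fun X Y => C.ip_comm _ _
  have hder0 : IsUnit (dirDer der X0 f) := by
    have h3 := hgrad X0
    rw [hX0] at h3
    exact IsUnit.of_mul_eq_one s (by rw [mul_comm]; exact h3.symm)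
  -- Complete the normalized gradient to an orthonormal frame.
  obtain ⟨Y1, h11, h10'⟩ := hev.exists_orthonormal_extension C.firstForm hpos (k := 1) (by norm_num)
    (fun _ => X0) (fun a b => by rw [hX0]; simp [Subsingleton.elim a b])
  have h10 := h10' 0
  obtain ⟨Y2, h22, h2'⟩ := hev.exists_orthonormal_extension C.firstForm hpos (k := 2) (by norm_num)
    ![X0, Y1] (fun a b => by
      have e01 := (hff X0 Y1).trans h10
      fin_cases a <;> fin_cases b <;> simp only [Fin.zero_eta, Fin.mk_one, Fin.isValue,
        Matrix.cons_val_zero, Matrix.cons_val_one, hX0, h11, h10, e01] <;> simp)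
  have h20 : C.firstForm Y2 X0 = 0 := h2' 0
  have h21 : C.firstForm Y2 Y1 = 0 := h2' 1
  have h01 := (hff X0 Y1).trans h10
  have h02 := (hff X0 Y2).trans h20
  have h12 := (hff Y1 Y2).trans h21
  obtain ⟨p, hp⟩ : ∃ p, p = C.secondBilin ν Y1 Y1 := ⟨_, rfl⟩
  obtain ⟨q, hq⟩ : ∃ q, q = C.secondBilin ν Y1 Y2 := ⟨_, rfl⟩
  obtain ⟨r, hr⟩ : ∃ r, r = C.secondBilin ν Y2 Y2 := ⟨_, rfl⟩
  have hq' : C.secondBilin ν Y2 Y1 = q := by rw [C.secondBilin_comm, hq]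
  have hs00 : C.secondBilin ν X0 X0 = t := by rw [hsec, hX0, mul_one]
  have hs01 : C.secondBilin ν X0 Y1 = 0 := by rw [hsec, h01, mul_zero]
  have hs02 : C.secondBilin ν X0 Y2 = 0 := by rw [hsec, h02, mul_zero]
  have hs10 := (C.secondBilin_comm ν Y1 X0).trans hs01
  have hs20 := (C.secondBilin_comm ν Y2 X0).trans hs02
  have horth : ∀ a b : Fin 3, C.ip (C.push ((![X0, Y1, Y2] : Fin 3 → Fin 3 → A) a))
      (C.push ((![X0, Y1, Y2] : Fin 3 → Fin 3 → A) b)) = if a = b then 1 else 0 := by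
    intro a b
    change C.firstForm _ _ = _
    fin_cases a <;> fin_cases b <;> simp [hX0, h11, h22, h10, h20, h21, h01, h02, h12]
  -- The trace and the determinant of the second fundamental form on the complement of `grad f` are
  -- known from the definition of `f` and from the Gauss equation.
  have htr : p + r = -3 * t := by
    have h3 := C.trace_eq_frame (ν := ν) hinv horth
    simp only [Fin.sum_univ_three, Matrix.cons_val_zero, Matrix.cons_val_one, Matrix.cons_val,
      hs00, ← hp, ← hr, ← hf] at h3
    linear_combination -h3 - f * hhalf - 2 * ht
  have hdet : p * r - q * q = 3 * t ^ 2 - k := by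
    have h3 := hν.scal_eq hinv hsymm hc
    rw [norm_sq_eq_frame hinv horth, hR] at h3
    simp only [Fin.sum_univ_three, Matrix.cons_val_zero, Matrix.cons_val_one, Matrix.cons_val,
      hs00, hs01, hs02, hs10, hs20, ← hp, ← hq, ← hr, hq', ← hf] at h3
    have h4 : 2 * k = 6 * algebraMap ℝ A c - algebraMap ℝ A R := by
      have := congrArg (algebraMap ℝ A) hκ
      rw [map_mul, map_sub, map_mul, map_ofNat, map_ofNat] at this
      rw [hk, this]
    have h5 : 2 * (p * r - q * q) = 2 * (3 * t ^ 2 - k) := by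
      have hf2 : f = -2 * t := by linear_combination -f * hhalf - 2 * ht
      rw [hf2] at h3
      push_cast at h3
      linear_combination (p + r - 3 * t) * htr - h3 + h4
    linear_combination hlf * h5 - (p * r - q * q - 3 * t ^ 2 + k) * hhalf
  have hdisc : (p - r) ^ 2 + 4 * (q * q) = 4 * k - 3 * t ^ 2 := by
    linear_combination (p + r - 3 * t) * htr - 4 * hdet
  have hdpos : 0 < ev (4 * k - 3 * t ^ 2) := by
    refine lt_of_le_of_ne ?_ ?_
    · rw [← hdisc, map_add, map_mul, map_mul, map_pow, map_ofNat]
      nlinarith [sq_nonneg (ev (p - r)), mul_self_nonneg (ev q)]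
    · rw [map_sub, map_mul, map_mul, map_pow, map_ofNat, map_ofNat, evt, evk]
      intro h0
      apply h1
      linarith
  -- `Δ` is the difference of the two other principal curvatures `l1` and `l2`.
  obtain ⟨Δ, hΔ⟩ := hev.sqrt _ hdpos
  have hΔne : ev Δ ≠ 0 := by
    intro h0
    rw [← hΔ, map_mul, h0, mul_zero] at hdpos
    exact hdpos.false
  set l1 : A := hlf * (-3 * t + Δ) with hl1
  set l2 : A := hlf * (-3 * t - Δ) with hl2
  have hsum : l1 + l2 = -3 * t := by
    linear_combination hl1 + hl2 + (-3 * t) * hhalf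
  have hdiff : l1 - l2 = Δ := by
    linear_combination hl1 - hl2 + Δ * hhalf
  have hprod : l1 * l2 = 3 * t ^ 2 - k := by
    have h3 : 4 * (hlf * hlf) = 1 := by linear_combination (2 * hlf + 1) * hhalf
    rw [hl1, hl2]
    linear_combination -hlf * hlf * hΔ + (3 * t ^ 2 - k) * h3
  have hchar : (l1 - p) * (l1 - r) = q * q := by
    linear_combination -l1 * htr + hdet - hprod + l1 * hsum
  obtain ⟨α, β, hαβ, ha, hb⟩ := hev.exists_rotation hchar (by
    by_contra! hall
    apply hΔne
    have : Δ = (l1 - p) + (l1 - r) := by linear_combination -hdiff + htr - hsum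
    rw [this, map_add, hall.1, hall.2, add_zero])
  set X : Fin 3 → Fin 3 → A := ![X0, α • Y1 + β • Y2, -β • Y1 + α • Y2] with hX
  have horthX : ∀ a b, C.ip (C.push (X a)) (C.push (X b)) = if a = b then 1 else 0 := by
    intro a b
    change C.firstForm _ _ = _
    fin_cases a <;> fin_cases b <;> simp only [hX, Fin.zero_eta, Fin.mk_one, Fin.reduceFinMk,
      Matrix.cons_val_zero, Matrix.cons_val_one, Matrix.cons_val, map_add, map_smul,
      LinearMap.add_apply, LinearMap.smul_apply, smul_eq_mul, hX0, h11, h22,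
      h10, h20, h21, h01, h02, h12, if_true, Fin.reduceEq, if_false] <;>
      first | ring1 | linear_combination hαβ
  set lam : Fin 3 → A := ![t, l1, l2] with hlam
  have hdiagX : ∀ a b, C.ip (C.nab (X a) (C.push (X b))) ν = if a = b then lam a else 0 := by
    intro a b
    rw [C.ip_nab_push _ _ hν, ← C.secondBilin_apply]
    fin_cases a <;> fin_cases b <;> simp only [hX, hlam, Fin.zero_eta, Fin.mk_one, Fin.reduceFinMk,
      Matrix.cons_val_zero, Matrix.cons_val_one, Matrix.cons_val, map_add, map_smul,
      LinearMap.add_apply, LinearMap.smul_apply, smul_eq_mul, hs00, hs01, hs02,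
      hs10, hs20, ← hp, ← hq, ← hr, hq', if_true, Fin.reduceEq, if_false] <;>
      first
      | ring1
      | linear_combination α * ha + β * hb + l1 * hαβ
      | linear_combination α * hb - β * ha
      | linear_combination (p + r) * hαβ - α * ha - β * hb - l1 * hαβ + htr - hsum
  have hder : ∀ Y, C.firstForm X0 Y = 0 → dirDer der Y t = 0 := by
    intro Y hY
    have h3 : dirDer der Y f = 0 := (hsu.mul_right_eq_zero).1 ((hgrad Y).symm.trans hY)
    rw [ht, map_neg, Derivation.leibniz, h3, dhalf]
    simp
  have hmul : IsUnit ((t - l1) * (t - l2)) := by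
    refine hev.isUnit _ ?_
    have h3 : (t - l1) * (t - l2) = 7 * t ^ 2 - k := by linear_combination hprod - t * hsum
    rw [h3, map_sub, map_mul, map_pow, map_ofNat, evt, evk]
    intro h0
    apply h2
    linarith
  have hframe := hν.principalFrame hcomm hinv hc horthX hdiagX
  refine hframe.false κ ?_ ?_ (isUnit_of_mul_isUnit_left hmul) (isUnit_of_mul_isUnit_right hmul)
    ?_ ?_ (hder _ ?_) (hder _ ?_)
  · exact hsum
  · rw [← hk]; exact hprod
  · change IsUnit (l1 - l2)
    rw [hdiff]
    exact hev.isUnit _ hΔne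
  · change IsUnit (dirDer der X0 t)
    rw [ht, map_neg, Derivation.leibniz, dhalf, smul_zero, add_zero, smul_eq_mul]
    exact ((IsUnit.of_mul_eq_one_right 2 hhalf).mul hder0).neg
  · change C.firstForm X0 (α • Y1 + β • Y2) = 0
    rw [map_add, map_smul, map_smul, h01, h02, smul_zero, smul_zero, add_zero]
  · change C.firstForm X0 (-β • Y1 + α • Y2) = 0
    rw [map_add, map_smul, map_smul, h01, h02, smul_zero, smul_zero, add_zero]

end ConnectionAlong
end Biconservative

namespace Biconservative
open Filter Topology

/-! ### Germs of metrics and of their Christoffel symbols -/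

/-- `h` is the matrix of coefficients of a Riemannian metric near `y`. Positivity at `y` implies
positivity nearby; symmetry is required everywhere, as it holds for `coeff` even at junk values. -/
structure IsMetricAt {n : ℕ} (h : E n → Matrix (Fin n) (Fin n) ℝ) (y : E n) : Prop where
  contDiffAt : ∀ a b, ContDiffAt ℝ ∞ (fun z => h z a b) y
  symm : ∀ z a b, h z a b = h z b a
  pos : ∀ v : Fin n → ℝ, v ≠ 0 → 0 < dot h y v v

theorem contDiffAt_det {n k : ℕ} {M : E n → Matrix (Fin k) (Fin k) ℝ} {y : E n}
    (hM : ∀ a b, ContDiffAt ℝ ∞ (fun z => M z a b) y) : ContDiffAt ℝ ∞ (fun z => (M z).det) y := by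
  simp only [Matrix.det_apply']
  exact ContDiffAt.sum fun σ _ => contDiffAt_const.mul (contDiffAt_prod fun i _ => hM _ _)

theorem contDiffAt_inv_apply {n k : ℕ} {M : E n → Matrix (Fin k) (Fin k) ℝ} {y : E n}
    (hM : ∀ a b, ContDiffAt ℝ ∞ (fun z => M z a b) y) (hdet : (M y).det ≠ 0) (a b : Fin k) :
    ContDiffAt ℝ ∞ (fun z => (M z)⁻¹ a b) y := by
  simp only [Matrix.inv_def, Matrix.smul_apply, smul_eq_mul, Ring.inverse_eq_inv',
    Matrix.adjugate_apply]
  refine ((contDiffAt_det hM).inv hdet).mul (contDiffAt_det fun c d => ?_)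
  by_cases hc : c = b
  · subst hc
    simp only [Matrix.updateRow_self]
    exact contDiffAt_const
  · simp only [Matrix.updateRow_ne hc]
    exact hM c d

namespace IsMetricAt

variable {n : ℕ} {h : E n → Matrix (Fin n) (Fin n) ℝ} {y : E n}

theorem det_ne_zero (H : IsMetricAt h y) : (h y).det ≠ 0 := by
  intro h0
  obtain ⟨v, hv, hv0⟩ := Matrix.exists_mulVec_eq_zero_iff.2 h0
  have h1 := H.pos v hv
  have h2 : dot h y v v = ∑ a, v a * (h y).mulVec v a := by
    simp only [dot, Matrix.mulVec, dotProduct, Finset.mul_sum]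
    exact Finset.sum_congr rfl fun _ _ => Finset.sum_congr rfl fun _ _ => by ring
  rw [h2, hv0] at h1
  simp at h1

theorem eventually_mul_inv (H : IsMetricAt h y) (i j : Fin n) :
    ∀ᶠ z in 𝓝 y, ∑ l, h z i l * (h z)⁻¹ l j = if i = j then 1 else 0 := by
  filter_upwards [(contDiffAt_det H.contDiffAt).continuousAt.eventually_ne H.det_ne_zero] with z hz
  rw [← Matrix.mul_apply, Matrix.mul_nonsing_inv _ (isUnit_iff_ne_zero.2 hz), Matrix.one_apply]

theorem inv_symm (H : IsMetricAt h y) (z : E n) (i j : Fin n) : (h z)⁻¹ i j = (h z)⁻¹ j i := by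
  have h1 : (h z).transpose = h z := by
    ext a b
    exact H.symm z b a
  conv_rhs => rw [← h1, ← Matrix.transpose_nonsing_inv]
  rfl

open SmoothGerm

/-- The germ of a metric coefficient. -/
def germ (H : IsMetricAt h y) (a b : Fin n) : SmoothGerm y := ofFun _ (H.contDiffAt a b)

/-- The germ of a coefficient of the inverse metric. -/
def invGerm (H : IsMetricAt h y) (a b : Fin n) : SmoothGerm y :=
  ofFun (fun z => (h z)⁻¹ a b) (contDiffAt_inv_apply H.contDiffAt H.det_ne_zero a b)

theorem rep_germ (H : IsMetricAt h y) (a b : Fin n) : Rep (fun z => h z a b) (H.germ a b) := rfl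

theorem rep_invGerm (H : IsMetricAt h y) (a b : Fin n) :
    Rep (fun z => (h z)⁻¹ a b) (H.invGerm a b) := rfl

theorem germ_symm (H : IsMetricAt h y) (a b : Fin n) : H.germ a b = H.germ b a :=
  (H.rep_germ a b).eq_of_eventuallyEq (H.rep_germ b a) (.of_forall fun z => H.symm z a b)

theorem invGerm_symm (H : IsMetricAt h y) (a b : Fin n) : H.invGerm a b = H.invGerm b a :=
  (H.rep_invGerm a b).eq_of_eventuallyEq (H.rep_invGerm b a) (.of_forall fun z => H.inv_symm z a b)

theorem germ_mul_invGerm (H : IsMetricAt h y) (i j : Fin n) :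
    ∑ l, H.germ i l * H.invGerm l j = if i = j then 1 else 0 := by
  exact (rep_sum _ fun l _ => (H.rep_germ i l).mul (H.rep_invGerm l j)).eq_of_eventuallyEq (rep_ite _)
    (H.eventually_mul_inv i j)

/-- The germ of a Christoffel symbol. -/
def chrGerm (H : IsMetricAt h y) (k i j : Fin n) : SmoothGerm y :=
  algebraMap ℝ _ (1 / 2) * ∑ l, H.invGerm k l *
    (gpd i (H.germ j l) + gpd j (H.germ i l) - gpd l (H.germ i j))

theorem rep_chrGerm (H : IsMetricAt h y) (k i j : Fin n) :
    Rep (christoffel h k i j) (H.chrGerm k i j) :=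
  (rep_const _).mul (rep_sum _ fun l _ => (H.rep_invGerm k l).mul
    ((((H.rep_germ j l).pd i).add ((H.rep_germ i l).pd j)).sub ((H.rep_germ i j).pd l)))

theorem chrGerm_symm (H : IsMetricAt h y) (k i j : Fin n) : H.chrGerm k i j = H.chrGerm k j i := by
  simp only [chrGerm, H.germ_symm i j]
  congr 1
  exact Finset.sum_congr rfl fun l _ => by ring

theorem sum_chrGerm_mul (H : IsMetricAt h y) (i j b : Fin n) :
    ∑ e, H.chrGerm e i j * H.germ b e
      = algebraMap ℝ _ (1 / 2) * (gpd i (H.germ j b) + gpd j (H.germ i b) - gpd b (H.germ i j)) := by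
  set T := fun l => gpd i (H.germ j l) + gpd j (H.germ i l) - gpd l (H.germ i j) with hT
  change ∑ k, algebraMap ℝ (SmoothGerm y) (1 / 2) * (∑ l, H.invGerm k l * T l) * H.germ b k
    = algebraMap ℝ (SmoothGerm y) (1 / 2) * T b
  simp only [mul_assoc, ← Finset.mul_sum]
  congr 1
  simp only [Finset.sum_mul]
  rw [Finset.sum_comm]
  calc ∑ l, ∑ k, H.invGerm k l * T l * H.germ b k
      = ∑ l, (∑ k, H.germ b k * H.invGerm k l) * T l := by
        refine Finset.sum_congr rfl fun l _ => ?_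
        rw [Finset.sum_mul]
        exact Finset.sum_congr rfl fun k _ => by ring
    _ = T b := by simp [H.germ_mul_invGerm]

/-- The Levi-Civita connection is metric. -/
theorem pd_germ (H : IsMetricAt h y) (d a b : Fin n) :
    gpd d (H.germ a b) = ∑ e, (H.chrGerm e d a * H.germ e b + H.chrGerm e d b * H.germ a e) := by
  rw [Finset.sum_add_distrib, H.sum_chrGerm_mul]
  simp only [H.germ_symm _ b]
  rw [H.sum_chrGerm_mul, H.germ_symm d b, H.germ_symm d a, H.germ_symm a b]
  linear_combination (-gpd d (H.germ b a)) * ConnectionAlong.algebraMap_half_add (A := SmoothGerm y)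

/-- The germ of a component of the curvature tensor. -/
def curvGerm (H : IsMetricAt h y) (l i j k : Fin n) : SmoothGerm y :=
  gpd i (H.chrGerm l j k) - gpd j (H.chrGerm l i k)
    + ∑ m, (H.chrGerm l i m * H.chrGerm m j k - H.chrGerm l j m * H.chrGerm m i k)

theorem rep_curvGerm (H : IsMetricAt h y) (l i j k : Fin n) :
    Rep (curvature h l i j k) (H.curvGerm l i j k) :=
  ((((H.rep_chrGerm l j k).pd i).sub ((H.rep_chrGerm l i k).pd j))).add (rep_sum _ fun m _ =>
    ((H.rep_chrGerm l i m).mul (H.rep_chrGerm m j k)).sub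
      ((H.rep_chrGerm l j m).mul (H.rep_chrGerm m i k)))

theorem curvGerm_bianchi (H : IsMetricAt h y) (l i j k : Fin n) :
    H.curvGerm l i j k + H.curvGerm l j k i + H.curvGerm l k i j = 0 := by
  simp only [curvGerm, H.chrGerm_symm _ k j, H.chrGerm_symm _ k i, H.chrGerm_symm _ j i,
    Finset.sum_sub_distrib]
  ring

/-! ### The pulled back connection -/

variable {m : ℕ} {F : E m → E n} {x : E m}

/-- The Leibniz rule for a metric connection, `G` being the connection matrix and `dh`, `du`, `dv`
the derivatives of the metric and of the components of two sections. -/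
theorem metric_leibniz {R : Type*} [CommRing R] (h G dh : Fin n → Fin n → R)
    (u v du dv : Fin n → R) (hdh : ∀ a b, dh a b = ∑ e, (G e a * h e b + G e b * h a e)) :
    ∑ a, ∑ b, (dh a b * u a * v b + h a b * du a * v b + h a b * u a * dv b)
      = ∑ a, ∑ b, h a b * (du a + ∑ d, G a d * u d) * v b
        + ∑ a, ∑ b, h a b * u a * (dv b + ∑ d, G b d * v d) := by
  have e1 : ∑ a, ∑ b, ∑ e, G e a * h e b * u a * v b
      = ∑ a, ∑ b, ∑ d, h a b * (G a d * u d) * v b := by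
    calc ∑ a, ∑ b, ∑ e, G e a * h e b * u a * v b
        = ∑ a, ∑ e, ∑ b, G e a * h e b * u a * v b :=
          Finset.sum_congr rfl fun _ _ => Finset.sum_comm
      _ = ∑ e, ∑ a, ∑ b, G e a * h e b * u a * v b := Finset.sum_comm
      _ = ∑ e, ∑ b, ∑ a, G e a * h e b * u a * v b :=
          Finset.sum_congr rfl fun _ _ => Finset.sum_comm
      _ = _ := Finset.sum_congr rfl fun _ _ => Finset.sum_congr rfl fun _ _ =>
          Finset.sum_congr rfl fun _ _ => by ring
  have e2 : ∑ a, ∑ b, ∑ e, G e b * h a e * u a * v b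
      = ∑ a, ∑ b, ∑ d, h a b * u a * (G b d * v d) := by
    refine Finset.sum_congr rfl fun a _ => ?_
    rw [Finset.sum_comm]
    exact Finset.sum_congr rfl fun _ _ => Finset.sum_congr rfl fun _ _ => by ring
  simp only [hdh, Finset.sum_mul, Finset.mul_sum, mul_add, add_mul, Finset.sum_add_distrib, e1, e2]
  ring

/-- The pull-back by `F` of the Levi-Civita connection of `h`, acting on germs of vector fields
along `F`. -/
def along (hF : ContDiffAt ℝ ∞ F x) (H : IsMetricAt h (F x)) :
    ConnectionAlong (fun i => (gpd i : Derivation ℝ (SmoothGerm x) (SmoothGerm x)))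
      (Fin n → SmoothGerm x) where
  ip := LinearMap.mk₂ _ (fun u v => ∑ a, ∑ b, comap F hF (H.germ a b) * u a * v b)
    (by intros; simp [mul_add, add_mul, Finset.sum_add_distrib])
    (by intros; simp only [Pi.smul_apply, smul_eq_mul, Finset.mul_sum]
        exact Finset.sum_congr rfl fun _ _ => Finset.sum_congr rfl fun _ _ => by ring)
    (by intros; simp [mul_add, Finset.sum_add_distrib])
    (by intros; simp only [Pi.smul_apply, smul_eq_mul, Finset.mul_sum]
        exact Finset.sum_congr rfl fun _ _ => Finset.sum_congr rfl fun _ _ => by ring)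
  D i :=
    { toFun := fun w a => gpd i (w a)
        + ∑ d, (∑ b, comap F hF (H.chrGerm a b d) * gpd i (component F hF b)) * w d
      map_zero' := by
        funext a
        simp
      map_add' := by
        intro v w
        funext a
        simp only [Pi.add_apply, map_add, mul_add, Finset.sum_add_distrib]
        ring }
  vel i a := gpd i (component F hF a)
  ip_comm u v := by
    simp only [LinearMap.mk₂_apply]
    rw [Finset.sum_comm]
    exact Finset.sum_congr rfl fun _ _ => Finset.sum_congr rfl fun _ _ => by
      rw [H.germ_symm]; ring
  D_smul i φ w := by
    funext a
    simp only [AddMonoidHom.coe_mk, ZeroHom.coe_mk, Pi.add_apply, Pi.smul_apply, smul_eq_mul,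
      Derivation.leibniz, mul_add, Finset.mul_sum]
    simp only [mul_left_comm _ φ]
    ring
  der_ip i u v := by
    simp only [AddMonoidHom.coe_mk, ZeroHom.coe_mk, LinearMap.mk₂_apply, map_sum,
      Derivation.leibniz, smul_eq_mul, gpd_comap, H.pd_germ, map_add, map_mul]
    rw [← metric_leibniz _ (fun e a => ∑ d, comap F hF (H.chrGerm e d a) * gpd i (component F hF d))
      (fun a b => ∑ d, (∑ e, (comap F hF (H.chrGerm e d a) * comap F hF (H.germ e b)
        + comap F hF (H.chrGerm e d b) * comap F hF (H.germ a e))) * gpd i (component F hF d))]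
    · exact Finset.sum_congr rfl fun a _ => Finset.sum_congr rfl fun b _ => by ring
    · intro a b
      simp only [Finset.sum_mul]
      rw [Finset.sum_comm]
      refine Finset.sum_congr rfl fun e _ => ?_
      rw [← Finset.sum_add_distrib]
      exact Finset.sum_congr rfl fun d _ => by ring
  torsion i j := by
    funext a
    simp only [AddMonoidHom.coe_mk, ZeroHom.coe_mk]
    simp only [Finset.sum_mul]
    rw [gpd_comm, Finset.sum_comm]
    congr 1
    exact Finset.sum_congr rfl fun _ _ => Finset.sum_congr rfl fun _ _ => by
      rw [H.chrGerm_symm]; ring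

end IsMetricAt
end Biconservative

namespace Biconservative
open Filter Topology SmoothGerm

/-! ### Curvature of the pulled back connection -/

namespace IsMetricAt

variable {m n : ℕ} {h : E n → Matrix (Fin n) (Fin n) ℝ} {F : E m → E n} {x : E m}

/-- The connection matrix of the pulled back connection. -/
def connMatrix (hF : ContDiffAt ℝ ∞ F x) (H : IsMetricAt h (F x)) (i : Fin m) (a d : Fin n) :
    SmoothGerm x :=
  ∑ b, comap F hF (H.chrGerm a b d) * gpd i (component F hF b)

theorem along_D (hF : ContDiffAt ℝ ∞ F x) (H : IsMetricAt h (F x)) (i : Fin m)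
    (w : Fin n → SmoothGerm x) (a : Fin n) :
    (along hF H).D i w a = gpd i (w a) + ∑ d, connMatrix hF H i a d * w d := rfl

theorem along_vel (hF : ContDiffAt ℝ ∞ F x) (H : IsMetricAt h (F x)) (i : Fin m) (a : Fin n) :
    (along hF H).vel i a = gpd i (component F hF a) := rfl

theorem along_ip (hF : ContDiffAt ℝ ∞ F x) (H : IsMetricAt h (F x)) (u v : Fin n → SmoothGerm x) :
    (along hF H).ip u v = ∑ a, ∑ b, comap F hF (H.germ a b) * u a * v b := rfl

/-- The curvature of the connection matrix, by the chain rule. -/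
theorem curv_connMatrix (hF : ContDiffAt ℝ ∞ F x) (H : IsMetricAt h (F x)) (i j : Fin m)
    (a k : Fin n) :
    gpd i (connMatrix hF H j a k) - gpd j (connMatrix hF H i a k)
      + ∑ d, (connMatrix hF H i a d * connMatrix hF H j d k
        - connMatrix hF H j a d * connMatrix hF H i d k)
      = ∑ p, ∑ q, comap F hF (H.curvGerm a p q k) * gpd i (component F hF p)
          * gpd j (component F hF q) := by
  have h1 : ∀ i j, gpd i (connMatrix hF H j a k)
      = ∑ p, ∑ q, comap F hF (gpd p (H.chrGerm a q k)) * gpd i (component F hF p)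
          * gpd j (component F hF q)
        + ∑ q, comap F hF (H.chrGerm a q k) * gpd i (gpd j (component F hF q)) := by
    intro i j
    simp only [connMatrix, map_sum, Derivation.leibniz, smul_eq_mul, gpd_comap,
      Finset.sum_add_distrib, Finset.mul_sum]
    rw [add_comm, Finset.sum_comm]
    congr 1
    exact Finset.sum_congr rfl fun _ _ => Finset.sum_congr rfl fun _ _ => by ring
  have h2 : ∀ i j, ∑ d, connMatrix hF H i a d * connMatrix hF H j d k
      = ∑ p, ∑ q, (∑ d, comap F hF (H.chrGerm a p d) * comap F hF (H.chrGerm d q k))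
          * gpd i (component F hF p) * gpd j (component F hF q) := by
    intro i j
    simp only [connMatrix, Finset.sum_mul, Finset.mul_sum]
    calc ∑ d, ∑ q, ∑ p, comap F hF (H.chrGerm a p d) * gpd i (component F hF p)
            * (comap F hF (H.chrGerm d q k) * gpd j (component F hF q))
        = ∑ q, ∑ d, ∑ p, comap F hF (H.chrGerm a p d) * gpd i (component F hF p)
            * (comap F hF (H.chrGerm d q k) * gpd j (component F hF q)) := Finset.sum_comm
      _ = ∑ q, ∑ p, ∑ d, comap F hF (H.chrGerm a p d) * gpd i (component F hF p)
            * (comap F hF (H.chrGerm d q k) * gpd j (component F hF q)) :=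
          Finset.sum_congr rfl fun _ _ => Finset.sum_comm
      _ = ∑ p, ∑ q, ∑ d, comap F hF (H.chrGerm a p d) * gpd i (component F hF p)
            * (comap F hF (H.chrGerm d q k) * gpd j (component F hF q)) := Finset.sum_comm
      _ = _ := Finset.sum_congr rfl fun _ _ => Finset.sum_congr rfl fun _ _ =>
          Finset.sum_congr rfl fun _ _ => by ring
  have h3 : ∀ T : Fin n → Fin n → SmoothGerm x,
      ∑ p, ∑ q, T p q * gpd j (component F hF p) * gpd i (component F hF q)
      = ∑ p, ∑ q, T q p * gpd i (component F hF p) * gpd j (component F hF q) := by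
    intro T
    rw [Finset.sum_comm]
    exact Finset.sum_congr rfl fun _ _ => Finset.sum_congr rfl fun _ _ => by ring
  rw [Finset.sum_sub_distrib, h1 i j, h1 j i, h2 i j, h2 j i, h3, h3]
  simp only [gpd_comm j i]
  simp only [curvGerm, map_add, map_sub, map_sum, map_mul, Finset.sum_sub_distrib, add_mul, sub_mul,
    Finset.sum_add_distrib]
  ring

/-- The curvature of the pulled back connection is the pull-back of the curvature. -/
theorem along_curvature (hF : ContDiffAt ℝ ∞ F x) (H : IsMetricAt h (F x)) (i j : Fin m)
    (w : Fin n → SmoothGerm x) (a : Fin n) :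
    (along hF H).D i ((along hF H).D j w) a - (along hF H).D j ((along hF H).D i w) a
      = ∑ k, (∑ p, ∑ q, comap F hF (H.curvGerm a p q k) * gpd i (component F hF p)
          * gpd j (component F hF q)) * w k := by
  have h1 : ∀ i j, (along hF H).D i ((along hF H).D j w) a = gpd i (gpd j (w a))
      + ∑ k, gpd i (connMatrix hF H j a k) * w k
      + ∑ k, (connMatrix hF H j a k * gpd i (w k) + connMatrix hF H i a k * gpd j (w k))
      + ∑ k, (∑ d, connMatrix hF H i a d * connMatrix hF H j d k) * w k := by
    intro i j
    simp only [along_D, map_add, map_sum, Derivation.leibniz, smul_eq_mul, mul_add,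
      Finset.sum_add_distrib, Finset.mul_sum, Finset.sum_mul]
    rw [Finset.sum_comm (f := fun k d => connMatrix hF H i a d * connMatrix hF H j d k * w k)]
    simp only [mul_assoc, mul_comm (w _) (gpd i _)]
    ring
  rw [h1 i j, h1 j i, gpd_comm j i]
  simp only [← curv_connMatrix, add_mul, sub_mul, Finset.sum_add_distrib, Finset.sum_sub_distrib]
  ring

end IsMetricAt

/-! ### Spaces of constant curvature -/

/-- A curvature-like tensor whose sectional curvatures vanish is zero. -/
theorem curvatureLike_eq_zero {n : ℕ} (T : Fin n → Fin n → Fin n → Fin n → ℝ)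
    (h12 : ∀ i j k l, T i j k l = -T j i k l) (h34 : ∀ i j k l, T i j k l = -T i j l k)
    (hb : ∀ i j k l, T i j k l + T j k i l + T k i j l = 0)
    (hq : ∀ u v : Fin n → ℝ, ∑ i, ∑ j, ∑ k, ∑ l, T i j k l * u i * v j * v k * u l = 0)
    (i j k l : Fin n) : T i j k l = 0 := by
  -- The identities of the curvature tensor imply the symmetry by pairs.
  have hpair : ∀ i j k l, T i j k l = T k l i j := by
    intro i j k l
    linarith [hb i j k l, hb j k l i, hb k l i j, hb l i j k, h12 i j k l, h12 j k i l, h12 k i j l,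
      h12 j k l i, h12 k l j i, h12 l j k i, h12 k l i j, h12 l i k j, h12 i k l j, h12 l i j k,
      h12 i j l k, h12 j l i k, h34 i j k l, h34 j k i l, h34 k i j l, h34 k l i j, h34 l i j k,
      h34 j l i k, h34 i k l j, h34 l j k i]
  set B : (Fin n → ℝ) → (Fin n → ℝ) → (Fin n → ℝ) → (Fin n → ℝ) → ℝ :=
    fun u v w z => ∑ i, ∑ j, ∑ k, ∑ l, T i j k l * u i * v j * w k * z l with hB
  have hB1 : ∀ u u' v w z, B (u + u') v w z = B u v w z + B u' v w z := by
    intros; simp [hB, mul_add, add_mul, Finset.sum_add_distrib]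
  have hB2 : ∀ u v v' w z, B u (v + v') w z = B u v w z + B u v' w z := by
    intros; simp [hB, mul_add, add_mul, Finset.sum_add_distrib]
  have hB3 : ∀ u v w w' z, B u v (w + w') z = B u v w z + B u v w' z := by
    intros; simp [hB, mul_add, add_mul, Finset.sum_add_distrib]
  have hB4 : ∀ u v w z z', B u v w (z + z') = B u v w z + B u v w z' := by
    intros; simp [hB, mul_add, Finset.sum_add_distrib]
  have hBe : ∀ i j k l, B (Pi.single i 1) (Pi.single j 1) (Pi.single k 1) (Pi.single l 1)
      = T i j k l := by
    intros
    simp [hB, Pi.single_apply]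
  have hBQ : ∀ u v, B u v v u = 0 := hq
  have hpol : ∀ u j k, B u (Pi.single j 1) (Pi.single k 1) u
      + B u (Pi.single k 1) (Pi.single j 1) u = 0 := by
    intro u j k
    have h1 := hBQ u (Pi.single j 1 + Pi.single k 1)
    rw [hB2, hB3, hB3, hBQ, hBQ] at h1
    linarith
  have h14 : ∀ i j k l, T i j k l = -T l j k i := by
    intro i j k l
    have h0 := hpol (Pi.single i 1 + Pi.single l 1) j k
    have h1 := hpol (Pi.single i 1) j k
    have h2 := hpol (Pi.single l 1) j k
    simp only [hB1, hB4, hBe] at h0 h1 h2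
    linarith [hpair i k j l, hpair l k j i, h12 j l i k, h34 l j i k, h12 j i l k, h34 i j l k]
  -- `T` is alternating, so that the Bianchi identity reads `3 T = 0`.
  have h13 : ∀ i j k l, T i j k l = -T k j i l := by
    intro i j k l
    linarith [h34 i j k l, h14 i j l k, h34 k j l i]
  linarith [hb i j k l, h13 i j k l, h12 k j i l, h13 j k i l, h12 i k j l]

/-- The curvature tensor is skew-symmetric in its last two arguments, as the connection is
metric. -/
theorem curvature_skew {n : ℕ} {h : E n → Matrix (Fin n) (Fin n) ℝ} {y : E n}
    (H : IsMetricAt h y) (i j k l : Fin n) :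
    ∑ a, curvature h a i j k y * h y a l = -∑ a, curvature h a i j l y * h y a k := by
  -- The pull-back by the identity is the Levi-Civita connection itself.
  have hF : ContDiffAt ℝ ∞ (fun z : E n => z) y := contDiffAt_id
  set C := IsMetricAt.along hF H with hC
  have hcomap : ∀ a : SmoothGerm y, comap (fun z : E n => z) hF a = a := by
    intro a
    obtain ⟨f, -, ha⟩ := exists_rep a
    exact (ha.comap hF).unique ha
  have hpd : ∀ i a : Fin n, gpd i (component (fun z : E n => z) hF a)
      = if i = a then 1 else 0 := by
    intro i a
    refine ((rep_ofFun _ _).pd i).eq_of_eventuallyEq (rep_ite (i = a)) (.of_forall fun z => ?_)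
    refine (pd_component (F := fun z : E n => z) differentiableAt_fun_id i a).trans ?_
    simp [eq_comm]
  have hcurv : ∀ k a, (C.D i (C.D j (Pi.single k 1)) - C.D j (C.D i (Pi.single k 1))) a
      = H.curvGerm a i j k := by
    intro k a
    rw [Pi.sub_apply, hC, IsMetricAt.along_curvature]
    simp [hcomap, hpd, Pi.single_apply]
  have hip : ∀ k l, C.ip (C.D i (C.D j (Pi.single k 1)) - C.D j (C.D i (Pi.single k 1)))
      (Pi.single l 1) = ∑ a, H.curvGerm a i j k * H.germ a l := by
    intro k l
    rw [hC, IsMetricAt.along_ip, ← hC]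
    simp only [hcurv, hcomap]
    simp [Pi.single_apply, mul_comm]
  have key : C.ip (C.D i (C.D j (Pi.single k 1)) - C.D j (C.D i (Pi.single k 1))) (Pi.single l 1)
      + C.ip (C.D i (C.D j (Pi.single l 1)) - C.D j (C.D i (Pi.single l 1))) (Pi.single k 1) = 0 := by
    have h1 := gpd_comm i j (C.ip (Pi.single k 1) (Pi.single l 1))
    simp only [C.der_ip, map_add] at h1
    simp only [map_sub, LinearMap.sub_apply, C.ip_comm _ (Pi.single k 1)]
    linear_combination h1
  rw [hip, hip] at key
  have hR : ∀ k l, Rep (fun z => ∑ a, curvature h a i j k z * h z a l)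
      (∑ a, H.curvGerm a i j k * H.germ a l) := fun k l =>
    rep_sum _ fun a _ => (H.rep_curvGerm a i j k).mul (H.rep_germ a l)
  have h2 := congrArg (ev y) key
  rw [map_add, (hR k l).ev_eq, (hR l k).ev_eq, map_zero] at h2
  linarith

/-- The curvature tensor of a metric of constant sectional curvature `c` at `y`. -/
theorem curvature_eq_of_sectional {n : ℕ} {h : E n → Matrix (Fin n) (Fin n) ℝ} {y : E n}
    (H : IsMetricAt h y) {c : ℝ}
    (hc : ∀ u v : Fin n → ℝ, dot h y (curvatureVec h y u v v) u
      = c * (dot h y u u * dot h y v v - dot h y u v ^ 2)) (l i j k : Fin n) :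
    curvature h l i j k y
      = c * (h y j k * (if l = i then 1 else 0) - h y i k * (if l = j then 1 else 0)) := by
  -- The difference with the curvature tensor of a space form has vanishing sectional curvatures.
  set T : Fin n → Fin n → Fin n → Fin n → ℝ := fun i j k l =>
    ∑ a, curvature h a i j k y * h y a l - c * (h y j k * h y i l - h y i k * h y j l) with hT
  have hanti : ∀ a i j k, curvature h a i j k y = -curvature h a j i k y := by
    intro a i j k
    simp only [curvature, Finset.sum_sub_distrib]
    ring
  have hbi : ∀ a i j k, curvature h a i j k y + curvature h a j k i y + curvature h a k i j y
      = 0 := by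
    intro a i j k
    have h1 := congrArg (ev y) (H.curvGerm_bianchi a i j k)
    simpa only [map_add, map_zero, (H.rep_curvGerm _ _ _ _).ev_eq] using h1
  have hT0 : ∀ i j k l, T i j k l = 0 := by
    refine curvatureLike_eq_zero T ?_ ?_ ?_ ?_
    · intro i j k l
      simp only [hT]
      simp only [hanti _ i j k, neg_mul, Finset.sum_neg_distrib]
      ring
    · intro i j k l
      simp only [hT]
      rw [curvature_skew H]
      ring
    · intro i j k l
      have h1 : ∑ a, curvature h a i j k y * h y a l + ∑ a, curvature h a j k i y * h y a l
          + ∑ a, curvature h a k i j y * h y a l = 0 := by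
        rw [← Finset.sum_add_distrib, ← Finset.sum_add_distrib]
        exact Finset.sum_eq_zero fun a _ => by rw [← add_mul, ← add_mul, hbi, zero_mul]
      simp only [hT, H.symm y k i, H.symm y k j, H.symm y j i]
      linear_combination h1
    · intro u v
      have h1 : ∑ i, ∑ j, ∑ k, ∑ l, (∑ a, curvature h a i j k y * h y a l) * u i * v j * v k * u l
          = dot h y (curvatureVec h y u v v) u := by
        simp only [dot, curvatureVec, Finset.sum_mul, Finset.mul_sum]
        calc ∑ i, ∑ j, ∑ k, ∑ l, ∑ a, curvature h a i j k y * h y a l * u i * v j * v k * u l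
            = ∑ i, ∑ j, ∑ k, ∑ a, ∑ l, curvature h a i j k y * h y a l * u i * v j * v k * u l :=
              Finset.sum_congr rfl fun _ _ => Finset.sum_congr rfl fun _ _ =>
                Finset.sum_congr rfl fun _ _ => Finset.sum_comm
          _ = ∑ i, ∑ j, ∑ a, ∑ k, ∑ l, curvature h a i j k y * h y a l * u i * v j * v k * u l :=
              Finset.sum_congr rfl fun _ _ => Finset.sum_congr rfl fun _ _ => Finset.sum_comm
          _ = ∑ i, ∑ a, ∑ j, ∑ k, ∑ l, curvature h a i j k y * h y a l * u i * v j * v k * u l :=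
              Finset.sum_congr rfl fun _ _ => Finset.sum_comm
          _ = ∑ a, ∑ i, ∑ j, ∑ k, ∑ l, curvature h a i j k y * h y a l * u i * v j * v k * u l :=
              Finset.sum_comm
          _ = ∑ a, ∑ i, ∑ j, ∑ l, ∑ k, curvature h a i j k y * h y a l * u i * v j * v k * u l :=
              Finset.sum_congr rfl fun _ _ => Finset.sum_congr rfl fun _ _ =>
                Finset.sum_congr rfl fun _ _ => Finset.sum_comm
          _ = ∑ a, ∑ i, ∑ l, ∑ j, ∑ k, curvature h a i j k y * h y a l * u i * v j * v k * u l :=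
              Finset.sum_congr rfl fun _ _ => Finset.sum_congr rfl fun _ _ => Finset.sum_comm
          _ = ∑ a, ∑ l, ∑ i, ∑ j, ∑ k, curvature h a i j k y * h y a l * u i * v j * v k * u l :=
              Finset.sum_congr rfl fun _ _ => Finset.sum_comm
          _ = _ := Finset.sum_congr rfl fun _ _ => Finset.sum_congr rfl fun _ _ =>
                Finset.sum_congr rfl fun _ _ => Finset.sum_congr rfl fun _ _ =>
                Finset.sum_congr rfl fun _ _ => by ring
      have h2 : ∑ i, ∑ j, ∑ k, ∑ l, h y j k * h y i l * u i * v j * v k * u l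
          = dot h y u u * dot h y v v := by
        rw [mul_comm (dot h y u u)]
        simp only [dot, Finset.sum_mul, Finset.mul_sum]
        refine Finset.sum_congr rfl fun i _ => ?_
        calc ∑ j, ∑ k, ∑ l, h y j k * h y i l * u i * v j * v k * u l
            = ∑ j, ∑ l, ∑ k, h y j k * h y i l * u i * v j * v k * u l :=
              Finset.sum_congr rfl fun _ _ => Finset.sum_comm
          _ = ∑ l, ∑ j, ∑ k, h y j k * h y i l * u i * v j * v k * u l := Finset.sum_comm
          _ = _ := Finset.sum_congr rfl fun _ _ => Finset.sum_congr rfl fun _ _ =>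
                Finset.sum_congr rfl fun _ _ => by ring
      have h3 : ∑ i, ∑ j, ∑ k, ∑ l, h y i k * h y j l * u i * v j * v k * u l
          = dot h y u v ^ 2 := by
        have h4 : dot h y u v = dot h y v u := by
          simp only [dot]
          rw [Finset.sum_comm]
          exact Finset.sum_congr rfl fun _ _ => Finset.sum_congr rfl fun _ _ => by
            rw [H.symm]; ring
        rw [pow_two]
        nth_rewrite 1 [h4]
        simp only [dot, Finset.sum_mul, Finset.mul_sum]
        refine Finset.sum_congr rfl fun i _ => ?_
        calc ∑ j, ∑ k, ∑ l, h y i k * h y j l * u i * v j * v k * u l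
            = ∑ k, ∑ j, ∑ l, h y i k * h y j l * u i * v j * v k * u l := Finset.sum_comm
          _ = _ := Finset.sum_congr rfl fun _ _ => Finset.sum_congr rfl fun _ _ =>
                Finset.sum_congr rfl fun _ _ => by ring
      have h5 : ∑ i, ∑ j, ∑ k, ∑ l, T i j k l * u i * v j * v k * u l
          = ∑ i, ∑ j, ∑ k, ∑ l, (∑ a, curvature h a i j k y * h y a l) * u i * v j * v k * u l
            - c * (∑ i, ∑ j, ∑ k, ∑ l, h y j k * h y i l * u i * v j * v k * u l
              - ∑ i, ∑ j, ∑ k, ∑ l, h y i k * h y j l * u i * v j * v k * u l) := by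
        simp only [Finset.mul_sum, ← Finset.sum_sub_distrib]
        exact Finset.sum_congr rfl fun _ _ => Finset.sum_congr rfl fun _ _ =>
                Finset.sum_congr rfl fun _ _ => Finset.sum_congr rfl fun _ _ => by
                  simp only [hT]
                  ring
      rw [h5, h1, h2, h3, hc]
      ring
  -- Raise the last index.
  have hinv : ∀ a b, ∑ p, h y a p * (h y)⁻¹ p b = if a = b then 1 else 0 := fun a b =>
    (H.eventually_mul_inv a b).self_of_nhds
  calc curvature h l i j k y
      = ∑ p, (∑ a, curvature h a i j k y * h y a p) * (h y)⁻¹ p l := by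
        simp only [Finset.sum_mul]
        rw [Finset.sum_comm]
        simp only [mul_assoc, ← Finset.mul_sum, hinv]
        simp
    _ = ∑ p, c * (h y j k * h y i p - h y i k * h y j p) * (h y)⁻¹ p l :=
        Finset.sum_congr rfl fun p _ => by
          have := hT0 i j k p
          simp only [hT, sub_eq_zero] at this
          rw [this]
    _ = c * (h y j k * ∑ p, h y i p * (h y)⁻¹ p l - h y i k * ∑ p, h y j p * (h y)⁻¹ p l) := by
        rw [Finset.mul_sum, Finset.mul_sum, ← Finset.sum_sub_distrib, Finset.mul_sum]
        exact Finset.sum_congr rfl fun p _ => by ring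
    _ = _ := by rw [hinv, hinv]; simp [eq_comm]

/-- The ambient curvature along a map into a space of constant sectional curvature. -/
theorem IsMetricAt.along_hasCurvature {m n : ℕ} {h : E n → Matrix (Fin n) (Fin n) ℝ} {F : E m → E n}
    {x : E m} (hF : ContDiffAt ℝ ∞ F x) (H : IsMetricAt h (F x)) {c : ℝ}
    (hH : ∀ᶠ y in 𝓝 (F x), IsMetricAt h y)
    (hc : ∀ᶠ y in 𝓝 (F x), ∀ u v : Fin n → ℝ, dot h y (curvatureVec h y u v v) u
      = c * (dot h y u u * dot h y v v - dot h y u v ^ 2)) :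
    (along hF H).HasCurvature (algebraMap ℝ _ c) := by
  have hg : ∀ l i j k, H.curvGerm l i j k = algebraMap ℝ _ c *
      (H.germ j k * (if l = i then 1 else 0) - H.germ i k * (if l = j then 1 else 0)) := by
    intro l i j k
    refine (H.rep_curvGerm l i j k).eq_of_eventuallyEq ((rep_const c).mul
      (((H.rep_germ j k).mul (rep_ite (l = i))).sub ((H.rep_germ i k).mul (rep_ite (l = j))))) ?_
    filter_upwards [hH, hc] with y hy hcy
    exact curvature_eq_of_sectional hy hcy l i j k
  intro i j w
  funext a
  rw [Pi.sub_apply, along_curvature]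
  have hite : ∀ a p : Fin n, comap F hF (if a = p then 1 else 0) = if a = p then 1 else 0 := by
    intro a p
    split_ifs <;> simp
  simp only [hg, map_mul, map_sub, AlgHom.commutes, hite, Pi.smul_apply, Pi.sub_apply, smul_eq_mul,
    along_ip, along_vel]
  simp only [mul_sub, sub_mul, Finset.sum_sub_distrib, mul_ite, mul_one, mul_zero, ite_mul,
    zero_mul, Finset.sum_ite_eq, Finset.mem_univ, if_true]
  congr 1
  · rw [Finset.sum_comm (s := Finset.univ (α := Fin n)), Finset.sum_mul, Finset.mul_sum]
    refine Finset.sum_congr rfl fun k _ => ?_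
    rw [Finset.sum_comm]
    simp only [Finset.sum_ite_eq, Finset.mem_univ, if_true, Finset.sum_mul, Finset.mul_sum]
    exact Finset.sum_congr rfl fun _ _ => by ring
  · rw [Finset.sum_comm, Finset.sum_mul, Finset.mul_sum]
    refine Finset.sum_congr rfl fun k _ => ?_
    simp only [Finset.sum_mul, Finset.mul_sum]
    exact Finset.sum_congr rfl fun _ _ => by ring

end Biconservative

namespace Biconservative
open Filter Topology SmoothGerm

/-! ### Germs of the tensors of an isometric immersion -/

/-- `F` is an isometric immersion near `x`, for the metrics `g` of its source and `h` of its
target. -/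
structure IsIsometricAt {m n : ℕ} (g : E m → Matrix (Fin m) (Fin m) ℝ)
    (h : E n → Matrix (Fin n) (Fin n) ℝ) (F : E m → E n) (x : E m) : Prop where
  contDiffAt : ContDiffAt ℝ ∞ F x
  source : IsMetricAt g x
  target : IsMetricAt h (F x)
  pullback : ∀ᶠ y in 𝓝 x, ∀ i j, g y i j = dot h (F y) (dmap F i y) (dmap F j y)

/-- The components of the vector field `V` along a map have the germs `w`. -/
def RepVec {m n : ℕ} {x : E m} (V : E m → Fin n → ℝ) (w : Fin n → SmoothGerm x) : Prop :=
  ∀ a, Rep (fun y => V y a) (w a)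

namespace IsIsometricAt

variable {m n : ℕ} {g : E m → Matrix (Fin m) (Fin m) ℝ} {h : E n → Matrix (Fin n) (Fin n) ℝ}
  {F : E m → E n} {x : E m} (I : IsIsometricAt g h F x)

/-- The connection of the vector fields along the immersion. -/
def conn : ConnectionAlong (fun i => (gpd i : Derivation ℝ (SmoothGerm x) (SmoothGerm x)))
    (Fin n → SmoothGerm x) :=
  IsMetricAt.along I.contDiffAt I.target

include I

theorem rep_vel (i : Fin m) : RepVec (dmap F i) (I.conn.vel i) := fun _ => (rep_ofFun _ _).pd i

theorem rep_ip {V W : E m → Fin n → ℝ} {v w : Fin n → SmoothGerm x} (hV : RepVec V v)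
    (hW : RepVec W w) : Rep (fun y => dot h (F y) (V y) (W y)) (I.conn.ip v w) :=
  rep_sum _ fun a _ => rep_sum _ fun b _ =>
    (((I.target.rep_germ a b).comap I.contDiffAt).mul (hV a)).mul (hW b)

theorem rep_D {V : E m → Fin n → ℝ} {v : Fin n → SmoothGerm x} (hV : RepVec V v) (i : Fin m) :
    RepVec (covAlong h F V i) (I.conn.D i v) := by
  intro a
  refine (((hV a).pd i).add (rep_sum _ fun d _ => (rep_sum _ fun b _ =>
    ((I.target.rep_chrGerm a b d).comap I.contDiffAt).mul (I.rep_vel i b)).mul (hV d))).congr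
    (.of_forall fun y => ?_)
  simp only [covAlong, Finset.sum_mul]
  rw [Finset.sum_comm]

theorem met_eq (i j : Fin m) : I.conn.met i j = I.source.germ i j :=
  (I.rep_ip (I.rep_vel i) (I.rep_vel j)).eq_of_eventuallyEq (I.source.rep_germ i j)
    (I.pullback.mono fun _ hy => (hy i j).symm)

theorem met_mul_inv (i j : Fin m) :
    ∑ l, I.conn.met i l * I.source.invGerm l j = if i = j then 1 else 0 := by
  simp only [I.met_eq, I.source.germ_mul_invGerm]

theorem chr_eq (k i j : Fin m) : I.conn.chr I.source.invGerm k i j = I.source.chrGerm k i j := by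
  simp only [ConnectionAlong.chr, I.met_eq]
  rfl

theorem rep_sff (i j : Fin m) :
    RepVec (secondForm g h F i j) (I.conn.sff I.source.invGerm i j) := by
  intro a
  have h1 := (I.rep_D (I.rep_vel j) i a).sub (rep_sum Finset.univ fun k _ =>
    (I.source.rep_chrGerm k i j).mul (I.rep_vel k a))
  have h2 : I.conn.sff I.source.invGerm i j a = I.conn.D i (I.conn.vel j) a
      - ∑ k, I.source.chrGerm k i j * I.conn.vel k a := by
    simp [ConnectionAlong.sff, I.chr_eq]
  rw [h2]
  exact h1

theorem rep_tens : RepVec (tension g h F) (I.conn.tens I.source.invGerm) := by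
  intro a
  have h2 : I.conn.tens I.source.invGerm a
      = ∑ i, ∑ j, I.source.invGerm i j * I.conn.sff I.source.invGerm i j a := by
    simp [ConnectionAlong.tens]
  rw [h2]
  exact rep_sum Finset.univ fun i _ => rep_sum Finset.univ fun j _ =>
    (I.source.rep_invGerm i j).mul (I.rep_sff i j a)

theorem rep_stress (i j : Fin m) :
    Rep (stressBienergy g h F i j) (I.conn.stress I.source.invGerm i j) := by
  have h1 := (((((rep_const (1 / 2)).mul (I.rep_ip I.rep_tens I.rep_tens)).add
    (rep_sum Finset.univ fun k _ => rep_sum Finset.univ fun l _ => (I.source.rep_invGerm k l).mul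
      (I.rep_ip (I.rep_vel k) (I.rep_D I.rep_tens l)))).mul (I.source.rep_germ i j)).sub
    (I.rep_ip (I.rep_vel i) (I.rep_D I.rep_tens j))).sub
    (I.rep_ip (I.rep_vel j) (I.rep_D I.rep_tens i))
  rw [ConnectionAlong.stress, I.met_eq]
  exact h1

theorem rep_dvg {S : Fin m → Fin m → E m → ℝ} {T : Fin m → Fin m → SmoothGerm x}
    (hS : ∀ i j, Rep (S i j) (T i j)) (j : Fin m) :
    Rep (divergence g S j) (I.conn.dvg I.source.invGerm T j) := by
  have h1 := rep_sum Finset.univ fun i _ => rep_sum Finset.univ fun k _ =>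
    (I.source.rep_invGerm i k).mul (((hS i j).pd k).sub (rep_sum Finset.univ fun l _ =>
      ((I.source.rep_chrGerm l k i).mul (hS l j)).add ((I.source.rep_chrGerm l k j).mul (hS i l))))
  simp only [ConnectionAlong.dvg, I.chr_eq]
  exact h1

theorem rep_scal : Rep (scalarCurvature g) (I.conn.scal I.source.invGerm) := by
  have h1 := rep_sum Finset.univ fun j _ => rep_sum Finset.univ fun k _ =>
    (I.source.rep_invGerm j k).mul (rep_sum Finset.univ fun i _ => I.source.rep_curvGerm i i j k)
  simp only [ConnectionAlong.scal, ConnectionAlong.curv, I.chr_eq]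
  exact h1

end IsIsometricAt

theorem isLocalEval_ev {n : ℕ} (x : E n) : IsLocalEval (ev x) := by
  constructor
  · intro a h
    exact isUnit_of_ev_ne_zero h
  · intro a h
    exact exists_sqrt h

/-- The scalar product as a bilinear form. -/
def dotBilin {n : ℕ} (h : E n → Matrix (Fin n) (Fin n) ℝ) (y : E n) :
    (Fin n → ℝ) →ₗ[ℝ] (Fin n → ℝ) →ₗ[ℝ] ℝ :=
  LinearMap.mk₂ ℝ (dot h y)
    (by intros; simp [dot, mul_add, add_mul, Finset.sum_add_distrib])
    (by intros; simp only [dot, Pi.smul_apply, smul_eq_mul, Finset.mul_sum]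
        exact Finset.sum_congr rfl fun _ _ => Finset.sum_congr rfl fun _ _ => by ring)
    (by intros; simp [dot, mul_add, Finset.sum_add_distrib])
    (by intros; simp only [dot, Pi.smul_apply, smul_eq_mul, Finset.mul_sum]
        exact Finset.sum_congr rfl fun _ _ => Finset.sum_congr rfl fun _ _ => by ring)

namespace IsIsometricAt

variable {m n : ℕ} {g : E m → Matrix (Fin m) (Fin m) ℝ} {h : E n → Matrix (Fin n) (Fin n) ℝ}
  {F : E m → E n} {x : E m} (I : IsIsometricAt g h F x)

include I

theorem ev_ip (v w : Fin n → SmoothGerm x) :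
    ev x (I.conn.ip v w) = dot h (F x) (fun a => ev x (v a)) (fun a => ev x (w a)) := by
  change ev x (∑ a, ∑ b, comap F I.contDiffAt (I.target.germ a b) * v a * w b) = _
  simp only [map_sum, map_mul, dot, ((I.target.rep_germ _ _).comap I.contDiffAt).ev_eq]

theorem ev_ip_pos (v : Fin n → SmoothGerm x) (hv : ∃ a, ev x (v a) ≠ 0) :
    0 < ev x (I.conn.ip v v) := by
  rw [I.ev_ip]
  obtain ⟨a, ha⟩ := hv
  exact I.target.pos _ fun h0 => ha (congrFun h0 a)

theorem ev_ip_push_pos (Y : Fin m → SmoothGerm x) (hY : ∃ i, ev x (Y i) ≠ 0) :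
    0 < ev x (I.conn.ip (I.conn.push Y) (I.conn.push Y)) := by
  obtain ⟨i, hi⟩ := hY
  have h1 := I.source.pos (fun i => ev x (Y i)) fun h0 => hi (congrFun h0 i)
  have h2 : I.conn.ip (I.conn.push Y) (I.conn.push Y)
      = ∑ i, ∑ j, I.source.germ i j * Y i * Y j := by
    simp only [ConnectionAlong.push, map_sum, map_smul, LinearMap.sum_apply, LinearMap.smul_apply,
      smul_eq_mul, ← I.met_eq]
    simp only [ConnectionAlong.met]
    rw [Finset.sum_comm]
    simp only [Finset.mul_sum]
    exact Finset.sum_congr rfl fun _ _ => Finset.sum_congr rfl fun _ _ => by ring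
  rw [h2]
  simpa only [map_sum, map_mul, (I.source.rep_germ _ _).ev_eq, dot] using h1

end IsIsometricAt

end Biconservative

namespace Biconservative
open Filter Topology SmoothGerm

/-! ### The local theorem -/

theorem orthonormal_snoc {A V : Type*} [CommRing A] [AddCommGroup V] [Module A V]
    (B : V →ₗ[A] V →ₗ[A] A) (hB : ∀ u v, B u v = B v u) {k : ℕ} (v : Fin k → V)
    (hv : ∀ a b, B (v a) (v b) = if a = b then 1 else 0) {w : V} (hw : B w w = 1)
    (hwv : ∀ a, B w (v a) = 0) (a b : Fin (k + 1)) :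
    B ((Fin.snoc v w : Fin (k + 1) → V) a) ((Fin.snoc v w : Fin (k + 1) → V) b)
      = if a = b then 1 else 0 := by
  induction a using Fin.lastCases with
  | last =>
    induction b using Fin.lastCases with
    | last => simp [hw]
    | cast b => simp [hwv, (Fin.castSucc_lt_last b).ne']
  | cast a =>
    induction b using Fin.lastCases with
    | last => simp [hB _ w, hwv, (Fin.castSucc_lt_last a).ne]
    | cast b => simp [hv]

theorem IsLocalEval.exists_orthonormal {A : Type*} [CommRing A] [Algebra ℝ A] {ev : A →ₐ[ℝ] ℝ}
    (hev : IsLocalEval ev) {n : ℕ} (B : (Fin n → A) →ₗ[A] (Fin n → A) →ₗ[A] A)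
    (hB : ∀ u v, B u v = B v u) (hpos : ∀ w : Fin n → A, (∃ i, ev (w i) ≠ 0) → 0 < ev (B w w))
    {k : ℕ} (hk : k ≤ n) :
    ∃ v : Fin k → Fin n → A, ∀ a b, B (v a) (v b) = if a = b then 1 else 0 := by
  induction k with
  | zero => exact ⟨fun a => a.elim0, fun a => a.elim0⟩
  | succ k ih =>
    obtain ⟨v, hv⟩ := ih (by lia)
    obtain ⟨w, hw, hwv⟩ := hev.exists_orthonormal_extension B hpos (by lia) v hv
    exact ⟨Fin.snoc v w, orthonormal_snoc B hB v hv hw hwv⟩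

namespace IsIsometricAt

section Hypersurface

variable {m : ℕ} {g : E m → Matrix (Fin m) (Fin m) ℝ}
  {h : E (m + 1) → Matrix (Fin (m + 1)) (Fin (m + 1)) ℝ}
  {F : E m → E (m + 1)} {x : E m} (I : IsIsometricAt g h F x)

include I

/-- A hypersurface has a smooth unit normal near `x`, and it is unique up to sign at `x`. -/
theorem exists_isNormal : ∃ ν, I.conn.IsNormal ν ∧ ∀ u : Fin (m + 1) → ℝ,
    dot h (F x) u u = 1 → (∀ i, dot h (F x) u (dmap F i x) = 0) →
      dot h (F x) (fun a => ev x (ν a)) u ^ 2 = 1 := by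
  have hev := isLocalEval_ev x
  obtain ⟨X, hX⟩ := hev.exists_orthonormal I.conn.firstForm
    (fun u v => I.conn.ip_comm _ _) I.ev_ip_push_pos le_rfl
  obtain ⟨ν, hν, hνX⟩ := hev.exists_orthonormal_extension I.conn.ip I.ev_ip_pos
    (Nat.lt_succ_self m) (fun a => I.conn.push (X a)) hX
  have hsnoc := orthonormal_snoc I.conn.ip I.conn.ip_comm _ hX hν hνX
  -- The vectors `∂ᵢ` are combinations of the `X a`, as these are orthonormal.
  have hvel : ∀ l, I.conn.ip ν (I.conn.vel l) = 0 := by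
    intro l
    have h1 : (Pi.single l 1 : Fin m → SmoothGerm x)
        - ∑ a, I.conn.firstForm (Pi.single l 1) (X a) • X a = 0 := by
      refine eq_zero_of_orthogonal I.conn.firstForm X hX _ fun b => ?_
      simp only [map_sub, map_sum, map_smul, LinearMap.sub_apply, LinearMap.sum_apply,
        LinearMap.smul_apply, hX, smul_eq_mul]
      simp
    have h2 : I.conn.vel l = I.conn.push (Pi.single l 1) := by
      simp [ConnectionAlong.push, Pi.single_apply]
    have h3 : ∀ Y : Fin m → SmoothGerm x, I.conn.ip ν (I.conn.push Y)
        = ∑ i, Y i * I.conn.ip ν (I.conn.vel i) := by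
      intro Y
      simp [ConnectionAlong.push]
    have h4 : ∀ a, ∑ i, X a i * I.conn.ip ν (I.conn.vel i) = 0 := fun a => by
      rw [← h3]; exact hνX a
    rw [h2, sub_eq_zero.1 h1, h3]
    simp only [Finset.sum_apply, Pi.smul_apply, smul_eq_mul, Finset.sum_mul]
    rw [Finset.sum_comm]
    simp only [mul_assoc, ← Finset.mul_sum, h4]
    simp
  have hpush : ∀ w, (∀ l, I.conn.ip w (I.conn.vel l) = 0) → ∀ a, I.conn.ip w (I.conn.push (X a)) = 0 := by
    intro w hw a
    simp [ConnectionAlong.push, hw]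
  refine ⟨ν, ⟨hvel, hν, fun w hw hwν => eq_zero_of_orthogonal I.conn.ip _ hsnoc w ?_⟩, ?_⟩
  · intro a
    induction a using Fin.lastCases with
    | last => simpa using hwν
    | cast a => simpa using hpush w hw a
  · intro u hu hud
    set e : Fin (m + 1) → ℝ := fun a => ev x (ν a) with he
    have hsnoc' : ∀ a b, dotBilin h (F x)
        (fun c => ev x ((Fin.snoc (fun a => I.conn.push (X a)) ν : Fin (m + 1) → _) a c))
        (fun c => ev x ((Fin.snoc (fun a => I.conn.push (X a)) ν : Fin (m + 1) → _) b c))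
          = if a = b then 1 else 0 := by
      intro a b
      have h1 := congrArg (ev x) (hsnoc a b)
      rw [I.ev_ip] at h1
      refine h1.trans ?_
      split_ifs <;> simp
    have hee : dotBilin h (F x) e e = 1 := by
      have h1 := congrArg (ev x) hν
      rw [I.ev_ip, map_one] at h1
      exact h1
    have hcomm : ∀ v w, dotBilin h (F x) v w = dotBilin h (F x) w v := by
      intro v w
      change dot h (F x) v w = dot h (F x) w v
      simp only [dot]
      rw [Finset.sum_comm]
      exact Finset.sum_congr rfl fun _ _ => Finset.sum_congr rfl fun _ _ => by
        rw [I.target.symm]; ring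
    have h2 : u - dotBilin h (F x) e u • e = 0 := by
      refine eq_zero_of_orthogonal (dotBilin h (F x)) _ hsnoc' _ fun a => ?_
      induction a using Fin.lastCases with
      | last =>
        simp only [Fin.snoc_last, map_sub, map_smul, LinearMap.sub_apply, LinearMap.smul_apply]
        change dotBilin h (F x) u e - dotBilin h (F x) e u * dotBilin h (F x) e e = 0
        rw [hee, hcomm u e, mul_one, sub_self]
      | cast a =>
        simp only [Fin.snoc_castSucc, map_sub, map_smul, LinearMap.sub_apply, LinearMap.smul_apply]
        have h3 : (fun c => ev x (I.conn.push (X a) c)) = ∑ i, ev x (X a i) • dmap F i x := by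
          funext c
          simp [ConnectionAlong.push, (I.rep_vel _ c).ev_eq]
        have h4 : dotBilin h (F x) u (fun c => ev x (I.conn.push (X a) c)) = 0 := by
          have h5 : ∀ i, dotBilin h (F x) u (dmap F i x) = 0 := hud
          rw [h3]
          simp [h5]
        have h6 : dotBilin h (F x) e (fun c => ev x (I.conn.push (X a) c)) = 0 := by
          have h1 := congrArg (ev x) (hνX a)
          rw [I.ev_ip, map_zero] at h1
          exact h1
        rw [h4, h6, smul_zero, sub_zero]
    have h3 : dotBilin h (F x) u u = dotBilin h (F x) e u ^ 2 := by
      conv_lhs => rw [sub_eq_zero.1 h2]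
      simp only [map_smul, LinearMap.smul_apply, hee, smul_eq_mul]
      ring
    exact h3.symm.trans hu

end Hypersurface

/-- The square of the mean curvature is one ninth of the square of the length of the tension field. -/
theorem meanCurvature_sq {g : E 3 → Matrix (Fin 3) (Fin 3) ℝ} {h : E 4 → Matrix (Fin 4) (Fin 4) ℝ}
    {F : E 3 → E 4} {x : E 3} (I : IsIsometricAt g h F x) {u : Fin 4 → ℝ}
    (hu : dot h (F x) u u = 1) (hud : ∀ i, dot h (F x) u (dmap F i x) = 0) :
    meanCurvature g h F x u ^ 2 = dot h (F x) (tension g h F x) (tension g h F x) / 9 := by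
  obtain ⟨ν, hν, hu'⟩ := I.exists_isNormal
  have h1 := hu' u hu hud
  set e : Fin 4 → ℝ := fun a => ev x (ν a) with he
  have hee : dotBilin h (F x) e e = 1 := by
    have h1 := congrArg (ev x) hν.ip_self
    rw [I.ev_ip, map_one] at h1
    exact h1
  have h2 : tension g h F x = ev x (I.conn.trace I.source.invGerm ν) • e := by
    funext a
    rw [← (I.rep_tens a).ev_eq, hν.tens_eq I.met_mul_inv]
    simp [he]
  have h3 : meanCurvature g h F x u = (1 / 3 : ℝ) * dotBilin h (F x) (tension g h F x) u := by
    have h4 : tension g h F x = ∑ i, ∑ j, (g x)⁻¹ i j • secondForm g h F i j x := by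
      funext a
      simp [tension]
    rw [h4]
    simp only [map_sum, map_smul, LinearMap.sum_apply, LinearMap.smul_apply, smul_eq_mul]
    rfl
  change dotBilin h (F x) e u ^ 2 = 1 at h1
  change _ = dotBilin h (F x) (tension g h F x) (tension g h F x) / 9
  rw [h3, h2]
  simp only [map_smul, LinearMap.smul_apply, smul_eq_mul, hee]
  linear_combination (1 / 9 : ℝ) * ev x (I.conn.trace I.source.invGerm ν) ^ 2 * h1

end IsIsometricAt

section Local

variable {g : E 3 → Matrix (Fin 3) (Fin 3) ℝ} {h : E 4 → Matrix (Fin 4) (Fin 4) ℝ}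
  {F : E 3 → E 4} {c R : ℝ}

/-- Where the mean curvature is not stationary, it takes one of finitely many values. -/
theorem normSq_tension_of_pd_ne_zero {x : E 3} (I : IsIsometricAt g h F x)
    (hh : ∀ᶠ z in 𝓝 (F x), IsMetricAt h z)
    (hc : ∀ᶠ z in 𝓝 (F x), ∀ u v : Fin 4 → ℝ, dot h z (curvatureVec h z u v v) u
      = c * (dot h z u u * dot h z v v - dot h z u v ^ 2))
    (hR : ∀ᶠ y in 𝓝 x, scalarCurvature g y = R)
    (hbi : ∀ᶠ y in 𝓝 x, ∀ j, divergence g (stressBienergy g h F) j y = 0) (i : Fin 3)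
    (hi : pd i (fun y => dot h (F y) (tension g h F y) (tension g h F y)) x ≠ 0) :
    (3 * dot h (F x) (tension g h F x) (tension g h F x) - 8 * (6 * c - R))
      * (7 * dot h (F x) (tension g h F x) (tension g h F x) - 2 * (6 * c - R)) = 0 := by
  obtain ⟨ν, hν, -⟩ := I.exists_isNormal
  set f := I.conn.trace I.source.invGerm ν with hf
  have h1 : I.conn.ip (I.conn.tens I.source.invGerm) (I.conn.tens I.source.invGerm) = f * f := by
    rw [hν.tens_eq I.met_mul_inv]
    simp [hν.ip_self, ← hf]
  have hs := I.rep_ip I.rep_tens I.rep_tens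
  rw [h1] at hs
  have hs0 := hs.ev_eq
  have hs1 := (hs.pd i).ev_eq
  rw [← hs1, Derivation.leibniz, smul_eq_mul, map_add, map_mul] at hi
  simp only [map_mul] at hs0
  rw [← hs0]
  by_contra hne
  refine hν.not_regular (isLocalEval_ev x) gpd_comm I.met_mul_inv I.source.invGerm_symm
    I.ev_ip_push_pos (IsMetricAt.along_hasCurvature I.contDiffAt I.target hh hc) (R := R) (κ := (6 * c - R) / 2)
    (I.rep_scal.eq_of_eventuallyEq (rep_const R) hR) (by ring)
    (fun j => (I.rep_dvg I.rep_stress j).eq_of_eventuallyEq rep_zero (hbi.mono fun y hy => hy j))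
    ?_ ?_ i ?_
  · intro h0
    apply hne
    rw [← hf] at h0
    linear_combination (7 * (ev x f * ev x f) - 2 * (6 * c - R)) * h0
  · intro h0
    apply hne
    rw [← hf] at h0
    linear_combination (3 * (ev x f * ev x f) - 8 * (6 * c - R)) * h0
  · intro h0
    apply hi
    rw [← hf] at h0
    rw [h0]
    ring

/-- The local form of the theorem: the mean curvature is stationary. -/
theorem pd_normSq_tension_eq_zero {x : E 3} (I : ∀ᶠ y in 𝓝 x, IsIsometricAt g h F y)
    (hh : ∀ᶠ y in 𝓝 x, ∀ᶠ z in 𝓝 (F y), IsMetricAt h z)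
    (hc : ∀ᶠ y in 𝓝 x, ∀ᶠ z in 𝓝 (F y), ∀ u v : Fin 4 → ℝ, dot h z (curvatureVec h z u v v) u
      = c * (dot h z u u * dot h z v v - dot h z u v ^ 2))
    (hR : ∀ᶠ y in 𝓝 x, scalarCurvature g y = R)
    (hbi : ∀ᶠ y in 𝓝 x, ∀ j, divergence g (stressBienergy g h F) j y = 0) (i : Fin 3) :
    pd i (fun y => dot h (F y) (tension g h F y) (tension g h F y)) x = 0 := by
  by_contra hne
  have I0 := I.self_of_nhds
  have hs := I0.rep_ip I0.rep_tens I0.rep_tens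
  set a := I0.conn.ip (I0.conn.tens I0.source.invGerm) (I0.conn.tens I0.source.invGerm) with ha
  set r : SmoothGerm x := algebraMap ℝ _ (6 * c - R) with hr
  -- Near `x` the function takes at most two values, hence is constant by continuity; the germs
  -- see this by differentiating the equation for the values.
  have h1 : (3 * a - 8 * r) * (7 * a - 2 * r) = 0 := by
    have hrep := (((rep_const (x := x) 3).mul hs).sub (rep_const (8 * (6 * c - R)))).mul
      (((rep_const (x := x) 7).mul hs).sub (rep_const (2 * (6 * c - R))))
    have h2 := hrep.eq_of_eventuallyEq rep_zero (by
      filter_upwards [I, hh, hc, hR.eventually_nhds, hbi.eventually_nhds,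
        (hs.pd i).contDiffAt.continuousAt.eventually_ne hne] with y h1 h2 h3 h4 h5 h6
      exact normSq_tension_of_pd_ne_zero h1 h2 h3 h4 h5 i h6)
    simpa only [map_mul, map_ofNat, hr] using h2
  have hu : IsUnit (gpd i a) := isUnit_of_ev_ne_zero (by rwa [(hs.pd i).ev_eq])
  have dr : gpd i r = 0 := Derivation.map_algebraMap _ _
  have dn : ∀ k : ℕ, gpd i (k : SmoothGerm x) = 0 := fun k => Derivation.map_natCast _ _
  have h2 : gpd i a * (42 * a - 62 * r) = 0 := by
    have h3 := congrArg (gpd i) h1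
    have d3 := dn 3
    have d8 := dn 8
    have d7 := dn 7
    have d2 := dn 2
    push_cast at d3 d8 d7 d2
    simp only [Derivation.leibniz, map_sub, dr, d3, d8, d7, d2, smul_eq_mul, map_zero] at h3
    linear_combination h3
  have h3 := congrArg (gpd i) (hu.mul_right_eq_zero.1 h2)
  have d42 := dn 42
  have d62 := dn 62
  push_cast at d42 d62
  simp only [Derivation.leibniz, map_sub, dr, d42, d62, smul_eq_mul, map_zero, mul_zero,
    add_zero, sub_zero] at h3
  have h4 := congrArg (ev x) h3
  rw [map_mul, (hs.pd i).ev_eq, map_zero, map_ofNat] at h4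
  exact hne (by linarith)

end Local

end Biconservative

namespace Biconservative
open Filter Topology SmoothGerm

/-! ### Composition of immersions and changes of coordinates -/

namespace IsIsometricAt

section Composition

variable {l m n : ℕ} {f : E l → Matrix (Fin l) (Fin l) ℝ} {g : E m → Matrix (Fin m) (Fin m) ℝ}
  {h : E n → Matrix (Fin n) (Fin n) ℝ} {F : E l → E m} {G : E m → E n} {x : E l}
  (I : IsIsometricAt f g F x) (J : IsIsometricAt g h G (F x))

/-- The image `dG(w)` of a vector field `w` along `F`. -/
def pushAlong (w : Fin m → SmoothGerm x) (a : Fin n) : SmoothGerm x :=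
  ∑ b, comap F I.contDiffAt (J.conn.vel b a) * w b

variable (K : IsIsometricAt f h (fun y => G (F y)) x)

theorem comp_vel (i : Fin l) : K.conn.vel i = I.pushAlong J (I.conn.vel i) := by
  funext a
  exact gpd_comap I.contDiffAt (component G J.contDiffAt a) i

/-- The chain rule for covariant derivatives, with the term `D dG` not yet split into its tangent
and normal parts. -/
theorem comp_D (i : Fin l) (w : Fin m → SmoothGerm x) (a : Fin n) :
    K.conn.D i (I.pushAlong J w) a
      = ∑ b, comap F I.contDiffAt (J.conn.vel b a) * gpd i (w b)
        + ∑ c, ∑ b, comap F I.contDiffAt (J.conn.D c (J.conn.vel b) a) * I.conn.vel i c * w b := by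
  have hJ : ∀ b c, J.conn.D c (J.conn.vel b) a = gpd c (J.conn.vel b a)
      + ∑ d, (∑ p, comap G J.contDiffAt (J.target.chrGerm a p d) * J.conn.vel c p)
        * J.conn.vel b d := fun b c => rfl
  have hK : K.conn.D i (I.pushAlong J w) a = gpd i (I.pushAlong J w a)
      + ∑ d, (∑ p, comap (fun y => G (F y)) K.contDiffAt (K.target.chrGerm a p d)
        * K.conn.vel i p) * I.pushAlong J w d := rfl
  have hchr : ∀ a p d, comap (fun y => G (F y)) K.contDiffAt (K.target.chrGerm a p d)
      = comap F I.contDiffAt (comap G J.contDiffAt (J.target.chrGerm a p d)) := by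
    intro a p d
    exact ((K.target.rep_chrGerm a p d).comap K.contDiffAt).unique
      (((J.target.rep_chrGerm a p d).comap J.contDiffAt).comap I.contDiffAt)
  rw [hK, I.comp_vel J K]
  simp only [hchr, hJ, pushAlong, map_sum, Derivation.leibniz, smul_eq_mul, map_add, map_mul,
    gpd_comap, Finset.sum_add_distrib]
  rw [add_assoc]
  congr 1
  have e1 : ∑ b, w b * ∑ d, comap F I.contDiffAt (gpd d (J.conn.vel b a))
        * gpd i (component F I.contDiffAt d)
      = ∑ c, ∑ b, comap F I.contDiffAt (gpd c (J.conn.vel b a)) * I.conn.vel i c * w b := by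
    simp only [Finset.mul_sum]
    rw [Finset.sum_comm]
    exact Finset.sum_congr rfl fun _ _ => Finset.sum_congr rfl fun _ _ => mul_comm _ _
  have e2 : ∑ d, (∑ p, comap F I.contDiffAt (comap G J.contDiffAt (J.target.chrGerm a p d))
        * ∑ c, comap F I.contDiffAt (J.conn.vel c p) * I.conn.vel i c)
          * ∑ b, comap F I.contDiffAt (J.conn.vel b d) * w b
      = ∑ c, ∑ b, (∑ d, (∑ p, comap F I.contDiffAt (comap G J.contDiffAt (J.target.chrGerm a p d))
        * comap F I.contDiffAt (J.conn.vel c p)) * comap F I.contDiffAt (J.conn.vel b d))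
          * I.conn.vel i c * w b := by
    generalize hA : (fun p d => comap F I.contDiffAt (comap G J.contDiffAt
      (J.target.chrGerm a p d))) = A
    generalize hB : (fun c p => comap F I.contDiffAt (J.conn.vel c p)) = B
    generalize I.conn.vel i = v
    have hA' : ∀ p d, comap F I.contDiffAt (comap G J.contDiffAt (J.target.chrGerm a p d))
        = A p d := fun p d => by rw [← hA]
    have hB' : ∀ c p, comap F I.contDiffAt (J.conn.vel c p) = B c p := fun c p => by rw [← hB]
    simp only [hA', hB']
    have t1 : ∀ d, ∑ p, A p d * ∑ c, B c p * v c = ∑ c, (∑ p, A p d * B c p) * v c := by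
      intro d
      simp only [Finset.mul_sum, Finset.sum_mul]
      rw [Finset.sum_comm]
      exact Finset.sum_congr rfl fun _ _ => Finset.sum_congr rfl fun _ _ => by ring
    simp only [t1]
    simp only [Finset.sum_mul_sum]
    rw [Finset.sum_comm]
    refine Finset.sum_congr rfl fun c _ => ?_
    rw [Finset.sum_comm]
    refine Finset.sum_congr rfl fun b _ => ?_
    rw [Finset.sum_mul, Finset.sum_mul]
    exact Finset.sum_congr rfl fun _ _ => by ring
  rw [e1, e2]
  simp only [add_mul, Finset.sum_add_distrib]

include I J K in
/-- The second fundamental form of a composition. -/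
theorem secondForm_comp (i j : Fin l) :
    secondForm f h (fun y => G (F y)) i j x
      = ∑ b, secondForm f g F i j x b • dmap G b (F x)
        + ∑ c, ∑ b, (dmap F i x c * dmap F j x b) • secondForm g h G c b (F x) := by
  have key : ∀ a, K.conn.sff K.source.invGerm i j a
      = ∑ b, comap F I.contDiffAt (J.conn.vel b a) * I.conn.sff I.source.invGerm i j b
        + ∑ c, ∑ b, I.conn.vel i c * I.conn.vel j b
          * comap F I.contDiffAt (J.conn.sff J.source.invGerm c b a) := by
    intro a
    have e1 : K.conn.sff K.source.invGerm i j a = K.conn.D i (K.conn.vel j) a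
        - ∑ k, K.source.chrGerm k i j * K.conn.vel k a := by
      simp [ConnectionAlong.sff, K.chr_eq]
    have e2 : ∀ b, I.conn.sff I.source.invGerm i j b = gpd i (I.conn.vel j b)
        + ∑ d, (∑ p, comap F I.contDiffAt (I.target.chrGerm b p d) * I.conn.vel i p)
          * I.conn.vel j d - ∑ k, K.source.chrGerm k i j * I.conn.vel k b := by
      intro b
      have : I.conn.sff I.source.invGerm i j b = I.conn.D i (I.conn.vel j) b
          - ∑ k, I.source.chrGerm k i j * I.conn.vel k b := by
        simp [ConnectionAlong.sff, I.chr_eq]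
      rw [this]
      rfl
    have e3 : ∀ c b, J.conn.sff J.source.invGerm c b a = J.conn.D c (J.conn.vel b) a
        - ∑ e, I.target.chrGerm e c b * J.conn.vel e a := by
      intro c b
      simp only [ConnectionAlong.sff, J.chr_eq, Pi.sub_apply, Finset.sum_apply, Pi.smul_apply,
        smul_eq_mul]
    rw [e1, I.comp_vel J K, I.comp_D J K]
    simp only [e2, e3, map_sub, map_sum, map_mul, mul_add, mul_sub, Finset.sum_add_distrib,
      Finset.sum_sub_distrib, I.comp_vel J K, pushAlong]
    have t1 : ∑ k, K.source.chrGerm k i j * ∑ b, comap F I.contDiffAt (J.conn.vel b a)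
          * I.conn.vel k b
        = ∑ b, comap F I.contDiffAt (J.conn.vel b a)
          * ∑ k, K.source.chrGerm k i j * I.conn.vel k b := by
      simp only [Finset.mul_sum]
      rw [Finset.sum_comm]
      exact Finset.sum_congr rfl fun _ _ => Finset.sum_congr rfl fun _ _ => by ring
    have t2 : ∑ b, comap F I.contDiffAt (J.conn.vel b a)
          * ∑ d, (∑ p, comap F I.contDiffAt (I.target.chrGerm b p d) * I.conn.vel i p)
            * I.conn.vel j d
        = ∑ c, ∑ b, I.conn.vel i c * I.conn.vel j b * ∑ e,
          comap F I.contDiffAt (I.target.chrGerm e c b) * comap F I.contDiffAt (J.conn.vel e a) := by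
      simp only [Finset.mul_sum, Finset.sum_mul]
      rw [Finset.sum_comm]
      rw [Finset.sum_congr rfl fun d _ => Finset.sum_comm]
      rw [Finset.sum_comm]
      exact Finset.sum_congr rfl fun _ _ => Finset.sum_congr rfl fun _ _ =>
        Finset.sum_congr rfl fun _ _ => by ring
    have t3 : ∑ c, ∑ b, I.conn.vel i c * I.conn.vel j b
          * comap F I.contDiffAt (J.conn.D c (J.conn.vel b) a)
        = ∑ c, ∑ b, comap F I.contDiffAt (J.conn.D c (J.conn.vel b) a) * I.conn.vel i c
          * I.conn.vel j b :=
      Finset.sum_congr rfl fun _ _ => Finset.sum_congr rfl fun _ _ => by ring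
    rw [t1, t2, t3]
    ring
  funext a
  have h1 := congrArg (ev x) (key a)
  rw [(K.rep_sff i j a).ev_eq] at h1
  simp only [map_add, map_sum, map_mul, ((J.rep_vel _ a).comap I.contDiffAt).ev_eq,
    (I.rep_sff i j _).ev_eq, (I.rep_vel _ _).ev_eq,
    ((J.rep_sff _ _ a).comap I.contDiffAt).ev_eq] at h1
  rw [h1]
  simp [mul_comm]

end Composition

section Coordinates

variable {m n : ℕ}

/-- Local isometries are totally geodesic. -/
theorem secondForm_eq_zero {g h : E n → Matrix (Fin n) (Fin n) ℝ} {F : E n → E n} {x : E n}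
    (I : IsIsometricAt g h F x) (i j : Fin n) : secondForm g h F i j x = 0 := by
  have h1 : I.conn.sff I.source.invGerm i j = 0 := by
    set w := I.conn.sff I.source.invGerm i j with hw
    set v : Matrix (Fin n) (Fin n) (SmoothGerm x) := Matrix.of I.conn.vel with hv
    set H : Matrix (Fin n) (Fin n) (SmoothGerm x) :=
      Matrix.of fun a b => comap F I.contDiffAt (I.target.germ a b) with hH
    set k : Matrix (Fin n) (Fin n) (SmoothGerm x) := Matrix.of I.source.invGerm with hk
    -- The first fundamental form is `v H vᵀ`, and `k` is its inverse.
    have h2 : v * (H * v.transpose * k) = 1 := by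
      rw [← mul_assoc]
      refine Matrix.ext fun p q => ?_
      have h3 : ∀ a, (v * (H * v.transpose)) p a = I.conn.met p a := by
        intro a
        change _ = ∑ b, ∑ c, comap F I.contDiffAt (I.target.germ b c) * I.conn.vel p b
          * I.conn.vel a c
        simp only [Matrix.mul_apply, hv, hH, Matrix.of_apply, Matrix.transpose_apply,
          Finset.mul_sum]
        exact Finset.sum_congr rfl fun _ _ => Finset.sum_congr rfl fun _ _ => by ring
      rw [Matrix.mul_apply]
      simp only [h3]
      exact (I.met_mul_inv p q).trans (Matrix.one_apply ..).symm
    -- Since the dimensions agree, the `∂ᵢ` also span the fields along `F`.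
    have h4 : H * v.transpose * (k * v) = 1 := by
      rw [← mul_assoc]
      exact mul_eq_one_comm.1 h2
    have h5 : Matrix.vecMul w (H * v.transpose) = 0 := by
      funext p
      refine Eq.trans ?_ (I.conn.ip_sff_vel I.met_mul_inv i j p)
      change _ = ∑ b, ∑ c, comap F I.contDiffAt (I.target.germ b c) * w b * I.conn.vel p c
      simp only [Matrix.vecMul, dotProduct, Matrix.mul_apply, hv, hH, Matrix.of_apply,
        Matrix.transpose_apply, Finset.mul_sum]
      exact Finset.sum_congr rfl fun _ _ => Finset.sum_congr rfl fun _ _ => by ring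
    have h6 := congrArg (fun u => Matrix.vecMul u (k * v)) h5
    simpa only [Matrix.vecMul_vecMul, h4, Matrix.vecMul_one, Matrix.zero_vecMul] using h6
  funext a
  have h2 := (I.rep_sff i j a).ev_eq
  rw [h1] at h2
  exact h2.symm.trans (map_zero _)

/-- The mean curvature does not depend on the coordinates of the target. -/
theorem meanCurvature_comp_left {f : E m → Matrix (Fin m) (Fin m) ℝ}
    {g h : E n → Matrix (Fin n) (Fin n) ℝ} {F : E m → E n} {G : E n → E n} {x : E m}
    (I : IsIsometricAt f g F x) (J : IsIsometricAt g h G (F x))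
    (K : IsIsometricAt f h (fun y => G (F y)) x) (u : Fin n → ℝ) :
    meanCurvature f h (fun y => G (F y)) x (∑ b, u b • dmap G b (F x))
      = meanCurvature f g F x u := by
  simp only [meanCurvature]
  congr 1
  refine Finset.sum_congr rfl fun i _ => Finset.sum_congr rfl fun j _ => ?_
  congr 1
  rw [I.secondForm_comp J K]
  simp only [J.secondForm_eq_zero, smul_zero, Finset.sum_const_zero, add_zero]
  change dotBilin h (G (F x)) _ _ = _
  simp only [map_sum, map_smul, LinearMap.sum_apply, LinearMap.smul_apply, smul_eq_mul,
    Finset.mul_sum]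
  simp only [dot, J.pullback.self_of_nhds]
  rw [Finset.sum_comm]
  refine Finset.sum_congr rfl fun a _ => Finset.sum_congr rfl fun b _ => ?_
  change _ * (_ * dot h (G (F x)) _ _) = _
  simp only [dot]
  ring

/-- The mean curvature does not depend on the coordinates of the source. -/
theorem meanCurvature_comp_right {f g : E m → Matrix (Fin m) (Fin m) ℝ}
    {h : E n → Matrix (Fin n) (Fin n) ℝ} {F : E m → E m} {G : E m → E n} {x : E m}
    (I : IsIsometricAt f g F x) (J : IsIsometricAt g h G (F x))
    (K : IsIsometricAt f h (fun y => G (F y)) x) (u : Fin n → ℝ) :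
    meanCurvature f h (fun y => G (F y)) x u = meanCurvature g h G (F x) u := by
  -- The inverse metric is a contravariant tensor.
  have hinv : ∀ c b, ∑ i, ∑ j, (f x)⁻¹ i j * (dmap F i x c * dmap F j x b) = (g (F x))⁻¹ c b := by
    set v : Matrix (Fin m) (Fin m) ℝ := Matrix.of fun i => dmap F i x with hv
    have hf : f x = v * g (F x) * v.transpose := by
      ext i j
      rw [I.pullback.self_of_nhds i j]
      simp only [Matrix.mul_apply, dot, Matrix.of_apply, hv, Matrix.transpose_apply,
        Finset.sum_mul]
      rw [Finset.sum_comm]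
      exact Finset.sum_congr rfl fun _ _ => Finset.sum_congr rfl fun _ _ => by ring
    have h1 : v * (g (F x) * v.transpose * (f x)⁻¹) = 1 := by
      rw [← mul_assoc, ← mul_assoc, ← hf,
        Matrix.mul_nonsing_inv _ (isUnit_iff_ne_zero.2 I.source.det_ne_zero)]
    have h2 : g (F x) * (v.transpose * (f x)⁻¹ * v) = 1 := by
      have := mul_eq_one_comm.1 h1
      simpa only [mul_assoc] using this
    intro c b
    rw [Matrix.inv_eq_right_inv h2]
    simp only [Matrix.mul_apply, Matrix.transpose_apply, hv, Matrix.of_apply, Finset.sum_mul]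
    rw [Finset.sum_comm]
    exact Finset.sum_congr rfl fun _ _ => Finset.sum_congr rfl fun _ _ => by ring
  simp only [meanCurvature]
  congr 1
  have h1 : ∀ i j, dot h (G (F x)) (secondForm f h (fun y => G (F y)) i j x) u
      = ∑ c, ∑ b, dmap F i x c * dmap F j x b * dot h (G (F x)) (secondForm g h G c b (F x)) u := by
    intro i j
    rw [I.secondForm_comp J K]
    simp only [I.secondForm_eq_zero, Pi.zero_apply, zero_smul, Finset.sum_const_zero, zero_add]
    change dotBilin h (G (F x)) _ _ = _
    simp only [map_sum, map_smul, LinearMap.sum_apply, LinearMap.smul_apply, smul_eq_mul]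
    rfl
  simp only [h1, ← hinv, Finset.mul_sum, Finset.sum_mul]
  rw [Finset.sum_congr rfl fun i _ => Finset.sum_comm]
  rw [Finset.sum_comm]
  refine Finset.sum_congr rfl fun c _ => ?_
  rw [Finset.sum_congr rfl fun i _ => Finset.sum_comm]
  rw [Finset.sum_comm]
  exact Finset.sum_congr rfl fun _ _ => Finset.sum_congr rfl fun _ _ =>
    Finset.sum_congr rfl fun _ _ => by ring

end Coordinates

end IsIsometricAt

theorem dmap_eventuallyEq {m n : ℕ} {F G : E m → E n} {x : E m} (h : F =ᶠ[𝓝 x] G) (i : Fin m) :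
    dmap F i =ᶠ[𝓝 x] dmap G i := by
  have h1 : ∀ a, ∀ᶠ y in 𝓝 x, dmap F i y a = dmap G i y a := fun a =>
    pd_eventuallyEq (h.mono fun y hy => by rw [hy]) i
  filter_upwards [eventually_all.2 h1] with y hy
  exact funext hy

theorem meanCurvature_congr {m n : ℕ} {g : E m → Matrix (Fin m) (Fin m) ℝ}
    {h : E n → Matrix (Fin n) (Fin n) ℝ} {F G : E m → E n} {x : E m} (hFG : F =ᶠ[𝓝 x] G)
    (u : Fin n → ℝ) : meanCurvature g h F x u = meanCurvature g h G x u := by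
  have h1 : ∀ i j, secondForm g h F i j x = secondForm g h G i j x := by
    intro i j
    funext a
    have e1 : ∀ k, dmap F k x = dmap G k x := fun k => (dmap_eventuallyEq hFG k).self_of_nhds
    have e2 : pd i (fun y => dmap F j y a) x = pd i (fun y => dmap G j y a) x :=
      (pd_eventuallyEq ((dmap_eventuallyEq hFG j).mono fun y hy => by rw [hy]) i).self_of_nhds
    simp only [secondForm, covAlong, e1, e2, hFG.self_of_nhds]
  simp only [meanCurvature, h1, hFG.self_of_nhds]

theorem IsIsometricAt.congr {m n : ℕ} {g : E m → Matrix (Fin m) (Fin m) ℝ}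
    {h : E n → Matrix (Fin n) (Fin n) ℝ} {F G : E m → E n} {x : E m} (I : IsIsometricAt g h F x)
    (hFG : F =ᶠ[𝓝 x] G) : IsIsometricAt g h G x where
  contDiffAt := I.contDiffAt.congr_of_eventuallyEq hFG.symm
  source := I.source
  target := hFG.self_of_nhds ▸ I.target
  pullback := by
    filter_upwards [I.pullback, hFG, eventually_all.2 fun i => dmap_eventuallyEq hFG i]
      with y h1 h2 h3 i j
    rw [h1, h2, h3, h3]

end Biconservative

namespace Biconservative
open Filter Topology

/-! ### Coordinate expressions on manifolds -/

theorem sum_smul_single (v : E n) :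
    v = ∑ a, v a • (EuclideanSpace.single a (1 : ℝ) : E n) := by
  ext b
  simp [Pi.single_apply]

section Charts

variable {m n : ℕ}
  {M : Type*} [TopologicalSpace M] [ChartedSpace (E m) M]
  {N : Type*} [TopologicalSpace N] [ChartedSpace (E n) N]

/-- The components of a tangent vector in a chart. -/
def comps (e : OpenPartialHomeomorph N (E n)) (q : N) (v : TangentSpace (𝓡 n) q) : Fin n → ℝ :=
  fun a => (show E n from mfderiv (𝓡 n) (𝓡 n) e q v) a

theorem mdifferentiable_of_mem_maximalAtlas {e : OpenPartialHomeomorph N (E n)}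
    (he : e ∈ IsManifold.maximalAtlas (𝓡 n) ∞ N) :
    e.MDifferentiable (𝓡 n) (𝓡 n) :=
  ⟨(contMDiffOn_of_mem_maximalAtlas he).mdifferentiableOn (by simp),
    (contMDiffOn_symm_of_mem_maximalAtlas he).mdifferentiableOn (by simp)⟩

variable {φ : M → N} {e : OpenPartialHomeomorph M (E m)} {e' : OpenPartialHomeomorph N (E n)}

theorem contDiffAt_localRep (hφ : ContMDiff (𝓡 m) (𝓡 n) ∞ φ)
    (he : e ∈ IsManifold.maximalAtlas (𝓡 m) ∞ M) (he' : e' ∈ IsManifold.maximalAtlas (𝓡 n) ∞ N)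
    {x : E m} (hx : x ∈ e.target) (hx' : φ (e.symm x) ∈ e'.source) :
    ContDiffAt ℝ ∞ (localRep φ e e') x := by
  rw [← contMDiffAt_iff_contDiffAt]
  exact (contMDiffAt_of_mem_maximalAtlas he' hx').comp x
    ((hφ.contMDiffAt).comp x (contMDiffAt_symm_of_mem_maximalAtlas he hx))

theorem fderiv_localRep (hφ : ContMDiff (𝓡 m) (𝓡 n) ∞ φ)
    (he : e ∈ IsManifold.maximalAtlas (𝓡 m) ∞ M) (he' : e' ∈ IsManifold.maximalAtlas (𝓡 n) ∞ N)
    {x : E m} (hx : x ∈ e.target) (hx' : φ (e.symm x) ∈ e'.source) (v : E m) :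
    fderiv ℝ (localRep φ e e') x v = (mfderiv (𝓡 n) (𝓡 n) e' (φ (e.symm x))
      (mfderiv (𝓡 m) (𝓡 n) φ (e.symm x) (mfderiv (𝓡 m) (𝓡 m) e.symm x v)) : E n) := by
  have h1 := (contMDiffAt_symm_of_mem_maximalAtlas he hx).mdifferentiableAt (by simp)
  have h2 := (hφ.contMDiffAt (x := e.symm x)).mdifferentiableAt (by simp)
  have h3 := (contMDiffAt_of_mem_maximalAtlas he' hx').mdifferentiableAt (by simp)
  rw [← mfderiv_eq_fderiv]
  have h4 : localRep φ e e' = e' ∘ (φ ∘ e.symm) := rfl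
  rw [h4, mfderiv_comp x h3 (h2.comp x h1), mfderiv_comp x h2 h1]
  rfl

theorem dmap_localRep (hφ : ContMDiff (𝓡 m) (𝓡 n) ∞ φ)
    (he : e ∈ IsManifold.maximalAtlas (𝓡 m) ∞ M) (he' : e' ∈ IsManifold.maximalAtlas (𝓡 n) ∞ N)
    {x : E m} (hx : x ∈ e.target) (hx' : φ (e.symm x) ∈ e'.source) (i : Fin m) :
    dmap (localRep φ e e') i x = comps e' (φ (e.symm x)) (mfderiv (𝓡 m) (𝓡 n) φ (e.symm x)
      (mfderiv (𝓡 m) (𝓡 m) e.symm x (EuclideanSpace.single i (1 : ℝ) : E m))) := by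
  funext a
  refine (pd_component ((contDiffAt_localRep hφ he he' hx hx').differentiableAt (by simp)) i a).trans ?_
  rw [fderiv_localRep hφ he he' hx hx']
  rfl

theorem eventually_mem_charts (hφ : ContMDiff (𝓡 m) (𝓡 n) ∞ φ) {x : E m} (hx : x ∈ e.target)
    (hx' : φ (e.symm x) ∈ e'.source) :
    ∀ᶠ y in 𝓝 x, y ∈ e.target ∧ φ (e.symm y) ∈ e'.source := by
  have h1 : ContinuousAt (fun y => φ (e.symm y)) x :=
    hφ.continuous.continuousAt.comp (e.continuousAt_symm hx)
  exact (e.open_target.eventually_mem hx).and (h1.eventually (e'.open_source.eventually_mem hx'))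

variable [IsManifold (𝓡 m) ∞ M] [IsManifold (𝓡 n) ∞ N]

theorem dot_coeff (g : Metric n N) (e : OpenPartialHomeomorph N (E n)) (x : E n) (u v : E n) :
    dot (coeff g e) x u v = g.inner (e.symm x) (mfderiv (𝓡 n) (𝓡 n) e.symm x u)
      (mfderiv (𝓡 n) (𝓡 n) e.symm x v) := by
  set T : E n →L[ℝ] TangentSpace (𝓡 n) (e.symm x) := mfderiv (𝓡 n) (𝓡 n) e.symm x with hT
  change _ = g.inner (e.symm x) (T u) (T v)
  conv_rhs => rw [sum_smul_single u, sum_smul_single v]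
  simp only [map_sum, map_smul, sum_apply, smul_apply,
    smul_eq_mul, Finset.mul_sum, dot]
  rw [Finset.sum_comm]
  refine Finset.sum_congr rfl fun _ _ => Finset.sum_congr rfl fun _ _ => ?_
  change g.inner (e.symm x) (T _) (T _) * _ * _ = _
  ring

/-- The coefficients of a smooth metric are smooth, since the coordinate vector fields are smooth
sections of the tangent bundle. -/
theorem contDiffAt_coeff (g : Metric n N) {e : OpenPartialHomeomorph N (E n)}
    (he : e ∈ IsManifold.maximalAtlas (𝓡 n) ∞ N) {x : E n} (hx : x ∈ e.target) (i j : Fin n) :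
    ContDiffAt ℝ ∞ (fun z => coeff g e z i j) x := by
  have hb : ContMDiffAt (𝓡 n) (𝓡 n) ∞ e.symm x := contMDiffAt_symm_of_mem_maximalAtlas he hx
  have hv : ∀ w : E n, ContMDiffAt (𝓡 n) (𝓡 n).tangent ∞
      (fun z => (⟨e.symm z, mfderiv (𝓡 n) (𝓡 n) e.symm z w⟩ : TangentBundle (𝓡 n) N)) x := by
    intro w
    have h1 := (contMDiffOn_symm_of_mem_maximalAtlas he).contMDiffOn_tangentMapWithin
      (m := ∞) (by simp) e.open_target.uniqueMDiffOn
    have h2 : ContMDiffAt (𝓡 n) (𝓡 n).tangent ∞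
        (fun z => (⟨z, w⟩ : TangentBundle (𝓡 n) (E n))) x :=
      contMDiffAt_vectorSpace_iff_contDiffAt.2 contDiffAt_const
    have h3 : (Bundle.TotalSpace.proj ⁻¹' e.target : Set (TangentBundle (𝓡 n) (E n)))
        ∈ 𝓝 (⟨x, w⟩ : TangentBundle (𝓡 n) (E n)) :=
      (e.open_target.preimage (FiberBundle.continuous_proj (E n) _)).mem_nhds hx
    refine (((h1 ⟨x, w⟩ hx).contMDiffAt h3).comp x h2).congr_of_eventuallyEq ?_
    filter_upwards [e.open_target.mem_nhds hx] with z hz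
    simp only [Function.comp_apply, tangentMapWithin]
    rw [mfderivWithin_of_isOpen e.open_target hz]
  have h1 : ContMDiffAt (𝓡 n) ((𝓡 n).prod 𝓘(ℝ)) ∞
      (fun z => Bundle.TotalSpace.mk' ℝ (E := Bundle.Trivial N ℝ) (e.symm z)
        (coeff g e z i j)) x := by
    apply ContMDiffAt.clm_bundle_apply₂ (F₁ := E n) (F₂ := E n)
      (E₁ := fun p : N => TangentSpace (𝓡 n) p) (E₂ := fun p : N => TangentSpace (𝓡 n) p)
    · exact ContMDiffAt.comp x (g.contMDiff.contMDiffAt) hb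
    · exact hv _
    · exact hv _
  simp only [Bundle.contMDiffAt_totalSpace] at h1
  exact contMDiffAt_iff_contDiffAt.1 h1.2

theorem isMetricAt_coeff (g : Metric n N) {e : OpenPartialHomeomorph N (E n)}
    (he : e ∈ IsManifold.maximalAtlas (𝓡 n) ∞ N) {x : E n} (hx : x ∈ e.target) :
    IsMetricAt (coeff g e) x where
  contDiffAt := contDiffAt_coeff g he hx
  symm _ _ _ := g.symm _ _ _
  pos v hv := by
    have h1 := dot_coeff g e x (WithLp.toLp 2 v) (WithLp.toLp 2 v)
    change dot (coeff g e) x v v = _ at h1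
    rw [h1]
    refine g.pos _ _ fun h0 => hv ?_
    have h2 := (mdifferentiable_of_mem_maximalAtlas he).comp_symm_deriv hx
    have h3 : mfderiv (𝓡 n) (𝓡 n) e (e.symm x) (mfderiv (𝓡 n) (𝓡 n) e.symm x
        (WithLp.toLp 2 v : E n)) = (WithLp.toLp 2 v : E n) :=
      congrArg (fun T => T (WithLp.toLp 2 v : E n)) h2
    have h4 : (0 : E n) = WithLp.toLp 2 v :=
      ((congrArg (mfderiv (𝓡 n) (𝓡 n) e (e.symm x)) h0).trans (map_zero _)).symm.trans h3
    funext a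
    exact (congrArg (fun w : E n => w a) h4).symm

/-- The metric in terms of the components of tangent vectors. -/
theorem dot_comps (g : Metric n N) {e : OpenPartialHomeomorph N (E n)}
    (he : e ∈ IsManifold.maximalAtlas (𝓡 n) ∞ N) {q : N} (hq : q ∈ e.source)
    (u v : TangentSpace (𝓡 n) q) :
    dot (coeff g e) (e q) (comps e q u) (comps e q v) = g.inner q u v := by
  refine (dot_coeff g e (e q) (mfderiv (𝓡 n) (𝓡 n) e q u) (mfderiv (𝓡 n) (𝓡 n) e q v)).trans ?_
  have h2 := (mdifferentiable_of_mem_maximalAtlas he).symm_comp_deriv hq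
  have h3 : ∀ w : TangentSpace (𝓡 n) q,
      mfderiv (𝓡 n) (𝓡 n) e.symm (e q) (mfderiv (𝓡 n) (𝓡 n) e q w) = w := fun w =>
    congrArg (fun T => T w) h2
  have h4 : ∀ q' (_ : q' = q) (a b : E n), g.inner q' a b = g.inner q a b := by
    rintro q' rfl a b
    rfl
  exact (h4 _ (e.left_inv hq) _ _).trans <| congrArg₂ (fun a b => g.inner q a b) (h3 u) (h3 v)

theorem IsIsometricImmersion.isIsometricAt {g : Metric m M} {h : Metric n N}
    (hφ : IsIsometricImmersion g h φ)
    (he : e ∈ IsManifold.maximalAtlas (𝓡 m) ∞ M) (he' : e' ∈ IsManifold.maximalAtlas (𝓡 n) ∞ N)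
    {x : E m} (hx : x ∈ e.target) (hx' : φ (e.symm x) ∈ e'.source) :
    IsIsometricAt (coeff g e) (coeff h e') (localRep φ e e') x where
  contDiffAt := contDiffAt_localRep hφ.contMDiff he he' hx hx'
  source := isMetricAt_coeff g he hx
  target := isMetricAt_coeff h he' (e'.map_source hx')
  pullback := by
    filter_upwards [eventually_mem_charts hφ.contMDiff hx hx'] with y hy i j
    rw [dmap_localRep hφ.contMDiff he he' hy.1 hy.2, dmap_localRep hφ.contMDiff he he' hy.1 hy.2]
    refine Eq.trans ?_ (dot_comps h he' hy.2 _ _).symm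
    rw [hφ.inner_eq]
    rfl

end Charts

end Biconservative

namespace Biconservative
open Filter Topology

/-! ### Independence of the charts -/

section Invariance

variable {m n : ℕ}
  {M : Type*} [TopologicalSpace M] {N : Type*} [TopologicalSpace N]
  {φ : M → N} {e : OpenPartialHomeomorph M (E m)} {e' : OpenPartialHomeomorph N (E n)} {p : M}

theorem localRep_apply (hp : p ∈ e.source) : localRep φ e e' (e p) = e' (φ p) := by
  simp only [localRep, e.left_inv hp]

theorem map_symm_mem (hp : p ∈ e.source) (hp' : φ p ∈ e'.source) :
    φ (e.symm (e p)) ∈ e'.source := by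
  rwa [e.left_inv hp]

variable [ChartedSpace (E m) M] [ChartedSpace (E n) N]

/-- The components of `dφ(w)`. -/
theorem comps_mfderiv (hφ : ContMDiff (𝓡 m) (𝓡 n) ∞ φ)
    (he : e ∈ IsManifold.maximalAtlas (𝓡 m) ∞ M) (he' : e' ∈ IsManifold.maximalAtlas (𝓡 n) ∞ N)
    (hp : p ∈ e.source) (hp' : φ p ∈ e'.source) (w : TangentSpace (𝓡 m) p) :
    comps e' (φ p) (mfderiv (𝓡 m) (𝓡 n) φ p w)
      = ∑ i, comps e p w i • dmap (localRep φ e e') i (e p) := by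
  have h1 := (contMDiffAt_of_mem_maximalAtlas he hp).mdifferentiableAt (by simp)
  have h2 := (hφ.contMDiffAt (x := p)).mdifferentiableAt (by simp)
  have h3 := (contMDiffAt_of_mem_maximalAtlas he' hp').mdifferentiableAt (by simp)
  have hd := (contDiffAt_localRep hφ he he' (e.map_source hp) (map_symm_mem hp hp')).differentiableAt
    (by simp)
  have h4 : e' ∘ φ =ᶠ[𝓝 p] localRep φ e e' ∘ e := by
    filter_upwards [e.open_source.mem_nhds hp] with q hq
    exact (localRep_apply hq).symm
  have h5 := h4.mfderiv_eq (I := 𝓡 m) (I' := 𝓡 n)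
  rw [mfderiv_comp p h3 h2, mfderiv_comp p hd.mdifferentiableAt h1, mfderiv_eq_fderiv] at h5
  have h6 : mfderiv (𝓡 n) (𝓡 n) e' (φ p) (mfderiv (𝓡 m) (𝓡 n) φ p w)
      = fderiv ℝ (localRep φ e e') (e p) (mfderiv (𝓡 m) (𝓡 m) e p w) :=
    congrArg (fun T => T w) h5
  funext a
  have h7 := congrArg (fun v : E n => v a) h6
  refine h7.trans ?_
  conv_lhs => rw [sum_smul_single (mfderiv (𝓡 m) (𝓡 m) e p w)]
  simp only [map_sum, map_smul, Finset.sum_apply, Pi.smul_apply, dmap, pd_component hd]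
  simp [comps]

theorem exists_comps_eq {e : OpenPartialHomeomorph N (E n)}
    (he : e ∈ IsManifold.maximalAtlas (𝓡 n) ∞ N) {q : N} (hq : q ∈ e.source) (u : Fin n → ℝ) :
    ∃ v : TangentSpace (𝓡 n) q, comps e q v = u := by
  obtain ⟨v, hv⟩ := (mdifferentiable_of_mem_maximalAtlas he).mfderiv_surjective hq
    (WithLp.toLp 2 u : E n)
  refine ⟨v, funext fun a => ?_⟩
  exact congrArg (fun w : E n => w a) hv

variable [IsManifold (𝓡 n) ∞ N] {h : Metric n N}

/-- Unit normal vectors in terms of their components. -/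
theorem isUnitNormal_iff (hφ : ContMDiff (𝓡 m) (𝓡 n) ∞ φ)
    (he : e ∈ IsManifold.maximalAtlas (𝓡 m) ∞ M) (he' : e' ∈ IsManifold.maximalAtlas (𝓡 n) ∞ N)
    (hp : p ∈ e.source) (hp' : φ p ∈ e'.source) (ν : TangentSpace (𝓡 n) (φ p)) :
    IsUnitNormal (m := m) h φ p ν ↔
      dot (coeff h e') (localRep φ e e' (e p)) (comps e' (φ p) ν) (comps e' (φ p) ν) = 1 ∧
      ∀ i, dot (coeff h e') (localRep φ e e' (e p)) (comps e' (φ p) ν)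
        (dmap (localRep φ e e') i (e p)) = 0 := by
  rw [localRep_apply hp, dot_comps h he' hp']
  refine and_congr Iff.rfl ⟨fun H i => ?_, fun H w => ?_⟩
  · obtain ⟨w, hw⟩ := exists_comps_eq he hp (Pi.single i 1)
    have h1 := comps_mfderiv hφ he he' hp hp' w
    rw [hw] at h1
    have h2 : ∑ j, (Pi.single i 1 : Fin m → ℝ) j • dmap (localRep φ e e') j (e p)
        = dmap (localRep φ e e') i (e p) := by
      simp [Pi.single_apply]
    rw [← h2, ← h1, dot_comps h he' hp']
    exact H w
  · rw [← dot_comps h he' hp', comps_mfderiv hφ he he' hp hp']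
    change dotBilin (coeff h e') _ _ _ = 0
    have H' : ∀ i, dotBilin (coeff h e') (e' (φ p)) (comps e' (φ p) ν)
      (dmap (localRep φ e e') i (e p)) = 0 := H
    simp [H']

variable [IsManifold (𝓡 m) ∞ M] {g : Metric m M}

theorem isIsometricImmersion_id (g : Metric m M) : IsIsometricImmersion g g id where
  contMDiff := contMDiff_id
  inner_eq p v w := by
    rw [mfderiv_id]
    rfl

theorem meanCurvatureAt_source_eq (hφ : IsIsometricImmersion g h φ)
    {e₂ : OpenPartialHomeomorph M (E m)}
    (he : e ∈ IsManifold.maximalAtlas (𝓡 m) ∞ M) (he₂ : e₂ ∈ IsManifold.maximalAtlas (𝓡 m) ∞ M)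
    (he' : e' ∈ IsManifold.maximalAtlas (𝓡 n) ∞ N)
    (hp : p ∈ e.source) (hp₂ : p ∈ e₂.source) (hp' : φ p ∈ e'.source)
    (ν : TangentSpace (𝓡 n) (φ p)) :
    meanCurvatureAt g h φ e e' p ν = meanCurvatureAt g h φ e₂ e' p ν := by
  have hid : (id : M → M) p ∈ e₂.source := hp₂
  have hx : localRep id e e₂ (e p) = e₂ p := localRep_apply hp
  have I := (isIsometricImmersion_id g).isIsometricAt he he₂ (e.map_source hp)
    (map_symm_mem hp hid)
  have J := hφ.isIsometricAt he₂ he' (e₂.map_source hp₂) (map_symm_mem hp₂ hp')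
  rw [← hx] at J
  have hev : localRep φ e e' =ᶠ[𝓝 (e p)] fun y => localRep φ e₂ e' (localRep id e e₂ y) := by
    filter_upwards [eventually_mem_charts contMDiff_id (e.map_source hp) (map_symm_mem hp hid)]
      with y hy
    simp only [localRep, id]
    rw [show e₂.symm (e₂ (e.symm y)) = e.symm y from e₂.left_inv hy.2]
  have K := (hφ.isIsometricAt he he' (e.map_source hp) (map_symm_mem hp hp')).congr hev
  unfold meanCurvatureAt
  rw [meanCurvature_congr hev, I.meanCurvature_comp_right J K, hx]

theorem meanCurvatureAt_target_eq (hφ : IsIsometricImmersion g h φ)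
    {e₂ : OpenPartialHomeomorph N (E n)}
    (he : e ∈ IsManifold.maximalAtlas (𝓡 m) ∞ M)
    (he' : e' ∈ IsManifold.maximalAtlas (𝓡 n) ∞ N) (he₂ : e₂ ∈ IsManifold.maximalAtlas (𝓡 n) ∞ N)
    (hp : p ∈ e.source) (hp' : φ p ∈ e'.source) (hp₂ : φ p ∈ e₂.source)
    (ν : TangentSpace (𝓡 n) (φ p)) :
    meanCurvatureAt g h φ e e' p ν = meanCurvatureAt g h φ e e₂ p ν := by
  have hid : (id : N → N) (φ p) ∈ e₂.source := hp₂
  have I := hφ.isIsometricAt he he' (e.map_source hp) (map_symm_mem hp hp')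
  have J := (isIsometricImmersion_id h).isIsometricAt he' he₂ (e'.map_source hp')
    (map_symm_mem hp' hid)
  have hx : localRep φ e e' (e p) = e' (φ p) := localRep_apply hp
  rw [← hx] at J
  have hev : localRep φ e e₂ =ᶠ[𝓝 (e p)] fun y => localRep id e' e₂ (localRep φ e e' y) := by
    filter_upwards [eventually_mem_charts hφ.contMDiff (e.map_source hp) (map_symm_mem hp hp')]
      with y hy
    simp only [localRep, id]
    rw [e'.left_inv hy.2]
  have K := (hφ.isIsometricAt he he₂ (e.map_source hp) (map_symm_mem hp hp₂)).congr hev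
  have hν : comps e₂ (φ p) ν
      = ∑ b, comps e' (φ p) ν b • dmap (localRep id e' e₂) b (localRep φ e e' (e p)) := by
    rw [hx, ← comps_mfderiv contMDiff_id he' he₂ hp' hid, mfderiv_id]
    rfl
  change _ = meanCurvature (coeff g e) (coeff h e₂) (localRep φ e e₂) (e p) (comps e₂ (φ p) ν)
  rw [meanCurvature_congr hev, hν, I.meanCurvature_comp_left J K]
  rfl

theorem meanCurvatureAt_eq (hφ : IsIsometricImmersion g h φ)
    {e₂ : OpenPartialHomeomorph M (E m)} {e₂' : OpenPartialHomeomorph N (E n)}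
    (he : e ∈ IsManifold.maximalAtlas (𝓡 m) ∞ M) (he' : e' ∈ IsManifold.maximalAtlas (𝓡 n) ∞ N)
    (he₂ : e₂ ∈ IsManifold.maximalAtlas (𝓡 m) ∞ M)
    (he₂' : e₂' ∈ IsManifold.maximalAtlas (𝓡 n) ∞ N)
    (hp : p ∈ e.source) (hp' : φ p ∈ e'.source) (hp₂ : p ∈ e₂.source) (hp₂' : φ p ∈ e₂'.source)
    (ν : TangentSpace (𝓡 n) (φ p)) :
    meanCurvatureAt g h φ e e' p ν = meanCurvatureAt g h φ e₂ e₂' p ν :=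
  (meanCurvatureAt_source_eq hφ he he₂ he' hp hp₂ hp' ν).trans
    (meanCurvatureAt_target_eq hφ he₂ he' he₂' hp₂ hp' hp₂' ν)

end Invariance

end Biconservative

namespace Biconservative
open Filter Topology

/-! ### Globalization -/

/-- The components of a continuous vector field along a map are continuous. -/
theorem continuousAt_comps {n : ℕ} {X N : Type*} [TopologicalSpace X] [TopologicalSpace N]
    [ChartedSpace (E n) N] [IsManifold (𝓡 n) ∞ N] {e' : OpenPartialHomeomorph N (E n)} {φ : X → N}
    {p : X} (hφ : Continuous φ) (he' : e' ∈ IsManifold.maximalAtlas (𝓡 n) ∞ N)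
    (hp' : φ p ∈ e'.source) {ξ : (p : X) → TangentSpace (𝓡 n) (φ p)}
    (hξ : Continuous (fun p => (⟨φ p, ξ p⟩ : TangentBundle (𝓡 n) N))) (a : Fin n) :
    ContinuousAt (fun q => comps e' (φ q) (ξ q) a) p := by
  have h1 := (contMDiffOn_of_mem_maximalAtlas he').continuousOn_tangentMapWithin (by simp)
    e'.open_source.uniqueMDiffOn
  have h2 : (Bundle.TotalSpace.proj ⁻¹' e'.source : Set (TangentBundle (𝓡 n) N))
      ∈ 𝓝 (⟨φ p, ξ p⟩ : TangentBundle (𝓡 n) N) :=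
    (e'.open_source.preimage (FiberBundle.continuous_proj (E n) _)).mem_nhds hp'
  have h3 := (contMDiff_snd_tangentBundle_modelSpace (n := ∞) (E n) (𝓡 n)).continuous
  have h4 : Continuous fun v : E n => v a := by fun_prop
  have h5 : ContinuousAt (fun q => (tangentMapWithin (𝓡 n) (𝓡 n) e' e'.source
      (⟨φ q, ξ q⟩ : TangentBundle (𝓡 n) N))) p :=
    ContinuousAt.comp (f := fun q => (⟨φ q, ξ q⟩ : TangentBundle (𝓡 n) N))
      (h1.continuousAt h2) hξ.continuousAt
  have h6 := (h4.continuousAt.comp (h3.continuousAt.comp h5))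
  refine h6.congr ?_
  filter_upwards [hφ.continuousAt.eventually (e'.open_source.eventually_mem hp')] with q hq
  exact congrArg (fun T : TangentSpace (𝓡 n) (φ q) →L[ℝ] E n => T (ξ q) a)
    (mfderivWithin_of_isOpen e'.open_source hq)

section Global

variable {M : Type*} [TopologicalSpace M] [ChartedSpace (E 3) M] [IsManifold (𝓡 3) ∞ M]
  {N : Type*} [TopologicalSpace N] [ChartedSpace (E 4) N] [IsManifold (𝓡 4) ∞ N]
  {g : Metric 3 M} {h : Metric 4 N} {φ : M → N} {e : OpenPartialHomeomorph M (E 3)}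
  {e' : OpenPartialHomeomorph N (E 4)} {p : M}

/-- The square of the length of the tension field, computed in charts. -/
def normSqTension (g : Metric 3 M) (h : Metric 4 N) (φ : M → N)
    (e : OpenPartialHomeomorph M (E 3)) (e' : OpenPartialHomeomorph N (E 4)) (x : E 3) : ℝ :=
  dot (coeff h e') (localRep φ e e' x) (tension (coeff g e) (coeff h e') (localRep φ e e') x)
    (tension (coeff g e) (coeff h e') (localRep φ e e') x)

theorem meanCurvatureAt_sq (hφ : IsIsometricImmersion g h φ)
    (he : e ∈ IsManifold.maximalAtlas (𝓡 3) ∞ M) (he' : e' ∈ IsManifold.maximalAtlas (𝓡 4) ∞ N)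
    (hp : p ∈ e.source) (hp' : φ p ∈ e'.source) {ν : TangentSpace (𝓡 4) (φ p)}
    (hν : IsUnitNormal (m := 3) h φ p ν) :
    meanCurvatureAt g h φ e e' p ν ^ 2 = normSqTension g h φ e e' (e p) / 9 := by
  obtain ⟨h1, h2⟩ := (isUnitNormal_iff hφ.contMDiff he he' hp hp' ν).1 hν
  exact (hφ.isIsometricAt he he' (e.map_source hp) (map_symm_mem hp hp')).meanCurvature_sq h1 h2

/-- Unit normals exist at every point; the one of the germ of the immersion is used. -/
theorem exists_isUnitNormal (hφ : IsIsometricImmersion g h φ) (p : M) :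
    ∃ ν : TangentSpace (𝓡 4) (φ p), IsUnitNormal (m := 3) h φ p ν := by
  have he := IsManifold.chart_mem_maximalAtlas (I := 𝓡 3) (n := ∞) p
  have he' := IsManifold.chart_mem_maximalAtlas (I := 𝓡 4) (n := ∞) (φ p)
  have hp := mem_chart_source (E 3) p
  have hp' := mem_chart_source (E 4) (φ p)
  have I := hφ.isIsometricAt he he' (OpenPartialHomeomorph.map_source _ hp) (map_symm_mem hp hp')
  obtain ⟨ν, hν, -⟩ := I.exists_isNormal
  obtain ⟨v, hv⟩ := exists_comps_eq he' hp' (fun a => SmoothGerm.ev _ (ν a))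
  refine ⟨v, (isUnitNormal_iff hφ.contMDiff he he' hp hp' v).2 ?_⟩
  rw [hv]
  constructor
  · rw [← I.ev_ip, hν.ip_self, map_one]
  · intro i
    have h1 := congrArg (SmoothGerm.ev _) (hν.ip_vel i)
    rw [I.ev_ip, map_zero] at h1
    simp only [(I.rep_vel i _).ev_eq] at h1
    exact h1

/-- The length of the tension field does not depend on the charts, as it is determined by the mean
curvature with respect to any unit normal. -/
theorem normSqTension_eq (hφ : IsIsometricImmersion g h φ)
    {e₂ : OpenPartialHomeomorph M (E 3)} {e₂' : OpenPartialHomeomorph N (E 4)}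
    (he : e ∈ IsManifold.maximalAtlas (𝓡 3) ∞ M) (he' : e' ∈ IsManifold.maximalAtlas (𝓡 4) ∞ N)
    (he₂ : e₂ ∈ IsManifold.maximalAtlas (𝓡 3) ∞ M)
    (he₂' : e₂' ∈ IsManifold.maximalAtlas (𝓡 4) ∞ N)
    (hp : p ∈ e.source) (hp' : φ p ∈ e'.source) (hp₂ : p ∈ e₂.source) (hp₂' : φ p ∈ e₂'.source) :
    normSqTension g h φ e e' (e p) = normSqTension g h φ e₂ e₂' (e₂ p) := by
  obtain ⟨ν, hν⟩ := exists_isUnitNormal hφ p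
  have h1 := meanCurvatureAt_sq hφ he he' hp hp' hν
  have h2 := meanCurvatureAt_sq hφ he₂ he₂' hp₂ hp₂' hν
  rw [meanCurvatureAt_eq hφ he he' he₂ he₂' hp hp' hp₂ hp₂' ν] at h1
  linarith

theorem normSqTension_locally_const (hφ : IsIsometricImmersion g h φ) {c : ℝ}
    (hN : HasConstantSectionalCurvature h c) (hbi : IsBiconservative g h φ)
    (hR : HasConstantScalarCurvature g)
    (he : e ∈ IsManifold.maximalAtlas (𝓡 3) ∞ M) (he' : e' ∈ IsManifold.maximalAtlas (𝓡 4) ∞ N)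
    {x : E 3} (hx : x ∈ e.target) (hx' : φ (e.symm x) ∈ e'.source) :
    ∀ᶠ y in 𝓝 x, normSqTension g h φ e e' y = normSqTension g h φ e e' x := by
  obtain ⟨R, hR⟩ := hR
  have hI : ∀ y, y ∈ e.target → φ (e.symm y) ∈ e'.source →
      IsIsometricAt (coeff g e) (coeff h e') (localRep φ e e') y := fun y hy hy' =>
    hφ.isIsometricAt he he' hy hy'
  have hdiff : ∀ y, y ∈ e.target → φ (e.symm y) ∈ e'.source →
      DifferentiableAt ℝ (normSqTension g h φ e e') y := fun y hy hy' =>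
    ((hI y hy hy').rep_ip (hI y hy hy').rep_tens (hI y hy hy').rep_tens).contDiffAt.differentiableAt
      (by simp)
  have hpd : ∀ y, y ∈ e.target → φ (e.symm y) ∈ e'.source →
      ∀ i, pd i (normSqTension g h φ e e') y = 0 := by
    intro y hy hy' i
    have hev := eventually_mem_charts hφ.contMDiff hy hy'
    have htarget : ∀ᶠ z in 𝓝 y, ∀ᶠ w in 𝓝 (localRep φ e e' z), w ∈ e'.target :=
      hev.mono fun z hz => e'.open_target.eventually_mem (e'.map_source hz.2)
    refine pd_normSq_tension_eq_zero (c := c) (R := R) ?_ ?_ ?_ ?_ ?_ i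
    · exact hev.mono fun z hz => hI z hz.1 hz.2
    · exact htarget.mono fun z hz => hz.mono fun w hw => isMetricAt_coeff h he' hw
    · exact htarget.mono fun z hz => hz.mono fun w hw u v => hN e' he' w hw u v
    · exact hev.mono fun z hz => hR e he z hz.1
    · refine hev.mono fun z hz j => ?_
      have h1 := hbi e he e' he' (e.symm z) (e.map_target hz.1) hz.2 j
      rwa [e.right_inv hz.1] at h1
  obtain ⟨r, hr, hball⟩ := Metric.eventually_nhds_iff_ball.1 (eventually_mem_charts hφ.contMDiff hx hx')
  filter_upwards [Metric.ball_mem_nhds x hr] with y hy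
  refine (convex_ball x r).is_const_of_fderivWithin_eq_zero (𝕜 := ℝ)
    (fun z hz => (hdiff z (hball z hz).1 (hball z hz).2).differentiableWithinAt) (fun z hz => ?_)
    hy (Metric.mem_ball_self hr)
  rw [fderivWithin_of_isOpen Metric.isOpen_ball hz]
  ext v
  rw [sum_smul_single v, map_sum]
  simp only [map_smul]
  exact Finset.sum_eq_zero fun i _ => by
    rw [show fderiv ℝ (normSqTension g h φ e e') z (EuclideanSpace.single i 1) = 0 from
      hpd z (hball z hz).1 (hball z hz).2 i, smul_zero]

theorem exists_normSqTension_eq [ConnectedSpace M] (hφ : IsIsometricImmersion g h φ) {c : ℝ}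
    (hN : HasConstantSectionalCurvature h c) (hbi : IsBiconservative g h φ)
    (hR : HasConstantScalarCurvature g) :
    ∃ s : ℝ, ∀ p : M, ∀ e ∈ IsManifold.maximalAtlas (𝓡 3) ∞ M,
      ∀ e' ∈ IsManifold.maximalAtlas (𝓡 4) ∞ N, p ∈ e.source → φ p ∈ e'.source →
        normSqTension g h φ e e' (e p) = s := by
  set S : M → ℝ := fun p => normSqTension g h φ (chartAt (E 3) p) (chartAt (E 4) (φ p))
    (chartAt (E 3) p p) with hS
  have hmem : ∀ p : M, chartAt (E 3) p ∈ IsManifold.maximalAtlas (𝓡 3) ∞ M := fun p =>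
    IsManifold.chart_mem_maximalAtlas p
  have hmem' : ∀ q : N, chartAt (E 4) q ∈ IsManifold.maximalAtlas (𝓡 4) ∞ N := fun q =>
    IsManifold.chart_mem_maximalAtlas q
  have hloc : IsLocallyConstant S := by
    refine (IsLocallyConstant.iff_eventually_eq S).2 fun p => ?_
    have hp := mem_chart_source (E 3) p
    have hp' := mem_chart_source (E 4) (φ p)
    have h1 := normSqTension_locally_const hφ hN hbi hR (hmem p) (hmem' (φ p))
      (OpenPartialHomeomorph.map_source _ hp) (map_symm_mem hp hp')
    filter_upwards [((chartAt (E 3) p).continuousAt hp).eventually h1,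
      (chartAt (E 3) p).open_source.mem_nhds hp, hφ.contMDiff.continuous.continuousAt.eventually
        ((chartAt (E 4) (φ p)).open_source.eventually_mem hp')] with q h2 h3 h4
    exact (normSqTension_eq hφ (hmem q) (hmem' (φ q)) (hmem p) (hmem' (φ p))
      (mem_chart_source (E 3) q) (mem_chart_source (E 4) (φ q)) h3 h4).trans h2
  obtain ⟨p₀⟩ : Nonempty M := inferInstance
  refine ⟨S p₀, fun p e he e' he' hp hp' => ?_⟩
  rw [hloc.apply_eq_of_preconnectedSpace p₀ p]
  exact normSqTension_eq hφ he he' (hmem p) (hmem' (φ p)) hp hp' (mem_chart_source (E 3) p)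
    (mem_chart_source (E 4) (φ p))

theorem continuousAt_meanCurvatureAt (hφ : IsIsometricImmersion g h φ)
    (he : e ∈ IsManifold.maximalAtlas (𝓡 3) ∞ M) (he' : e' ∈ IsManifold.maximalAtlas (𝓡 4) ∞ N)
    (hp : p ∈ e.source) (hp' : φ p ∈ e'.source) {ξ : (p : M) → TangentSpace (𝓡 4) (φ p)}
    (hξ : Continuous (fun p => (⟨φ p, ξ p⟩ : TangentBundle (𝓡 4) N))) :
    ContinuousAt (fun q => meanCurvatureAt g h φ e e' q (ξ q)) p := by
  have I := hφ.isIsometricAt he he' (e.map_source hp) (map_symm_mem hp hp')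
  have hinv : ∀ i j, ContinuousAt (fun q => (coeff g e (e q))⁻¹ i j) p := fun i j =>
    ContinuousAt.comp (I.source.rep_invGerm i j).contDiffAt.continuousAt (e.continuousAt hp)
  have hsff : ∀ i j a, ContinuousAt (fun q => secondForm (coeff g e) (coeff h e')
      (localRep φ e e') i j (e q) a) p := fun i j a =>
    ContinuousAt.comp (f := e) (g := fun x => secondForm (coeff g e) (coeff h e')
      (localRep φ e e') i j x a) (I.rep_sff i j a).contDiffAt.continuousAt (e.continuousAt hp)
  have hh : ∀ a b, ContinuousAt (fun q => coeff h e' (localRep φ e e' (e q)) a b) p := fun a b =>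
    ContinuousAt.comp (f := e) (g := fun x => coeff h e' (localRep φ e e' x) a b)
      ((I.target.rep_germ a b).comap I.contDiffAt).contDiffAt.continuousAt (e.continuousAt hp)
  have hc := continuousAt_comps hφ.contMDiff.continuous he' hp' hξ
  refine continuousAt_const.mul (tendsto_finsetSum _ fun i _ => tendsto_finsetSum _ fun j _ =>
    (hinv i j).mul (tendsto_finsetSum _ fun a _ => tendsto_finsetSum _ fun b _ => ?_))
  exact ((hh a b).mul (hsff i j a)).mul (hc b)

/-- A biconservative hypersurface of constant scalar curvature in a space form of dimension `4` has
constant mean curvature. -/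
theorem hasConstantMeanCurvature [ConnectedSpace M] (hφ : IsIsometricImmersion g h φ) {c : ℝ}
    (hN : HasConstantSectionalCurvature h c) (hbi : IsBiconservative g h φ)
    (hR : HasConstantScalarCurvature g) : HasConstantMeanCurvature g h φ := by
  obtain ⟨s, hs⟩ := exists_normSqTension_eq hφ hN hbi hR
  refine ⟨⟨√(s / 9), fun p ν hν e he e' he' hp hp' => ?_⟩, fun ξ hξ hunit => ?_⟩
  · rw [← hs p e he e' he' hp hp', ← meanCurvatureAt_sq hφ he he' hp hp' hν, Real.sqrt_sq_eq_abs]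
  · have hmem : ∀ p : M, chartAt (E 3) p ∈ IsManifold.maximalAtlas (𝓡 3) ∞ M := fun p =>
      IsManifold.chart_mem_maximalAtlas p
    have hmem' : ∀ q : N, chartAt (E 4) q ∈ IsManifold.maximalAtlas (𝓡 4) ∞ N := fun q =>
      IsManifold.chart_mem_maximalAtlas q
    set H : M → ℝ := fun p => meanCurvatureAt g h φ (chartAt (E 3) p) (chartAt (E 4) (φ p)) p (ξ p)
      with hH
    have hH' : ∀ p : M, ∀ e ∈ IsManifold.maximalAtlas (𝓡 3) ∞ M,
        ∀ e' ∈ IsManifold.maximalAtlas (𝓡 4) ∞ N, p ∈ e.source → φ p ∈ e'.source →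
          meanCurvatureAt g h φ e e' p (ξ p) = H p := fun p e he e' he' hp hp' =>
      meanCurvatureAt_eq hφ he he' (hmem p) (hmem' (φ p)) hp hp' (mem_chart_source (E 3) p)
        (mem_chart_source (E 4) (φ p)) (ξ p)
    have hsq : ∀ p, H p ^ 2 = s / 9 := fun p => by
      rw [← hs p _ (hmem p) _ (hmem' (φ p)) (mem_chart_source (E 3) p)
        (mem_chart_source (E 4) (φ p))]
      exact meanCurvatureAt_sq hφ (hmem p) (hmem' (φ p)) (mem_chart_source (E 3) p)
        (mem_chart_source (E 4) (φ p)) (hunit p)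
    have hcont : Continuous H := by
      refine continuous_iff_continuousAt.2 fun p => ?_
      have hp := mem_chart_source (E 3) p
      have hp' := mem_chart_source (E 4) (φ p)
      refine (continuousAt_meanCurvatureAt hφ (hmem p) (hmem' (φ p)) hp hp' hξ).congr ?_
      filter_upwards [(chartAt (E 3) p).open_source.mem_nhds hp,
        hφ.contMDiff.continuous.continuousAt.eventually
          ((chartAt (E 4) (φ p)).open_source.eventually_mem hp')] with q h1 h2
      exact hH' q _ (hmem p) _ (hmem' (φ p)) h1 h2
    obtain ⟨p₀⟩ : Nonempty M := inferInstance
    refine ⟨H p₀, fun p e he e' he' hp hp' => ?_⟩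
    rw [hH' p e he e' he' hp hp']
    by_cases h0 : s = 0
    · have hz : ∀ q, H q = 0 := fun q => by simpa [h0] using hsq q
      rw [hz, hz]
    -- A continuous function with constant nonzero square has constant sign.
    · have hne : H p₀ ≠ 0 := fun hz => h0 (by simpa [hz] using (hsq p₀).symm)
      rcases isPreconnected_univ.eq_or_eq_neg_of_sq_eq hcont.continuousOn
        (continuousOn_const (c := H p₀)) (fun q _ => (hsq q).trans (hsq p₀).symm)
        (fun _ => hne) with h1 | h1
      · exact h1 (Set.mem_univ p)
      · have h2 : H p₀ = -H p₀ := h1 (Set.mem_univ p₀)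
        exact absurd (by linarith) hne

end Global

end Biconservative

end

theorem theorem1 (c : ℝ)
    {N : Type*} [TopologicalSpace N] [ChartedSpace (EuclideanSpace ℝ (Fin 4)) N]
    [IsManifold (𝓡 4) ∞ N] (h : Biconservative.Metric 4 N)
    (hN : Biconservative.HasConstantSectionalCurvature h c)
    {M : Type*} [TopologicalSpace M] [ChartedSpace (EuclideanSpace ℝ (Fin 3)) M]
    [IsManifold (𝓡 3) ∞ M] [ConnectedSpace M] (g : Biconservative.Metric 3 M)
    (φ : M → N) (hφ : Biconservative.IsIsometricImmersion g h φ)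
    (hbi : Biconservative.IsBiconservative g h φ)
    (hR : Biconservative.HasConstantScalarCurvature g) :
    Biconservative.HasConstantMeanCurvature g h φ :=
  Biconservative.hasConstantMeanCurvature hφ hN hbi hR
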